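/- Let $p\in[1,\infty)$, let $G$ be a countable discrete abelian group (with counting measure), let $\hat G$ be its compact dual group with normalized Haar measure $\mu$, let $A$ be a separable unital $L^p$ operator algebra (with $\|1\|=1$) that has unique $L^p$ operator matrix norms, and let $\alpha$ be an action of $G$ on $A$ by isometric automorphisms. (Unique $L^p$ operator matrix norms means: for any two isometric representations of $A$ on separable $L^p$ spaces of $\sigma$-finite measures, all the norms induced on the matrix algebras $M_n(A)$ acting on $L^p(\{1,\dots,n\}\times X)$ coincide.) For a locally compact group $H$ with left Haar measure and a strongly continuous isometric action $\theta$ of $H$ on a Banach algebra $B$, let $F^p(H,B,\theta)$ be the completion of $C_c(H,B)$, with product the twisted convolution $(f*g)(t)=\int_H f(s)\,\theta_s(g(s^{-1}t))\,ds$, in the norm $\|f\|=\sup\|(\pi\rtimes v)(f)\|$. The supremum is over all pairs $(\pi,v)$ of a nondegenerate contractive homomorphism $\pi:B\to\mathcal B(L^p(X,\nu))$, $\nu$ $\sigma$-finite, and a strongly continuous isometric representation $v$ of $H$ on $L^p(X,\nu)$ with $v_t\pi(b)v_{t^{-1}}=\pi(\theta_t(b))$, and $(\pi\rtimes v)(f)\xi=\int_H\pi(f(s))v_s\xi\,ds$.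 Consider the following actions, given by their values on functions and extended by continuity: the dual action $\hat\alpha$ of $\hat G$ on $F^p(G,A,\alpha)$, $\hat\alpha_\gamma(f)(s)=\overline{\gamma(s)}f(s)$; the double dual action $\hat{\hat\alpha}$ of $G$ on $F^p(\hat G,F^p(G,A,\alpha),\hat\alpha)$, $\hat{\hat\alpha}_t(F)(\gamma,s)=\overline{\gamma(t)}F(\gamma,s)$; with $\beta$ the trivial action of $\hat G$ on $A$, the action $\hat\beta\otimes\alpha$ of $G$ on $F^p(\hat G,A,\beta)$, $(\hat\beta\otimes\alpha)_s(\varphi)(\gamma)=\gamma(s)\alpha_s(\varphi(\gamma))$; the actions $\mathrm{lt}\otimes\alpha$ and $\mathrm{lt}\otimes\mathrm{id}$ of $G$ on $C_0(G,A)$, $(\mathrm{lt}\otimes\alpha)_t f(s)=\alpha_t(f(t^{-1}s))$ and $(\mathrm{lt}\otimes\mathrm{id})_t f(s)=f(t^{-1}s)$; and the action $(\mathrm{rt}\otimes\alpha)\otimes\mathrm{id}$ of $G$ on $F^p(G,C_0(G,A),\mathrm{lt}\otimes\mathrm{id})$, $(((\mathrm{rt}\otimes\alpha)\otimes\mathrm{id})_rF)(s,t)=\alpha_r(F(s,tr))$.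 Then there are unique continuous algebra homomorphisms $$F^p(\hat G,F^p(G,A,\alpha),\hat\alpha)\xrightarrow{\Phi_1}F^p(G,F^p(\hat G,A,\beta),\hat\beta\otimes\alpha)\xrightarrow{\Phi_2}F^p(G,C_0(G,A),\mathrm{lt}\otimes\alpha)\xrightarrow{\Phi_3}F^p(G,C_0(G,A),\mathrm{lt}\otimes\mathrm{id})$$ such that $\Phi_1(F)(s,\gamma)=\gamma(s)F(\gamma,s)$ for $F\in C_c(\hat G\times G,A)$, $\Phi_2(F)(s,t)=\int_{\hat G}F(s,\gamma)\overline{\gamma(t)}\,d\mu(\gamma)$ for $F\in C_c(G\times\hat G,A)$, and $\Phi_3(F)(s,t)=\alpha_t^{-1}(F(s,t))$ for $F\in C_c(G,C_0(G,A))$; and for every $r\in G$ $$(\Phi_3\circ\Phi_2\circ\Phi_1)\circ\hat{\hat\alpha}_r=((\mathrm{rt}\otimes\alpha)\otimes\mathrm{id})_r\circ(\Phi_3\circ\Phi_2\circ\Phi_1)$$ on all of $F^p(\hat G,F^p(G,A,\alpha),\hat\alpha)$. -/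

import Mathlib

open MeasureTheory Topology UniformSpace
open scoped ENNReal CompactlySupported ZeroAtInfty

universe u

noncomputable section


namespace LpCrossed

/-! ### Isometric actions on Banach algebras -/

/-- A strongly continuous action of a topological group `H` on a (not necessarily unital) complex
Banach algebra `B` by isometric algebra automorphisms: a continuous homomorphism from `H` to the
group of isometric automorphisms of `B`. -/
structure IsometricAction (H B : Type u) [Group H] [TopologicalSpace H]
    [NonUnitalNormedRing B] [NormedSpace ℂ B] where
  act : H → B →ₙₐ[ℂ] B
  act_one : ∀ b, act 1 b = b
  act_mul : ∀ s t b, act (s * t) b = act s (act t b)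
  norm_act : ∀ s b, ‖act s b‖ = ‖b‖
  continuous_act : ∀ b, Continuous fun s => act s b

section General

variable {H B : Type u} [Group H] [TopologicalSpace H]
  [NonUnitalNormedRing B] [NormedSpace ℂ B]

/-- The trivial action. -/
def trivialAction (H B : Type u) [Group H] [TopologicalSpace H]
    [NonUnitalNormedRing B] [NormedSpace ℂ B] : IsometricAction H B where
  act _ := 1
  act_one _ := rfl
  act_mul _ _ _ := rfl
  norm_act _ _ := rfl
  continuous_act _ := continuous_const

theorem IsometricAction.act_inv_act (α : IsometricAction H B) (s : H) (b : B) :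
    α.act s⁻¹ (α.act s b) = b := by
  rw [← α.act_mul, inv_mul_cancel, α.act_one]

theorem IsometricAction.act_act_inv (α : IsometricAction H B) (s : H) (b : B) :
    α.act s (α.act s⁻¹ b) = b := by
  rw [← α.act_mul, mul_inv_cancel, α.act_one]

theorem continuous_of_isometries {X E F : Type*} [TopologicalSpace X] [SeminormedAddCommGroup E]
    [SeminormedAddCommGroup F] (T : X → E → F) (hsub : ∀ x a b, T x (a - b) = T x a - T x b)
    (hn : ∀ x a, ‖T x a‖ ≤ ‖a‖) (hc : ∀ a, Continuous fun x => T x a) :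
    Continuous fun q : X × E => T q.1 q.2 := by
  rw [continuous_iff_continuousAt]
  rintro ⟨x, a⟩
  have h1 : Filter.Tendsto (fun q : X × E => T q.1 a) (𝓝 (x, a)) (𝓝 (T x a)) :=
    ((hc a).comp continuous_fst).continuousAt
  have h2 : Filter.Tendsto (fun q : X × E => T q.1 (q.2 - a)) (𝓝 (x, a)) (𝓝 0) := by
    refine squeeze_zero_norm (a := fun q : X × E => ‖q.2 - a‖) (fun q => hn q.1 (q.2 - a)) ?_
    have : Continuous fun q : X × E => ‖q.2 - a‖ := by fun_prop
    simpa using this.tendsto (x, a)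
  have := h2.add h1
  simpa [hsub, ContinuousAt] using this

theorem IsometricAction.continuous_uncurry (α : IsometricAction H B) :
    Continuous fun q : H × B => α.act q.1 q.2 :=
  continuous_of_isometries (fun s b => α.act s b) (fun s a b => map_sub (α.act s) a b)
    (fun s b => (α.norm_act s b).le) α.continuous_act

/-- The isometric automorphism `act s` as a continuous linear map. -/
def IsometricAction.clm (α : IsometricAction H B) (s : H) : B →L[ℂ] B :=
  LinearMap.mkContinuous
    { toFun := α.act s
      map_add' := map_add (α.act s)
      map_smul' := fun c b => map_smul (α.act s) c b } 1
    (fun b => by simpa using (α.norm_act s b).le)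

theorem continuous_dual_eval {H : Type u} [Group H] [TopologicalSpace H]
    [LocallyCompactSpace H] :
    Continuous fun q : PontryaginDual H × H => q.1 q.2 := by
  have h : Continuous fun γ : H →ₜ* Circle => (γ : C(H, Circle)) :=
    (ContinuousMonoidHom.isInducing_toContinuousMap H Circle).continuous
  exact (h.comp continuous_fst).eval continuous_snd

/-! ### Covariant representations on `L^p` spaces -/

/-- A nondegenerate `σ`-finite contractive covariant representation `(π, v)` of the dynamical
system `(H, B, α)` on a space `L^p(X, ν)`: `π` is a nondegenerate contractive homomorphism,
`v` a (strongly continuous) isometric group representation, and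
`v_t π(b) v_{t⁻¹} = π(α_t(b))`. -/
structure CovRep (p : ℝ≥0∞) [Fact (1 ≤ p)] (α : IsometricAction H B) where
  X : Type u
  [mX : MeasurableSpace X]
  ν : Measure X
  [sigmaFinite : SigmaFinite ν]
  π : B →ₙₐ[ℂ] (Lp ℂ p ν →L[ℂ] Lp ℂ p ν)
  v : H →* (Lp ℂ p ν →L[ℂ] Lp ℂ p ν)
  norm_π_le : ∀ b, ‖π b‖ ≤ ‖b‖
  nondegenerate : Dense (Submodule.span ℂ {η | ∃ b ξ, η = π b ξ} : Set (Lp ℂ p ν))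
  norm_v : ∀ s ξ, ‖v s ξ‖ = ‖ξ‖
  continuous_v : ∀ ξ, Continuous fun s => v s ξ
  covariant : ∀ t b, v t * π b * v t⁻¹ = π (α.act t b)

attribute [instance] CovRep.mX CovRep.sigmaFinite

variable {p : ℝ≥0∞} [Fact (1 ≤ p)] {α : IsometricAction H B}

/-- The `L^p` space on which a covariant representation acts. -/
abbrev CovRep.E (ρ : CovRep p α) : Type u := Lp ℂ p ρ.ν

theorem CovRep.norm_π_apply_le (ρ : CovRep p α) (b : B) (ξ : ρ.E) : ‖ρ.π b ξ‖ ≤ ‖b‖ * ‖ξ‖ :=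
  (ρ.π b).le_of_opNorm_le (ρ.norm_π_le b) ξ

/-- The representation `π` as a continuous linear map. -/
def CovRep.πL (ρ : CovRep p α) : B →L[ℂ] (ρ.E →L[ℂ] ρ.E) :=
  LinearMap.mkContinuous
    { toFun := ρ.π
      map_add' := map_add ρ.π
      map_smul' := fun c b => map_smul ρ.π c b } 1
    (fun b => by simpa using ρ.norm_π_le b)

theorem CovRep.continuous_π (ρ : CovRep p α) : Continuous ρ.π := ρ.πL.continuous

theorem CovRep.continuous_v_uncurry (ρ : CovRep p α) :
    Continuous fun q : H × ρ.E => ρ.v q.1 q.2 :=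
  continuous_of_isometries (fun s ξ => ρ.v s ξ) (fun s a b => map_sub (ρ.v s) a b)
    (fun s ξ => (ρ.norm_v s ξ).le) ρ.continuous_v

theorem CovRep.v_π (ρ : CovRep p α) (t : H) (b : B) (ξ : ρ.E) :
    ρ.v t (ρ.π b ξ) = ρ.π (α.act t b) (ρ.v t ξ) := by
  rw [← ρ.covariant]
  change _ = ρ.v t (ρ.π b (ρ.v t⁻¹ (ρ.v t ξ)))
  have : ρ.v t⁻¹ (ρ.v t ξ) = ξ := by
    change (ρ.v t⁻¹ * ρ.v t) ξ = ξ
    rw [← map_mul]; simp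
  rw [this]

/-! ### The integrated form and the universal seminorm on `C_c(H, B)` -/

variable [MeasurableSpace H] [BorelSpace H]

theorem CovRep.continuous_integrand (ρ : CovRep p α) (f : C_c(H, B)) (ξ : ρ.E) :
    Continuous fun s => ρ.π (f s) (ρ.v s ξ) :=
  (ρ.continuous_π.comp (map_continuous f)).clm_apply (ρ.continuous_v ξ)

theorem CovRep.hasCompactSupport_integrand (ρ : CovRep p α) (f : C_c(H, B)) (ξ : ρ.E) :
    HasCompactSupport fun s => ρ.π (f s) (ρ.v s ξ) := by
  refine f.hasCompactSupport.mono ?_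
  intro s hs h0
  apply hs
  simp [h0]

theorem CovRep.integrable_integrand (ρ : CovRep p α) (μ : Measure H)
    [IsFiniteMeasureOnCompacts μ] (f : C_c(H, B)) (ξ : ρ.E) :
    Integrable (fun s => ρ.π (f s) (ρ.v s ξ)) μ :=
  (ρ.continuous_integrand f ξ).integrable_of_hasCompactSupport (ρ.hasCompactSupport_integrand f ξ)

theorem integrable_norm_Cc (μ : Measure H) [IsFiniteMeasureOnCompacts μ] (f : C_c(H, B)) :
    Integrable (fun s => ‖f s‖) μ :=
  (map_continuous f).norm.integrable_of_hasCompactSupport f.hasCompactSupport.norm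

theorem CovRep.norm_integral_le (ρ : CovRep p α) (μ : Measure H)
    [IsFiniteMeasureOnCompacts μ] (f : C_c(H, B)) (ξ : ρ.E) :
    ‖∫ s, ρ.π (f s) (ρ.v s ξ) ∂μ‖ ≤ (∫ s, ‖f s‖ ∂μ) * ‖ξ‖ := by
  refine (norm_integral_le_integral_norm _).trans ?_
  rw [← integral_mul_const]
  refine integral_mono (ρ.integrable_integrand μ f ξ).norm
    ((integrable_norm_Cc μ f).mul_const _) fun s => ?_
  simpa [ρ.norm_v] using ρ.norm_π_apply_le (f s) (ρ.v s ξ)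

/-- The integrated form `(π ⋊ v)(f) ξ = ∫ π(f(s)) v_s(ξ) dμ(s)`. -/
def CovRep.integrated (ρ : CovRep p α) (μ : Measure H) [IsFiniteMeasureOnCompacts μ]
    (f : C_c(H, B)) : ρ.E →L[ℂ] ρ.E :=
  LinearMap.mkContinuous
    { toFun := fun ξ => ∫ s, ρ.π (f s) (ρ.v s ξ) ∂μ
      map_add' := fun ξ η => by
        simp only [map_add]
        exact integral_add (ρ.integrable_integrand μ f ξ) (ρ.integrable_integrand μ f η)
      map_smul' := fun c ξ => by
        simp only [map_smul, RingHom.id_apply]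
        exact integral_smul c _ }
    (∫ s, ‖f s‖ ∂μ) (ρ.norm_integral_le μ f)

theorem CovRep.integrated_apply (ρ : CovRep p α) (μ : Measure H) [IsFiniteMeasureOnCompacts μ]
    (f : C_c(H, B)) (ξ : ρ.E) :
    ρ.integrated μ f ξ = ∫ s, ρ.π (f s) (ρ.v s ξ) ∂μ := rfl

theorem CovRep.norm_integrated_le (ρ : CovRep p α) (μ : Measure H) [IsFiniteMeasureOnCompacts μ]
    (f : C_c(H, B)) : ‖ρ.integrated μ f‖ ≤ ∫ s, ‖f s‖ ∂μ :=
  LinearMap.mkContinuous_norm_le _ (integral_nonneg fun _ => norm_nonneg _) _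

theorem CovRep.integrated_add (ρ : CovRep p α) (μ : Measure H) [IsFiniteMeasureOnCompacts μ]
    (f g : C_c(H, B)) : ρ.integrated μ (f + g) = ρ.integrated μ f + ρ.integrated μ g := by
  ext1 ξ
  simp only [CovRep.integrated_apply, _root_.add_apply,
    CompactlySupportedContinuousMap.add_apply, map_add]
  exact integral_add (ρ.integrable_integrand μ f ξ) (ρ.integrable_integrand μ g ξ)

theorem CovRep.integrated_smul (ρ : CovRep p α) (μ : Measure H) [IsFiniteMeasureOnCompacts μ]
    (c : ℂ) (f : C_c(H, B)) : ρ.integrated μ (c • f) = c • ρ.integrated μ f := by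
  ext1 ξ
  simp only [CovRep.integrated_apply, _root_.smul_apply,
    CompactlySupportedContinuousMap.smul_apply, map_smul]
  exact integral_smul c _

/-- The norm `‖f‖ = sup {‖(π ⋊ v)(f)‖}` over all nondegenerate `σ`-finite contractive covariant
representations on `L^p` spaces. -/
def universalNorm (p : ℝ≥0∞) [Fact (1 ≤ p)] (μ : Measure H) [IsFiniteMeasureOnCompacts μ]
    (α : IsometricAction H B) (f : C_c(H, B)) : ℝ :=
  ⨆ ρ : CovRep p α, ‖ρ.integrated μ f‖

theorem CovRep.norm_integrated_le_universalNorm (ρ : CovRep p α) (μ : Measure H)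
    [IsFiniteMeasureOnCompacts μ] (f : C_c(H, B)) :
    ‖ρ.integrated μ f‖ ≤ universalNorm p μ α f :=
  le_ciSup (f := fun ρ : CovRep p α => ‖ρ.integrated μ f‖)
    ⟨_, by rintro _ ⟨ρ, rfl⟩; exact ρ.norm_integrated_le μ f⟩ ρ

theorem universalNorm_le {μ : Measure H} [IsFiniteMeasureOnCompacts μ] {f : C_c(H, B)} {C : ℝ}
    (hC : 0 ≤ C) (h : ∀ ρ : CovRep p α, ‖ρ.integrated μ f‖ ≤ C) : universalNorm p μ α f ≤ C :=
  Real.iSup_le h hC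

theorem universalNorm_nonneg (p : ℝ≥0∞) [Fact (1 ≤ p)] (μ : Measure H)
    [IsFiniteMeasureOnCompacts μ] (α : IsometricAction H B) (f : C_c(H, B)) :
    0 ≤ universalNorm p μ α f :=
  Real.iSup_nonneg fun _ => norm_nonneg _

theorem universalNorm_le_integral (p : ℝ≥0∞) [Fact (1 ≤ p)] (μ : Measure H)
    [IsFiniteMeasureOnCompacts μ] (α : IsometricAction H B) (f : C_c(H, B)) :
    universalNorm p μ α f ≤ ∫ s, ‖f s‖ ∂μ :=
  universalNorm_le (integral_nonneg fun _ => norm_nonneg _) fun ρ => ρ.norm_integrated_le μ f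

/-- The universal norm, as a seminorm. -/
def universalSeminorm (p : ℝ≥0∞) [Fact (1 ≤ p)] (μ : Measure H) [IsFiniteMeasureOnCompacts μ]
    (α : IsometricAction H B) : Seminorm ℂ C_c(H, B) :=
  Seminorm.ofSMulLE (universalNorm p μ α)
    (le_antisymm ((universalNorm_le_integral p μ α 0).trans (by simp))
      (universalNorm_nonneg p μ α 0))
    (fun f g => universalNorm_le
      (add_nonneg (universalNorm_nonneg p μ α f) (universalNorm_nonneg p μ α g)) fun ρ => by
        rw [ρ.integrated_add]
        exact (norm_add_le _ _).trans (add_le_add (ρ.norm_integrated_le_universalNorm μ f)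
          (ρ.norm_integrated_le_universalNorm μ g)))
    (fun c f => universalNorm_le
      (mul_nonneg (norm_nonneg c) (universalNorm_nonneg p μ α f)) fun ρ => by
        rw [ρ.integrated_smul, norm_smul]
        exact mul_le_mul_of_nonneg_left (ρ.norm_integrated_le_universalNorm μ f) (norm_nonneg c))

/-- The space `C_c(H, B, α)`, that is `C_c(H, B)` equipped with the universal norm. -/
def PreCrossed (p : ℝ≥0∞) [Fact (1 ≤ p)] (μ : Measure H) [IsFiniteMeasureOnCompacts μ]
    (_α : IsometricAction H B) : Type u := C_c(H, B)

instance (μ : Measure H) [IsFiniteMeasureOnCompacts μ] : AddCommGroup (PreCrossed p μ α) :=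
  inferInstanceAs (AddCommGroup C_c(H, B))

instance (μ : Measure H) [IsFiniteMeasureOnCompacts μ] : Module ℂ (PreCrossed p μ α) :=
  inferInstanceAs (Module ℂ C_c(H, B))

instance (μ : Measure H) [IsFiniteMeasureOnCompacts μ] :
    SeminormedAddCommGroup (PreCrossed p μ α) :=
  AddGroupSeminorm.toSeminormedAddCommGroup
    (E := PreCrossed p μ α) (universalSeminorm p μ α).toAddGroupSeminorm

instance (μ : Measure H) [IsFiniteMeasureOnCompacts μ] : NormedSpace ℂ (PreCrossed p μ α) where
  norm_smul_le c f := (map_smul_eq_mul (universalSeminorm p μ α) c f).le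

end General

/-- The full `L^p` operator crossed product `F^p(H, B, α)` (with respect to the Haar measure `μ`
on `H`): the completion of `C_c(H, B, α)` in the universal norm. -/
def Crossed {H B : Type u} [Group H] [TopologicalSpace H]
    [NonUnitalNormedRing B] [NormedSpace ℂ B] [MeasurableSpace H] [BorelSpace H]
    (p : ℝ≥0∞) [Fact (1 ≤ p)] (μ : Measure H) [IsFiniteMeasureOnCompacts μ]
    (α : IsometricAction H B) : Type u := Completion (PreCrossed p μ α)

/-! ### Twisted convolution and the Banach algebra structure of `F^p(H, B, α)` -/

section Algebra

variable {H B : Type u} [Group H] [TopologicalSpace H] [IsTopologicalGroup H]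
  [MeasurableSpace H] [BorelSpace H]
  [NonUnitalNormedRing B] [NormedSpace ℂ B] [IsScalarTower ℂ B B] [SMulCommClass ℂ B B]
  [CompleteSpace B]
  {p : ℝ≥0∞} [Fact (1 ≤ p)] {α : IsometricAction H B}

theorem convolution_integrand_eq_zero (α : IsometricAction H B) (f g : C_c(H, B)) {s t : H}
    (h : ¬ (s ∈ tsupport f ∧ s⁻¹ * t ∈ tsupport g)) : f s * α.act s (g (s⁻¹ * t)) = 0 := by
  by_cases hs : s ∈ tsupport f
  · rw [image_eq_zero_of_notMem_tsupport fun ht => h ⟨hs, ht⟩]; simp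
  · rw [image_eq_zero_of_notMem_tsupport hs]; simp

theorem continuous_convolution_integrand (α : IsometricAction H B) (f g : C_c(H, B)) :
    Continuous fun q : H × H => f q.2 * α.act q.2 (g (q.2⁻¹ * q.1)) := by
  have hf : Continuous f := map_continuous f
  have hg : Continuous g := map_continuous g
  exact (hf.comp continuous_snd).mul (α.continuous_uncurry.comp
    (continuous_snd.prodMk (hg.comp (by fun_prop))))

/-- Twisted convolution `(f * g)(t) = ∫ f(s) α_s(g(s⁻¹ t)) dμ(s)` on `C_c(H, B)`. -/
def convolution (μ : Measure H) [IsFiniteMeasureOnCompacts μ] (α : IsometricAction H B)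
    (f g : C_c(H, B)) : C_c(H, B) where
  toFun t := ∫ s, f s * α.act s (g (s⁻¹ * t)) ∂μ
  continuous_toFun := by
    rw [← continuousOn_univ]
    refine continuousOn_integral_of_compact_support (k := tsupport f) f.hasCompactSupport
      (continuous_convolution_integrand α f g).continuousOn ?_
    intro t s _ hs
    exact convolution_integrand_eq_zero α f g fun h => hs h.1
  hasCompactSupport' := by
    refine HasCompactSupport.intro (f.hasCompactSupport.isCompact.mul
      g.hasCompactSupport.isCompact) fun t ht => ?_
    have : ∀ s, f s * α.act s (g (s⁻¹ * t)) = 0 := fun s =>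
      convolution_integrand_eq_zero α f g fun h =>
        ht ⟨s, h.1, s⁻¹ * t, h.2, mul_inv_cancel_left s t⟩
    simp [this]

theorem convolution_apply (μ : Measure H) [IsFiniteMeasureOnCompacts μ]
    (α : IsometricAction H B) (f g : C_c(H, B)) (t : H) :
    convolution μ α f g t = ∫ s, f s * α.act s (g (s⁻¹ * t)) ∂μ := rfl

theorem integrable_convolution (μ : Measure H) [IsFiniteMeasureOnCompacts μ]
    (α : IsometricAction H B) (f g : C_c(H, B)) (t : H) :
    Integrable (fun s => f s * α.act s (g (s⁻¹ * t))) μ := by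
  refine ((continuous_convolution_integrand α f g).comp
    (continuous_const.prodMk continuous_id)).integrable_of_hasCompactSupport ?_
  refine f.hasCompactSupport.mono ?_
  intro s hs h0
  exact hs (by simp [h0])

theorem convolution_add (μ : Measure H) [IsFiniteMeasureOnCompacts μ]
    (α : IsometricAction H B) (f g h : C_c(H, B)) :
    convolution μ α f (g + h) = convolution μ α f g + convolution μ α f h := by
  ext t
  simp only [convolution_apply, CompactlySupportedContinuousMap.add_apply, map_add, mul_add]
  exact integral_add (integrable_convolution μ α f g t) (integrable_convolution μ α f h t)

theorem add_convolution (μ : Measure H) [IsFiniteMeasureOnCompacts μ]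
    (α : IsometricAction H B) (f g h : C_c(H, B)) :
    convolution μ α (f + g) h = convolution μ α f h + convolution μ α g h := by
  ext t
  simp only [convolution_apply, CompactlySupportedContinuousMap.add_apply, add_mul]
  exact integral_add (integrable_convolution μ α f h t) (integrable_convolution μ α g h t)

theorem smul_convolution (μ : Measure H) [IsFiniteMeasureOnCompacts μ]
    (α : IsometricAction H B) (c : ℂ) (f g : C_c(H, B)) :
    convolution μ α (c • f) g = c • convolution μ α f g := by
  ext t
  simp only [convolution_apply, CompactlySupportedContinuousMap.smul_apply, smul_mul_assoc]
  exact integral_smul c _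

theorem convolution_smul (μ : Measure H) [IsFiniteMeasureOnCompacts μ]
    (α : IsometricAction H B) (c : ℂ) (f g : C_c(H, B)) :
    convolution μ α f (c • g) = c • convolution μ α f g := by
  ext t
  simp only [convolution_apply, CompactlySupportedContinuousMap.smul_apply, map_smul,
    mul_smul_comm]
  exact integral_smul c _

/-- The integrated form is multiplicative. -/
theorem CovRep.integrated_convolution (ρ : CovRep p α) (μ : Measure H)
    [IsFiniteMeasureOnCompacts μ] [μ.IsMulLeftInvariant] (f g : C_c(H, B)) :
    ρ.integrated μ (convolution μ α f g) = ρ.integrated μ f * ρ.integrated μ g := by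
  ext1 ξ
  change ∫ t, ρ.π (∫ s, f s * α.act s (g (s⁻¹ * t)) ∂μ) (ρ.v t ξ) ∂μ =
    ∫ s, ρ.π (f s) (ρ.v s (∫ t, ρ.π (g t) (ρ.v t ξ) ∂μ)) ∂μ
  have h1 : ∀ t, ρ.π (∫ s, f s * α.act s (g (s⁻¹ * t)) ∂μ) (ρ.v t ξ) =
      ∫ s, ρ.π (f s * α.act s (g (s⁻¹ * t))) (ρ.v t ξ) ∂μ := fun t =>
    ((ρ.πL.flip (ρ.v t ξ)).integral_comp_comm (integrable_convolution μ α f g t)).symm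
  simp only [h1]
  rw [integral_integral_swap_of_hasCompactSupport]
  · congr 1
    ext1 s
    rw [← integral_mul_left_eq_self _ s]
    have h2 : ∀ t, ρ.π (f s * α.act s (g (s⁻¹ * (s * t)))) (ρ.v (s * t) ξ) =
        ((ρ.π (f s)).comp (ρ.v s)) (ρ.π (g t) (ρ.v t ξ)) := by
      intro t
      rw [inv_mul_cancel_left, map_mul, map_mul]
      change ρ.π (f s) (ρ.π (α.act s (g t)) (ρ.v s (ρ.v t ξ))) = ρ.π (f s) (ρ.v s _)
      rw [ρ.v_π]
    simp only [h2]
    exact ((ρ.π (f s)).comp (ρ.v s)).integral_comp_comm (ρ.integrable_integrand μ g ξ)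
  · exact (ρ.continuous_π.comp (continuous_convolution_integrand α f g)).clm_apply
      ((ρ.continuous_v ξ).comp continuous_fst)
  · refine HasCompactSupport.intro ((f.hasCompactSupport.isCompact.mul
      g.hasCompactSupport.isCompact).prod f.hasCompactSupport.isCompact) ?_
    rintro ⟨t, s⟩ hts
    have : f s * α.act s (g (s⁻¹ * t)) = 0 :=
      convolution_integrand_eq_zero α f g fun h =>
        hts ⟨⟨s, h.1, s⁻¹ * t, h.2, mul_inv_cancel_left s t⟩, h.1⟩
    simp [Function.uncurry, this]

variable {μ : Measure H} [IsFiniteMeasureOnCompacts μ]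

/-- A function in `C_c(H, B)` as an element of the normed space `C_c(H, B, α)`. -/
def PreCrossed.of (p : ℝ≥0∞) [Fact (1 ≤ p)] (μ : Measure H) [IsFiniteMeasureOnCompacts μ]
    (α : IsometricAction H B) : C_c(H, B) →ₗ[ℂ] PreCrossed p μ α := LinearMap.id

theorem PreCrossed.norm_of (f : C_c(H, B)) :
    ‖PreCrossed.of p μ α f‖ = universalNorm p μ α f := rfl

instance : NormedAddCommGroup (Crossed p μ α) :=
  inferInstanceAs (NormedAddCommGroup (Completion (PreCrossed p μ α)))

instance : NormedSpace ℂ (Crossed p μ α) :=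
  inferInstanceAs (NormedSpace ℂ (Completion (PreCrossed p μ α)))

instance : CompleteSpace (Crossed p μ α) :=
  inferInstanceAs (CompleteSpace (Completion (PreCrossed p μ α)))

/-- The canonical map `C_c(H, B) → F^p(H, B, α)`. -/
def Crossed.of (p : ℝ≥0∞) [Fact (1 ≤ p)] (μ : Measure H) [IsFiniteMeasureOnCompacts μ]
    (α : IsometricAction H B) : C_c(H, B) →ₗ[ℂ] Crossed p μ α :=
  (Completion.toComplₗᵢ (𝕜 := ℂ) (E := PreCrossed p μ α)).toLinearMap ∘ₗ PreCrossed.of p μ α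

theorem Crossed.norm_of (f : C_c(H, B)) : ‖Crossed.of p μ α f‖ = universalNorm p μ α f :=
  Completion.norm_coe (PreCrossed.of p μ α f)

theorem Crossed.norm_of_le (f : C_c(H, B)) : ‖Crossed.of p μ α f‖ ≤ ∫ s, ‖f s‖ ∂μ :=
  (Crossed.norm_of f).le.trans (universalNorm_le_integral p μ α f)

theorem Crossed.denseRange_of : DenseRange (Crossed.of p μ α) :=
  Completion.denseRange_coe (α := PreCrossed p μ α)

theorem Crossed.induction_on {P : Crossed p μ α → Prop} (x : Crossed p μ α)
    (hc : IsClosed {x | P x}) (h : ∀ f, P (Crossed.of p μ α f)) : P x :=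
  Crossed.denseRange_of.induction_on x hc h

/-- Functions with the same image under every integrated form agree in `F^p(H, B, α)`. -/
theorem Crossed.of_eq_of {f g : C_c(H, B)}
    (h : ∀ ρ : CovRep p α, ρ.integrated μ f = ρ.integrated μ g) :
    Crossed.of p μ α f = Crossed.of p μ α g := by
  rw [← sub_eq_zero, ← map_sub, ← norm_le_zero_iff, Crossed.norm_of]
  refine universalNorm_le le_rfl fun ρ => ?_
  have : f - g = f + (-1 : ℂ) • g := by ext; simp [sub_eq_add_neg]
  rw [this, ρ.integrated_add, ρ.integrated_smul, h]
  simp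

theorem Crossed.clm_ext {E : Type*} [NormedAddCommGroup E] [NormedSpace ℂ E]
    {S T : Crossed p μ α →L[ℂ] E}
    (h : ∀ f, S (Crossed.of p μ α f) = T (Crossed.of p μ α f)) : S = T :=
  DFunLike.coe_injective (Crossed.denseRange_of.equalizer S.continuous T.continuous (funext h))

/-- Extension of a bounded linear map on `C_c(H, B, α)` to `F^p(H, B, α)`. -/
def Crossed.lift {E : Type*} [NormedAddCommGroup E] [NormedSpace ℂ E] [CompleteSpace E]
    (T : C_c(H, B) →ₗ[ℂ] E) (C : ℝ) (hT : ∀ f, ‖T f‖ ≤ C * universalNorm p μ α f) :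
    Crossed p μ α →L[ℂ] E :=
  (LinearMap.mkContinuous (E := PreCrossed p μ α) T C hT).extend
    (Completion.toComplL (𝕜 := ℂ) (E := PreCrossed p μ α))

theorem Crossed.lift_of {E : Type*} [NormedAddCommGroup E] [NormedSpace ℂ E] [CompleteSpace E]
    (T : C_c(H, B) →ₗ[ℂ] E) (C : ℝ) (hT : ∀ f, ‖T f‖ ≤ C * universalNorm p μ α f)
    (f : C_c(H, B)) :
    Crossed.lift T C hT (Crossed.of p μ α f) = T f :=
  ContinuousLinearMap.extend_eq _ (Completion.denseRange_coe (α := PreCrossed p μ α))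
    (Completion.isUniformInducing_coe _) _

theorem Crossed.norm_lift_le {E : Type*} [NormedAddCommGroup E] [NormedSpace ℂ E]
    [CompleteSpace E] (T : C_c(H, B) →ₗ[ℂ] E) (C : ℝ)
    (hT : ∀ f, ‖T f‖ ≤ C * universalNorm p μ α f) (x : Crossed p μ α) :
    ‖Crossed.lift T C hT x‖ ≤ C * ‖x‖ := by
  induction x using Crossed.induction_on with
  | hc => exact isClosed_le (by fun_prop) (by fun_prop)
  | h f => rw [Crossed.lift_of, Crossed.norm_of]; exact hT f

variable [μ.IsMulLeftInvariant]

theorem universalNorm_convolution_le (f g : C_c(H, B)) :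
    universalNorm p μ α (convolution μ α f g) ≤
      universalNorm p μ α f * universalNorm p μ α g :=
  universalNorm_le (mul_nonneg (universalNorm_nonneg p μ α f) (universalNorm_nonneg p μ α g))
    fun ρ => by
      rw [ρ.integrated_convolution]
      exact (norm_mul_le _ _).trans (mul_le_mul (ρ.norm_integrated_le_universalNorm μ f)
        (ρ.norm_integrated_le_universalNorm μ g) (norm_nonneg _) (universalNorm_nonneg p μ α f))

/-- Left multiplication by an element of `C_c(H, B, α)` on `F^p(H, B, α)`. -/
def Crossed.mulLeft (f : C_c(H, B)) : Crossed p μ α →L[ℂ] Crossed p μ α :=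
  Crossed.lift
    { toFun := fun g => Crossed.of p μ α (convolution μ α f g)
      map_add' := fun g h => by rw [convolution_add, map_add]
      map_smul' := fun c g => by rw [convolution_smul, map_smul]; rfl }
    (universalNorm p μ α f)
    (fun g => (Crossed.norm_of _).le.trans (universalNorm_convolution_le f g))

theorem Crossed.mulLeft_of (f g : C_c(H, B)) :
    Crossed.mulLeft f (Crossed.of p μ α g) = Crossed.of p μ α (convolution μ α f g) :=
  Crossed.lift_of _ _ _ _

theorem Crossed.norm_mulLeft_le (f : C_c(H, B)) :
    ‖Crossed.mulLeft (p := p) (μ := μ) (α := α) f‖ ≤ universalNorm p μ α f :=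
  ContinuousLinearMap.opNorm_le_bound _ (universalNorm_nonneg p μ α f)
    (Crossed.norm_lift_le _ _ _)

theorem Crossed.mulLeft_add (f g : C_c(H, B)) :
    Crossed.mulLeft (p := p) (μ := μ) (α := α) (f + g) =
      Crossed.mulLeft f + Crossed.mulLeft g :=
  Crossed.clm_ext fun k => by
    rw [_root_.add_apply, mulLeft_of, mulLeft_of, mulLeft_of, add_convolution, map_add]

theorem Crossed.mulLeft_smul (c : ℂ) (f : C_c(H, B)) :
    Crossed.mulLeft (p := p) (μ := μ) (α := α) (c • f) = c • Crossed.mulLeft f :=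
  Crossed.clm_ext fun k => by
    rw [_root_.smul_apply, mulLeft_of, mulLeft_of, smul_convolution, map_smul]

/-- The product of `F^p(H, B, α)`, as a continuous bilinear map. -/
def Crossed.mulL : Crossed p μ α →L[ℂ] Crossed p μ α →L[ℂ] Crossed p μ α :=
  Crossed.lift
    { toFun := fun f => Crossed.mulLeft f
      map_add' := Crossed.mulLeft_add
      map_smul' := Crossed.mulLeft_smul }
    1 (fun f => (Crossed.norm_mulLeft_le f).trans_eq (one_mul _).symm)

instance : Mul (Crossed p μ α) := ⟨fun x y => Crossed.mulL x y⟩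

theorem Crossed.mul_def (x y : Crossed p μ α) : x * y = Crossed.mulL x y := rfl

theorem Crossed.of_mul_of (f g : C_c(H, B)) :
    Crossed.of p μ α f * Crossed.of p μ α g = Crossed.of p μ α (convolution μ α f g) := by
  rw [Crossed.mul_def, Crossed.mulL, Crossed.lift_of]
  exact Crossed.mulLeft_of f g

theorem Crossed.mul_assoc_aux (x y z : Crossed p μ α) : x * y * z = x * (y * z) := by
  induction x using Crossed.induction_on with
  | hc =>
    simp only [Crossed.mul_def]
    exact isClosed_eq (by fun_prop) (by fun_prop)
  | h f =>
    induction y using Crossed.induction_on with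
    | hc =>
      simp only [Crossed.mul_def]
      exact isClosed_eq (by fun_prop) (by fun_prop)
    | h g =>
      induction z using Crossed.induction_on with
      | hc =>
        simp only [Crossed.mul_def]
        exact isClosed_eq (by fun_prop) (by fun_prop)
      | h k =>
        rw [Crossed.of_mul_of, Crossed.of_mul_of, Crossed.of_mul_of, Crossed.of_mul_of]
        refine Crossed.of_eq_of fun ρ => ?_
        simp only [ρ.integrated_convolution, mul_assoc]

theorem Crossed.norm_mul_le_aux (x y : Crossed p μ α) : ‖x * y‖ ≤ ‖x‖ * ‖y‖ := by
  induction x using Crossed.induction_on with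
  | hc =>
    simp only [Crossed.mul_def]
    exact isClosed_le (by fun_prop) (by fun_prop)
  | h f =>
    induction y using Crossed.induction_on with
    | hc =>
      simp only [Crossed.mul_def]
      exact isClosed_le (by fun_prop) (by fun_prop)
    | h g =>
      rw [Crossed.of_mul_of, Crossed.norm_of, Crossed.norm_of, Crossed.norm_of]
      exact universalNorm_convolution_le f g

/-- `F^p(H, B, α)` is a Banach algebra, with product extending twisted convolution. -/
instance : NonUnitalNormedRing (Crossed p μ α) :=
  { (inferInstance : NormedAddCommGroup (Crossed p μ α)),
    (inferInstance : Mul (Crossed p μ α)) with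
    left_distrib := fun x y z => map_add (Crossed.mulL x) y z
    right_distrib := fun x y z => by simp [Crossed.mul_def]
    zero_mul := fun x => by simp [Crossed.mul_def]
    mul_zero := fun x => map_zero (Crossed.mulL x)
    mul_assoc := Crossed.mul_assoc_aux
    norm_mul_le := Crossed.norm_mul_le_aux }

instance : IsScalarTower ℂ (Crossed p μ α) (Crossed p μ α) where
  smul_assoc c x y := by
    change Crossed.mulL (c • x) y = c • Crossed.mulL x y
    simp

instance : SMulCommClass ℂ (Crossed p μ α) (Crossed p μ α) where
  smul_comm c x y := by
    change c • Crossed.mulL x y = Crossed.mulL x (c • y)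
    simp

/-- Extension of a contractive multiplicative linear map on `C_c(H, B, α)` to an algebra
homomorphism on `F^p(H, B, α)`. -/
def Crossed.liftHom {D : Type*} [NonUnitalNormedRing D] [NormedSpace ℂ D] [CompleteSpace D]
    (T : C_c(H, B) →ₗ[ℂ] D) (hT : ∀ f, ‖T f‖ ≤ universalNorm p μ α f)
    (hmul : ∀ f g, T (convolution μ α f g) = T f * T g) : Crossed p μ α →ₙₐ[ℂ] D where
  toFun := Crossed.lift (p := p) (μ := μ) (α := α) T 1 (fun f => by rw [one_mul]; exact hT f)
  map_smul' c x := by simp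
  map_zero' := map_zero _
  map_add' := map_add _
  map_mul' x y := by
    induction x using Crossed.induction_on with
    | hc => exact isClosed_eq (by fun_prop) (by fun_prop)
    | h f =>
      induction y using Crossed.induction_on with
      | hc => exact isClosed_eq (by fun_prop) (by fun_prop)
      | h g => rw [Crossed.of_mul_of, Crossed.lift_of, Crossed.lift_of, Crossed.lift_of, hmul]

theorem Crossed.liftHom_of {D : Type*} [NonUnitalNormedRing D] [NormedSpace ℂ D]
    [CompleteSpace D] (T : C_c(H, B) →ₗ[ℂ] D) (hT : ∀ f, ‖T f‖ ≤ universalNorm p μ α f)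
    (hmul : ∀ f g, T (convolution μ α f g) = T f * T g) (f : C_c(H, B)) :
    Crossed.liftHom T hT hmul (Crossed.of p μ α f) = T f :=
  Crossed.lift_of _ _ _ _

theorem Crossed.norm_liftHom_le {D : Type*} [NonUnitalNormedRing D] [NormedSpace ℂ D]
    [CompleteSpace D] (T : C_c(H, B) →ₗ[ℂ] D) (hT : ∀ f, ‖T f‖ ≤ universalNorm p μ α f)
    (hmul : ∀ f g, T (convolution μ α f g) = T f * T g) (x : Crossed p μ α) :
    ‖Crossed.liftHom T hT hmul x‖ ≤ ‖x‖ :=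
  (Crossed.norm_lift_le T 1 _ x).trans_eq (one_mul _)

theorem Crossed.continuous_liftHom {D : Type*} [NonUnitalNormedRing D] [NormedSpace ℂ D]
    [CompleteSpace D] (T : C_c(H, B) →ₗ[ℂ] D) (hT : ∀ f, ‖T f‖ ≤ universalNorm p μ α f)
    (hmul : ∀ f g, T (convolution μ α f g) = T f * T g) :
    Continuous (Crossed.liftHom T hT hmul) :=
  (Crossed.lift T 1 _).continuous

end Algebra

/-! ### Functoriality, twisting by characters, and the dual action -/

section Functoriality

variable {H B B' : Type u} [Group H] [TopologicalSpace H] [IsTopologicalGroup H]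
  [MeasurableSpace H] [BorelSpace H]
  [NonUnitalNormedRing B] [NormedSpace ℂ B] [IsScalarTower ℂ B B] [SMulCommClass ℂ B B]
  [CompleteSpace B]
  [NonUnitalNormedRing B'] [NormedSpace ℂ B'] [IsScalarTower ℂ B' B'] [SMulCommClass ℂ B' B']
  [CompleteSpace B']
  {p : ℝ≥0∞} [Fact (1 ≤ p)] {α : IsometricAction H B} {α' : IsometricAction H B'}

/-- A contractive equivariant homomorphism with dense range between dynamical systems. -/
structure EquivariantHom (α : IsometricAction H B) (α' : IsometricAction H B') where
  hom : B →ₙₐ[ℂ] B'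
  norm_hom_le : ∀ b, ‖hom b‖ ≤ ‖b‖
  denseRange_hom : DenseRange hom
  equivariant : ∀ s b, hom (α.act s b) = α'.act s (hom b)

theorem EquivariantHom.continuous_hom (θ : EquivariantHom α α') : Continuous θ.hom :=
  AddMonoidHomClass.continuous_of_bound θ.hom 1 fun b => by simpa using θ.norm_hom_le b

/-- The underlying continuous linear map. -/
def EquivariantHom.clm (θ : EquivariantHom α α') : B →L[ℂ] B' where
  toFun := θ.hom
  map_add' := map_add θ.hom
  map_smul' := fun c b => map_smul θ.hom c b
  cont := θ.continuous_hom

/-- Composition with an equivariant homomorphism, `f ↦ θ ∘ f`. -/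
def EquivariantHom.compCc (θ : EquivariantHom α α') : C_c(H, B) →ₗ[ℂ] C_c(H, B') where
  toFun f :=
    { toFun := fun s => θ.hom (f s)
      continuous_toFun := θ.continuous_hom.comp (map_continuous f)
      hasCompactSupport' := f.hasCompactSupport.comp_left (map_zero θ.hom) }
  map_add' f g := by ext s; exact map_add θ.hom (f s) (g s)
  map_smul' c f := by ext s; exact map_smul θ.hom c (f s)

theorem EquivariantHom.compCc_apply (θ : EquivariantHom α α') (f : C_c(H, B)) (s : H) :
    θ.compCc f s = θ.hom (f s) := rfl

/-- Restriction of a covariant representation along an equivariant homomorphism. -/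
def CovRep.comp (ρ : CovRep p α') (θ : EquivariantHom α α') : CovRep p α where
  X := ρ.X
  ν := ρ.ν
  π := ρ.π.comp θ.hom
  v := ρ.v
  norm_π_le b := (ρ.norm_π_le _).trans (θ.norm_hom_le b)
  nondegenerate := by
    have key : (Submodule.span ℂ {η | ∃ b ξ, η = ρ.π b ξ} : Set ρ.E) ⊆
        closure (Submodule.span ℂ {η | ∃ b ξ, η = (ρ.π.comp θ.hom) b ξ} : Set ρ.E) := by
      rw [← Submodule.topologicalClosure_coe]
      refine Submodule.span_le.2 ?_
      rintro _ ⟨b, ξ, rfl⟩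
      have hc : Continuous fun b => ρ.π b ξ := ρ.continuous_π.clm_apply continuous_const
      refine θ.denseRange_hom.induction_on (p := fun b => ρ.π b ξ ∈ _) b
        ((Submodule.isClosed_topologicalClosure _).preimage hc) fun b => ?_
      exact Submodule.le_topologicalClosure _ (Submodule.subset_span ⟨b, ξ, rfl⟩)
    exact dense_closure.1 (ρ.nondegenerate.mono key)
  norm_v := ρ.norm_v
  continuous_v := ρ.continuous_v
  covariant t b := by
    change _ = ρ.π (θ.hom (α.act t b))
    rw [θ.equivariant]
    exact ρ.covariant t _

variable {μ : Measure H} [IsFiniteMeasureOnCompacts μ]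

theorem EquivariantHom.universalNorm_compCc_le (θ : EquivariantHom α α') (f : C_c(H, B)) :
    universalNorm p μ α' (θ.compCc f) ≤ universalNorm p μ α f :=
  universalNorm_le (universalNorm_nonneg p μ α f) fun ρ =>
    (ρ.comp θ).norm_integrated_le_universalNorm μ f

theorem EquivariantHom.compCc_convolution (θ : EquivariantHom α α') (f g : C_c(H, B)) :
    θ.compCc (convolution μ α f g) = convolution μ α' (θ.compCc f) (θ.compCc g) := by
  ext t
  rw [compCc_apply, convolution_apply, convolution_apply]
  refine (θ.clm.integral_comp_comm (integrable_convolution μ α f g t)).symm.trans ?_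
  refine integral_congr_ae (Filter.Eventually.of_forall fun s => ?_)
  change θ.hom (f s * α.act s (g (s⁻¹ * t))) = _
  rw [map_mul, θ.equivariant]
  rfl

variable [μ.IsMulLeftInvariant]

/-- The homomorphism `θ ⋊ id : F^p(H, B, α) → F^p(H, B', α')` induced by an equivariant
homomorphism `θ`; it is given on `C_c(H, B)` by `f ↦ θ ∘ f`. -/
def Crossed.map (p : ℝ≥0∞) [Fact (1 ≤ p)] (μ : Measure H) [IsFiniteMeasureOnCompacts μ]
    [μ.IsMulLeftInvariant] (θ : EquivariantHom α α') : Crossed p μ α →ₙₐ[ℂ] Crossed p μ α' :=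
  Crossed.liftHom (Crossed.of p μ α' ∘ₗ θ.compCc)
    (fun f => (Crossed.norm_of _).le.trans (θ.universalNorm_compCc_le f))
    (fun f g => by
      simp only [LinearMap.comp_apply, Crossed.of_mul_of, θ.compCc_convolution (μ := μ)])

theorem Crossed.map_of (θ : EquivariantHom α α') (f : C_c(H, B)) :
    Crossed.map p μ θ (Crossed.of p μ α f) = Crossed.of p μ α' (θ.compCc f) :=
  Crossed.liftHom_of _ _ _ _

theorem Crossed.norm_map_le (θ : EquivariantHom α α') (x : Crossed p μ α) :
    ‖Crossed.map p μ θ x‖ ≤ ‖x‖ :=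
  Crossed.norm_liftHom_le _ _ _ x

theorem Crossed.continuous_map (θ : EquivariantHom α α') : Continuous (Crossed.map p μ θ) :=
  Crossed.continuous_liftHom _ _ _

/-! #### Twisting by characters -/

/-- Multiplication by a conjugate character, `f ↦ (s ↦ conj (χ s) • f s)`. -/
def twistCc (χ : PontryaginDual H) : C_c(H, B) →ₗ[ℂ] C_c(H, B) where
  toFun f :=
    { toFun := fun s => (starRingEnd ℂ (χ s : ℂ)) • f s
      continuous_toFun := by
        have h1 : Continuous χ := map_continuous χ
        have h2 : Continuous f := map_continuous f
        fun_prop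
      hasCompactSupport' := f.hasCompactSupport.smul_left }
  map_add' f g := by ext s; exact smul_add _ (f s) (g s)
  map_smul' c f := by ext s; exact smul_comm _ c (f s)

theorem twistCc_apply (χ : PontryaginDual H) (f : C_c(H, B)) (s : H) :
    twistCc χ f s = (starRingEnd ℂ (χ s : ℂ)) • f s := rfl

/-- Multiply the group representation of a covariant representation by a conjugate character. -/
def CovRep.twist (ρ : CovRep p α) (χ : PontryaginDual H) : CovRep p α where
  X := ρ.X
  ν := ρ.ν
  π := ρ.π
  v :=
    { toFun := fun s => (starRingEnd ℂ (χ s : ℂ)) • ρ.v s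
      map_one' := by simp
      map_mul' := fun s t => by
        rw [map_mul, map_mul, Circle.coe_mul, map_mul, smul_mul_smul_comm] }
  norm_π_le := ρ.norm_π_le
  nondegenerate := ρ.nondegenerate
  norm_v s ξ := by
    change ‖(starRingEnd ℂ (χ s : ℂ)) • ρ.v s ξ‖ = ‖ξ‖
    rw [norm_smul, ρ.norm_v, RCLike.norm_conj, Circle.norm_coe, one_mul]
  continuous_v ξ := by
    have h1 : Continuous χ := map_continuous χ
    have h2 := ρ.continuous_v ξ
    change Continuous fun s => (starRingEnd ℂ (χ s : ℂ)) • ρ.v s ξ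
    fun_prop
  covariant t b := by
    change ((starRingEnd ℂ (χ t : ℂ)) • ρ.v t) * ρ.π b *
      ((starRingEnd ℂ (χ t⁻¹ : ℂ)) • ρ.v t⁻¹) = _
    rw [smul_mul_assoc, smul_mul_smul_comm, ρ.covariant, ← map_mul, ← Circle.coe_mul, ← map_mul]
    simp

theorem CovRep.integrated_twistCc (ρ : CovRep p α) (χ : PontryaginDual H) (f : C_c(H, B)) :
    ρ.integrated μ (twistCc χ f) = (ρ.twist χ).integrated μ f := by
  ext1 ξ
  change ∫ s, ρ.π ((starRingEnd ℂ (χ s : ℂ)) • f s) (ρ.v s ξ) ∂μ =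
    ∫ s, ρ.π (f s) ((starRingEnd ℂ (χ s : ℂ)) • ρ.v s ξ) ∂μ
  simp

theorem universalNorm_twistCc_le (χ : PontryaginDual H) (f : C_c(H, B)) :
    universalNorm p μ α (twistCc χ f) ≤ universalNorm p μ α f :=
  universalNorm_le (universalNorm_nonneg p μ α f) fun ρ => by
    rw [ρ.integrated_twistCc]
    exact (ρ.twist χ).norm_integrated_le_universalNorm μ f

theorem twistCc_convolution (χ : PontryaginDual H) (f g : C_c(H, B)) :
    twistCc χ (convolution μ α f g) = convolution μ α (twistCc χ f) (twistCc χ g) := by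
  ext t
  rw [twistCc_apply, convolution_apply, convolution_apply, ← integral_smul]
  refine integral_congr_ae (Filter.Eventually.of_forall fun s => ?_)
  change _ = ((starRingEnd ℂ (χ s : ℂ)) • f s) *
    α.act s ((starRingEnd ℂ (χ (s⁻¹ * t) : ℂ)) • g (s⁻¹ * t))
  rw [map_smul, smul_mul_smul_comm, ← map_mul, ← Circle.coe_mul, ← map_mul, mul_inv_cancel_left]

/-- The automorphism of `F^p(H, B, α)` given on `C_c(H, B)` by multiplication by the conjugate
of a character. -/
def Crossed.twist (p : ℝ≥0∞) [Fact (1 ≤ p)] (μ : Measure H) [IsFiniteMeasureOnCompacts μ]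
    [μ.IsMulLeftInvariant] (α : IsometricAction H B) (χ : PontryaginDual H) :
    Crossed p μ α →ₙₐ[ℂ] Crossed p μ α :=
  Crossed.liftHom (Crossed.of p μ α ∘ₗ twistCc χ)
    (fun f => (Crossed.norm_of _).le.trans (universalNorm_twistCc_le χ f))
    (fun f g => by
      simp only [LinearMap.comp_apply, Crossed.of_mul_of, twistCc_convolution (μ := μ) (α := α)])

theorem Crossed.twist_of (χ : PontryaginDual H) (f : C_c(H, B)) :
    Crossed.twist p μ α χ (Crossed.of p μ α f) = Crossed.of p μ α (twistCc χ f) :=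
  Crossed.liftHom_of _ _ _ _

theorem Crossed.norm_twist_le (χ : PontryaginDual H) (x : Crossed p μ α) :
    ‖Crossed.twist p μ α χ x‖ ≤ ‖x‖ :=
  Crossed.norm_liftHom_le _ _ _ x

theorem Crossed.continuous_twist (χ : PontryaginDual H) :
    Continuous (Crossed.twist p μ α χ) :=
  Crossed.continuous_liftHom _ _ _

theorem Crossed.twist_one (x : Crossed p μ α) : Crossed.twist p μ α 1 x = x := by
  induction x using Crossed.induction_on with
  | hc => exact isClosed_eq (Crossed.continuous_twist 1) continuous_id
  | h f =>
    rw [Crossed.twist_of]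
    congr 1
    ext s
    simp [twistCc_apply]

theorem Crossed.twist_mul (χ ψ : PontryaginDual H) (x : Crossed p μ α) :
    Crossed.twist p μ α (χ * ψ) x = Crossed.twist p μ α χ (Crossed.twist p μ α ψ x) := by
  induction x using Crossed.induction_on with
  | hc =>
    exact isClosed_eq (Crossed.continuous_twist _)
      ((Crossed.continuous_twist χ).comp (Crossed.continuous_twist ψ))
  | h f =>
    rw [Crossed.twist_of, Crossed.twist_of, Crossed.twist_of]
    congr 1
    ext s
    have : (χ * ψ) s = χ s * ψ s := rfl
    simp only [twistCc_apply, this, Circle.coe_mul, map_mul, mul_smul]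

/-- A family of contractions which is pointwise continuous on `C_c(H, B)` is pointwise continuous
on the completion. -/
theorem Crossed.continuous_of_dense {Y : Type*} [TopologicalSpace Y]
    (T : Y → Crossed p μ α →ₙₐ[ℂ] Crossed p μ α) (hT : ∀ y x, ‖T y x‖ ≤ ‖x‖)
    (h : ∀ f, Continuous fun y => T y (Crossed.of p μ α f)) (x : Crossed p μ α) :
    Continuous fun y => T y x := by
  refine continuous_of_uniform_approx_of_continuous fun V hV => ?_
  obtain ⟨ε, hε, hV⟩ := Metric.mem_uniformity_dist.1 hV
  obtain ⟨f, hf⟩ := Crossed.denseRange_of.exists_dist_lt x hε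
  refine ⟨_, h f, fun y => hV ?_⟩
  rw [dist_eq_norm, ← map_sub]
  exact (hT y _).trans_lt (by rwa [← dist_eq_norm])

/-- A homomorphic family of contractive endomorphisms of `F^p(H, B, α)` acts isometrically. -/
theorem Crossed.norm_eq_of_group {K : Type*} [Group K]
    (T : K → Crossed p μ α →ₙₐ[ℂ] Crossed p μ α) (hT : ∀ k x, ‖T k x‖ ≤ ‖x‖)
    (h1 : ∀ x, T 1 x = x) (hm : ∀ k l x, T (k * l) x = T k (T l x)) (k : K)
    (x : Crossed p μ α) : ‖T k x‖ = ‖x‖ := by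
  refine le_antisymm (hT k x) ?_
  conv_lhs => rw [← h1 x, ← inv_mul_cancel k, hm]
  exact hT _ _

theorem Crossed.continuous_twist_of [LocallyCompactSpace H] (f : C_c(H, B)) :
    Continuous fun γ : PontryaginDual H => Crossed.twist p μ α γ (Crossed.of p μ α f) := by
  rw [continuous_iff_continuousAt]
  intro γ₀
  rw [ContinuousAt, tendsto_iff_norm_sub_tendsto_zero]
  have hb : ∀ γ : PontryaginDual H,
      ‖Crossed.twist p μ α γ (Crossed.of p μ α f) -
        Crossed.twist p μ α γ₀ (Crossed.of p μ α f)‖ ≤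
      ∫ s, ‖(starRingEnd ℂ (γ s : ℂ)) • f s - (starRingEnd ℂ (γ₀ s : ℂ)) • f s‖ ∂μ := by
    intro γ
    rw [Crossed.twist_of, Crossed.twist_of, ← map_sub]
    exact Crossed.norm_of_le _
  have hcont : Continuous fun γ : PontryaginDual H =>
      ∫ s, ‖(starRingEnd ℂ (γ s : ℂ)) • f s - (starRingEnd ℂ (γ₀ s : ℂ)) • f s‖ ∂μ := by
    rw [← continuousOn_univ]
    refine continuousOn_integral_of_compact_support (k := tsupport f) f.hasCompactSupport ?_ ?_
    · have h1 : Continuous f := map_continuous f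
      have h2 : Continuous γ₀ := map_continuous γ₀
      have h3 := continuous_dual_eval (H := H)
      have hcoe : Continuous fun z : Circle => (z : ℂ) := by fun_prop
      refine Continuous.continuousOn ?_
      refine Continuous.norm (Continuous.sub ?_ ?_)
      · exact (Complex.continuous_conj.comp (hcoe.comp h3)).smul
          (h1.comp continuous_snd)
      · exact (Complex.continuous_conj.comp (hcoe.comp
          (h2.comp continuous_snd))).smul (h1.comp continuous_snd)
    · intro γ s _ hs
      simp [image_eq_zero_of_notMem_tsupport hs]
  have := hcont.tendsto γ₀
  simp only [sub_self, norm_zero, integral_zero] at this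
  exact squeeze_zero (fun _ => norm_nonneg _) hb this

/-- The dual action `α̂` of the dual group `Ĥ` on `F^p(H, B, α)`, given on `C_c(H, B)` by
`α̂_γ(f)(s) = conj (γ s) • f s`. -/
def dualAction (p : ℝ≥0∞) [Fact (1 ≤ p)] {H : Type u} [CommGroup H] [TopologicalSpace H]
    [IsTopologicalGroup H] [LocallyCompactSpace H] [MeasurableSpace H] [BorelSpace H]
    (μ : Measure H) [IsFiniteMeasureOnCompacts μ] [μ.IsMulLeftInvariant]
    (α : IsometricAction H B) : IsometricAction (PontryaginDual H) (Crossed p μ α) where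
  act := Crossed.twist p μ α
  act_one := Crossed.twist_one
  act_mul := Crossed.twist_mul
  norm_act := Crossed.norm_eq_of_group _ Crossed.norm_twist_le Crossed.twist_one
    Crossed.twist_mul
  continuous_act := Crossed.continuous_of_dense _ Crossed.norm_twist_le
    Crossed.continuous_twist_of

theorem dualAction_of {H : Type u} [CommGroup H] [TopologicalSpace H]
    [IsTopologicalGroup H] [LocallyCompactSpace H] [MeasurableSpace H] [BorelSpace H]
    (μ : Measure H) [IsFiniteMeasureOnCompacts μ] [μ.IsMulLeftInvariant]
    (α : IsometricAction H B) (γ : PontryaginDual H) (f : C_c(H, B)) :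
    (dualAction p μ α).act γ (Crossed.of p μ α f) = Crossed.of p μ α (twistCc γ f) :=
  Crossed.twist_of γ f

end Functoriality

/-! ### The concrete dynamical systems -/

/-- Pull back an action along a continuous homomorphism. -/
def IsometricAction.comap {K H B : Type u} [Group K] [TopologicalSpace K] [Group H]
    [TopologicalSpace H] [NonUnitalNormedRing B] [NormedSpace ℂ B]
    (α : IsometricAction H B) (e : K →ₜ* H) : IsometricAction K B where
  act k := α.act (e k)
  act_one b := by rw [map_one, α.act_one]
  act_mul s t b := by rw [map_mul, α.act_mul]
  norm_act s b := α.norm_act _ b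
  continuous_act b := (α.continuous_act b).comp (map_continuous e)

instance isFiniteMeasureOnCompacts_count {G : Type u} [TopologicalSpace G] [DiscreteTopology G]
    [MeasurableSpace G] [BorelSpace G] :
    IsFiniteMeasureOnCompacts (Measure.count : Measure G) where
  lt_top_of_isCompact _ hK := Measure.count_apply_lt_top.2 hK.finite_of_discrete

section Concrete

variable {G A : Type u} [CommGroup G] [TopologicalSpace G] [IsTopologicalGroup G]
  [DiscreteTopology G] [NormedRing A] [NormedAlgebra ℂ A] [CompleteSpace A]

/-- The character `γ ↦ γ(s)` of `Ĝ` defined by `s ∈ G`. -/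
def evalChar (s : G) : PontryaginDual (PontryaginDual G) :=
  ({ toFun := fun γ => γ s
     map_one' := rfl
     map_mul' := fun _ _ => rfl
     continuous_toFun :=
      (continuous_dual_eval (H := G)).comp (continuous_id.prodMk continuous_const) } :
    PontryaginDual G →ₜ* Circle)

theorem evalChar_apply (s : G) (γ : PontryaginDual G) : evalChar s γ = γ s := rfl

/-- The canonical homomorphism from the discrete group `G` to its double dual. -/
def evalHom (G : Type u) [CommGroup G] [TopologicalSpace G] [IsTopologicalGroup G]
    [DiscreteTopology G] : G →ₜ* PontryaginDual (PontryaginDual G) where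
  toFun := evalChar
  map_one' := PontryaginDual.ext fun γ => map_one γ
  map_mul' s t := PontryaginDual.ext fun γ => map_mul γ s t
  continuous_toFun := continuous_of_discreteTopology

/-- The endomorphism `f ↦ (t ↦ θ (f (σ t)))` of `C_0(G, A)`. -/
def c0Map (σ : G ≃ₜ G) (θ : A →ₙₐ[ℂ] A) (hθ : ∀ a, ‖θ a‖ = ‖a‖) :
    C₀(G, A) →ₙₐ[ℂ] C₀(G, A) where
  toFun f :=
    { toFun := fun t => θ (f (σ t))
      continuous_toFun := continuous_of_discreteTopology
      zero_at_infty' := by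
        refine squeeze_zero_norm (a := fun t => ‖f (σ t)‖) (fun t => (hθ _).le) ?_
        have := (f.zero_at_infty'.comp σ.isClosedEmbedding.tendsto_cocompact).norm
        simpa using this }
  map_smul' c f := by ext t; exact map_smul θ c (f (σ t))
  map_zero' := by ext t; exact map_zero θ
  map_add' f g := by ext t; exact map_add θ (f (σ t)) (g (σ t))
  map_mul' f g := by ext t; exact map_mul θ (f (σ t)) (g (σ t))

theorem c0Map_apply (σ : G ≃ₜ G) (θ : A →ₙₐ[ℂ] A) (hθ : ∀ a, ‖θ a‖ = ‖a‖) (f : C₀(G, A))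
    (t : G) : c0Map σ θ hθ f t = θ (f (σ t)) := rfl

theorem norm_c0Map (σ : G ≃ₜ G) (θ : A →ₙₐ[ℂ] A) (hθ : ∀ a, ‖θ a‖ = ‖a‖) (f : C₀(G, A)) :
    ‖c0Map σ θ hθ f‖ = ‖f‖ := by
  refine le_antisymm ?_ ?_
  · rw [← ZeroAtInftyContinuousMap.norm_toBCF_eq_norm]
    refine (BoundedContinuousFunction.norm_le (norm_nonneg _)).2 fun t => ?_
    change ‖θ (f (σ t))‖ ≤ _
    rw [hθ, ← ZeroAtInftyContinuousMap.norm_toBCF_eq_norm]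
    exact f.toBCF.norm_coe_le_norm (σ t)
  · conv_lhs => rw [← ZeroAtInftyContinuousMap.norm_toBCF_eq_norm]
    refine (BoundedContinuousFunction.norm_le (norm_nonneg _)).2 fun t => ?_
    change ‖f t‖ ≤ _
    have h := (c0Map σ θ hθ f).toBCF.norm_coe_le_norm (σ.symm t)
    change ‖θ (f (σ (σ.symm t)))‖ ≤ _ at h
    rwa [hθ, σ.apply_symm_apply, ZeroAtInftyContinuousMap.norm_toBCF_eq_norm] at h

/-- The action `lt ⊗ α` of `G` on `C_0(G, A)`: `(lt ⊗ α)_s f(t) = α_s(f(s⁻¹ t))`. For the trivial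
action `α` this is `lt ⊗ id`. -/
def ltTensor (α : IsometricAction G A) : IsometricAction G C₀(G, A) where
  act s := c0Map (Homeomorph.mulLeft s⁻¹) (α.act s) (α.norm_act s)
  act_one f := by ext t; simp [c0Map_apply, α.act_one]
  act_mul s r f := by ext t; simp [c0Map_apply, α.act_mul, mul_assoc]
  norm_act s f := norm_c0Map _ _ _ f
  continuous_act f := continuous_of_discreteTopology

theorem ltTensor_apply (α : IsometricAction G A) (s : G) (f : C₀(G, A)) (t : G) :
    (ltTensor α).act s f t = α.act s (f (s⁻¹ * t)) := rfl

/-- The action `rt ⊗ α` of `G` on `C_0(G, A)`: `(rt ⊗ α)_r f(t) = α_r(f(t r))`. -/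
def rtTensor (α : IsometricAction G A) : IsometricAction G C₀(G, A) where
  act r := c0Map (Homeomorph.mulRight r) (α.act r) (α.norm_act r)
  act_one f := by ext t; simp [c0Map_apply, α.act_one]
  act_mul s r f := by
    ext t
    simp [c0Map_apply, α.act_mul, mul_assoc]
  norm_act s f := norm_c0Map _ _ _ f
  continuous_act f := continuous_of_discreteTopology

theorem rtTensor_apply (α : IsometricAction G A) (r : G) (f : C₀(G, A)) (t : G) :
    (rtTensor α).act r f t = α.act r (f (t * r)) := rfl

variable [MeasurableSpace G] [BorelSpace G]
  [MeasurableSpace (PontryaginDual G)] [BorelSpace (PontryaginDual G)]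
  {p : ℝ≥0∞} [Fact (1 ≤ p)] (μ : Measure (PontryaginDual G)) [IsFiniteMeasureOnCompacts μ]
  [μ.IsMulLeftInvariant] (α : IsometricAction G A)

/-- Each `α_s` is equivariant for the trivial action of `Ĝ` on `A`. -/
def actEquivariant (s : G) :
    EquivariantHom (trivialAction (PontryaginDual G) A) (trivialAction (PontryaginDual G) A) where
  hom := α.act s
  norm_hom_le a := (α.norm_act s a).le
  denseRange_hom := Function.Surjective.denseRange fun a => ⟨_, α.act_act_inv s a⟩
  equivariant _ _ := rfl

/-- Each `(rt ⊗ α)_r` is equivariant for the action `lt ⊗ id` of `G` on `C_0(G, A)`. -/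
def rtEquivariant (r : G) :
    EquivariantHom (ltTensor (trivialAction G A)) (ltTensor (trivialAction G A)) where
  hom := (rtTensor α).act r
  norm_hom_le a := ((rtTensor α).norm_act r a).le
  denseRange_hom := Function.Surjective.denseRange fun a => ⟨_, (rtTensor α).act_act_inv r a⟩
  equivariant s f := by
    ext t
    rw [rtTensor_apply, ltTensor_apply, ltTensor_apply, rtTensor_apply, mul_assoc]
    rfl

/-- The automorphism `(β̂ ⊗ α)_s` of `F^p(Ĝ, A, β)`, `β` being the trivial action. -/
def dualTensorMap (p : ℝ≥0∞) [Fact (1 ≤ p)] (s : G) :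
    Crossed p μ (trivialAction (PontryaginDual G) A) →ₙₐ[ℂ]
      Crossed p μ (trivialAction (PontryaginDual G) A) :=
  (Crossed.map p μ (actEquivariant α s)).comp (Crossed.twist p μ _ (evalChar s⁻¹))

theorem dualTensorMap_of (s : G) (φ : C_c(PontryaginDual G, A)) :
    dualTensorMap μ α p s (Crossed.of p μ _ φ) =
      Crossed.of p μ _ ((actEquivariant α s).compCc (twistCc (evalChar s⁻¹) φ)) := by
  change Crossed.map p μ _ (Crossed.twist p μ _ _ _) = _
  rw [Crossed.twist_of, Crossed.map_of]

/-- On functions, `(β̂ ⊗ α)_s(φ)(γ) = γ(s) α_s(φ(γ))`. -/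
theorem dualTensor_formula (s : G) (φ : C_c(PontryaginDual G, A)) (γ : PontryaginDual G) :
    (actEquivariant α s).compCc (twistCc (evalChar s⁻¹) φ) γ =
      (γ s : ℂ) • α.act s (φ γ) := by
  rw [EquivariantHom.compCc_apply, twistCc_apply, evalChar_apply]
  change α.act s _ = _
  rw [map_smul, map_inv, Circle.coe_inv_eq_conj, Complex.conj_conj]

theorem norm_dualTensorMap_le (s : G)
    (x : Crossed p μ (trivialAction (PontryaginDual G) A)) : ‖dualTensorMap μ α p s x‖ ≤ ‖x‖ :=
  (Crossed.norm_map_le _ _).trans (Crossed.norm_twist_le _ _)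

theorem continuous_dualTensorMap (s : G) : Continuous (dualTensorMap μ α p s) :=
  (Crossed.continuous_map _).comp (Crossed.continuous_twist _)

theorem dualTensorMap_one (x : Crossed p μ (trivialAction (PontryaginDual G) A)) :
    dualTensorMap μ α p 1 x = x := by
  induction x using Crossed.induction_on with
  | hc => exact isClosed_eq (continuous_dualTensorMap μ α 1) continuous_id
  | h φ =>
    rw [dualTensorMap_of]
    congr 1
    ext γ
    rw [dualTensor_formula, α.act_one]
    simp

theorem dualTensorMap_mul (s t : G) (x : Crossed p μ (trivialAction (PontryaginDual G) A)) :
    dualTensorMap μ α p (s * t) x = dualTensorMap μ α p s (dualTensorMap μ α p t x) := by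
  induction x using Crossed.induction_on with
  | hc =>
    exact isClosed_eq (continuous_dualTensorMap μ α _)
      ((continuous_dualTensorMap μ α s).comp (continuous_dualTensorMap μ α t))
  | h φ =>
    rw [dualTensorMap_of, dualTensorMap_of, dualTensorMap_of]
    congr 1
    ext γ
    rw [dualTensor_formula, dualTensor_formula, dualTensor_formula, α.act_mul, map_mul,
      map_smul, Circle.coe_mul, mul_smul]

/-- The action `β̂ ⊗ α` of `G` on `F^p(Ĝ, A, β)`, where `β` is the trivial action of `Ĝ`, given
on functions by `(β̂ ⊗ α)_s(φ)(γ) = γ(s) α_s(φ(γ))`. -/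
def dualTensor (p : ℝ≥0∞) [Fact (1 ≤ p)] :
    IsometricAction G (Crossed p μ (trivialAction (PontryaginDual G) A)) where
  act := dualTensorMap μ α p
  act_one := dualTensorMap_one μ α
  act_mul := dualTensorMap_mul μ α
  norm_act := Crossed.norm_eq_of_group _ (norm_dualTensorMap_le μ α) (dualTensorMap_one μ α)
    (dualTensorMap_mul μ α)
  continuous_act _ := continuous_of_discreteTopology

/-- The action `(rt ⊗ α) ⊗ id` of `G` on `F^p(G, C_0(G, A), lt ⊗ id)`, given on functions by
`(((rt ⊗ α) ⊗ id)_r F)(s, t) = α_r(F(s, t r))`. -/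
def rtTensorId (p : ℝ≥0∞) [Fact (1 ≤ p)] :
    IsometricAction G (Crossed p (Measure.count : Measure G) (ltTensor (trivialAction G A))) where
  act r := Crossed.map p Measure.count (rtEquivariant α r)
  act_one x := by
    induction x using Crossed.induction_on with
    | hc => exact isClosed_eq (Crossed.continuous_map _) continuous_id
    | h f =>
      rw [Crossed.map_of]
      congr 1
      ext s : 1
      exact (rtTensor α).act_one (f s)
  act_mul r r' x := by
    induction x using Crossed.induction_on with
    | hc =>
      exact isClosed_eq (Crossed.continuous_map _)
        ((Crossed.continuous_map _).comp (Crossed.continuous_map _))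
    | h f =>
      rw [Crossed.map_of, Crossed.map_of, Crossed.map_of]
      congr 1
      ext s : 1
      exact (rtTensor α).act_mul r r' (f s)
  norm_act r x := by
    refine le_antisymm (Crossed.norm_map_le _ x) ?_
    have key : Crossed.map p Measure.count (rtEquivariant α r⁻¹)
        (Crossed.map p Measure.count (rtEquivariant α r) x) = x := by
      induction x using Crossed.induction_on with
      | hc =>
        exact isClosed_eq ((Crossed.continuous_map _).comp (Crossed.continuous_map _))
          continuous_id
      | h f =>
        rw [Crossed.map_of, Crossed.map_of]
        congr 1
        ext s : 1
        exact (rtTensor α).act_inv_act r (f s)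
    conv_lhs => rw [← key]
    exact Crossed.norm_map_le _ _
  continuous_act _ := continuous_of_discreteTopology

/-- On functions, `(((rt ⊗ α) ⊗ id)_r F)(s, t) = α_r(F(s, t r))`. -/
theorem rtTensorId_formula (r s t : G) (F : C_c(G, C₀(G, A))) :
    (rtEquivariant α r).compCc F s t = α.act r (F s (t * r)) := rfl

/-- The double dual action of `G` on `F^p(Ĝ, F^p(G, A, α), α̂)`: the dual action of the dual of
`Ĝ`, where `t ∈ G` is identified with the character `γ ↦ γ(t)` of `Ĝ`. On functions it is
`(α̂̂_t F)(γ, s) = conj (γ t) • F(γ, s)`. -/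
def doubleDualAction (p : ℝ≥0∞) [Fact (1 ≤ p)] :
    IsometricAction G (Crossed p μ (dualAction p (Measure.count : Measure G) α)) :=
  (dualAction p μ (dualAction p Measure.count α)).comap (evalHom G)

theorem doubleDualAction_of (t : G)
    (F : C_c(PontryaginDual G, Crossed p (Measure.count : Measure G) α)) :
    (doubleDualAction μ α p).act t (Crossed.of p μ _ F) =
      Crossed.of p μ _ (twistCc (evalChar t) F) :=
  Crossed.twist_of _ F

end Concrete

/-! ### Functions of two variables in iterated crossed products -/

section Curry

variable {Y H B : Type u} [TopologicalSpace Y] [R1Space Y] [Group H] [TopologicalSpace H]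
  [IsTopologicalGroup H] [MeasurableSpace H] [BorelSpace H]
  [NonUnitalNormedRing B] [NormedSpace ℂ B] [IsScalarTower ℂ B B] [SMulCommClass ℂ B B]
  [CompleteSpace B]

/-- The slice `F(y, ·)` of a compactly supported function of two variables. -/
def slice (F : C_c(Y × H, B)) (y : Y) : C_c(H, B) where
  toFun s := F (y, s)
  continuous_toFun := (map_continuous F).comp (continuous_const.prodMk continuous_id)
  hasCompactSupport' :=
    HasCompactSupport.intro (F.hasCompactSupport.isCompact.image continuous_snd) fun _ hs =>
      image_eq_zero_of_notMem_tsupport fun h => hs ⟨_, h, rfl⟩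

theorem slice_apply (F : C_c(Y × H, B)) (y : Y) (s : H) : slice F y s = F (y, s) := rfl

/-- A function `F ∈ C_c(Y × H, B)` viewed as the element `y ↦ F(y, ·)` of
`C_c(Y, F^p(H, B, α))`. -/
def curryCc (p : ℝ≥0∞) [Fact (1 ≤ p)] (μ : Measure H) [IsFiniteMeasureOnCompacts μ]
    (α : IsometricAction H B) (F : C_c(Y × H, B)) : C_c(Y, Crossed p μ α) where
  toFun y := Crossed.of p μ α (slice F y)
  continuous_toFun := by
    rw [continuous_iff_continuousAt]
    intro y₀
    rw [ContinuousAt, tendsto_iff_norm_sub_tendsto_zero]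
    have hb : ∀ y, ‖Crossed.of p μ α (slice F y) - Crossed.of p μ α (slice F y₀)‖ ≤
        ∫ s, ‖F (y, s) - F (y₀, s)‖ ∂μ := by
      intro y
      rw [← map_sub]
      exact Crossed.norm_of_le _
    have hcont : Continuous fun y => ∫ s, ‖F (y, s) - F (y₀, s)‖ ∂μ := by
      rw [← continuousOn_univ]
      refine continuousOn_integral_of_compact_support (k := Prod.snd '' tsupport F)
        (F.hasCompactSupport.isCompact.image continuous_snd) ?_ ?_
      · have h1 : Continuous F := map_continuous F
        refine Continuous.continuousOn ?_
        exact (Continuous.sub h1 (h1.comp (continuous_const.prodMk continuous_snd))).norm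
      · intro y s _ hs
        have h0 : ∀ z, F (z, s) = 0 := fun z =>
          image_eq_zero_of_notMem_tsupport fun h => hs ⟨_, h, rfl⟩
        simp [h0]
    have := hcont.tendsto y₀
    simp only [sub_self, norm_zero, integral_zero] at this
    exact squeeze_zero (fun _ => norm_nonneg _) hb this
  hasCompactSupport' := by
    refine HasCompactSupport.intro (F.hasCompactSupport.isCompact.image continuous_fst)
      fun y hy => ?_
    have : slice F y = 0 := by
      ext s
      exact image_eq_zero_of_notMem_tsupport (x := (y, s)) fun h => hy ⟨(y, s), h, rfl⟩
    rw [this, map_zero]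

theorem curryCc_apply (p : ℝ≥0∞) [Fact (1 ≤ p)] (μ : Measure H) [IsFiniteMeasureOnCompacts μ]
    (α : IsometricAction H B) (F : C_c(Y × H, B)) (y : Y) :
    curryCc p μ α F y = Crossed.of p μ α (slice F y) := rfl

end Curry

/-! ### The maps `Φ₁`, `Φ₂`, `Φ₃` -/

section Phi

variable {G A : Type u} [CommGroup G] [TopologicalSpace G] [IsTopologicalGroup G]
  [DiscreteTopology G] [NormedRing A] [NormedAlgebra ℂ A] [CompleteSpace A]
  [MeasurableSpace G] [BorelSpace G]
  [MeasurableSpace (PontryaginDual G)] [BorelSpace (PontryaginDual G)]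
  {p : ℝ≥0∞} [Fact (1 ≤ p)] {μ : Measure (PontryaginDual G)} [IsFiniteMeasureOnCompacts μ]
  [μ.IsMulLeftInvariant] {α : IsometricAction G A}

/-- `Φ₁ : F^p(Ĝ, F^p(G, A, α), α̂) → F^p(G, F^p(Ĝ, A, β), β̂ ⊗ α)` is the continuous homomorphism
given by `Φ₁(F)(s, γ) = γ(s) F(γ, s)` for `F ∈ C_c(Ĝ × G, A)`. -/
structure IsPhi₁ (Φ : Crossed p μ (dualAction p (Measure.count : Measure G) α) →ₙₐ[ℂ]
    Crossed p (Measure.count : Measure G) (dualTensor μ α p)) : Prop where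
  continuous : Continuous Φ
  formula : ∀ F : C_c(PontryaginDual G × G, A), ∃ F' : C_c(G × PontryaginDual G, A),
    (∀ s γ, F' (s, γ) = (γ s : ℂ) • F (γ, s)) ∧
    Φ (Crossed.of p μ _ (curryCc p Measure.count α F)) =
      Crossed.of p Measure.count _ (curryCc p μ (trivialAction (PontryaginDual G) A) F')

/-- `Φ₂ : F^p(G, F^p(Ĝ, A, β), β̂ ⊗ α) → F^p(G, C_0(G, A), lt ⊗ α)` is the continuous homomorphism
given by `Φ₂(F)(s, t) = ∫ F(s, γ) conj(γ(t)) dμ(γ)` for `F ∈ C_c(G × Ĝ, A)`. -/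
structure IsPhi₂ (Φ : Crossed p (Measure.count : Measure G) (dualTensor μ α p) →ₙₐ[ℂ]
    Crossed p (Measure.count : Measure G) (ltTensor α)) : Prop where
  continuous : Continuous Φ
  formula : ∀ F : C_c(G × PontryaginDual G, A), ∃ F' : C_c(G, C₀(G, A)),
    (∀ s t, F' s t = ∫ γ, (starRingEnd ℂ (γ t : ℂ)) • F (s, γ) ∂μ) ∧
    Φ (Crossed.of p Measure.count _ (curryCc p μ (trivialAction (PontryaginDual G) A) F)) =
      Crossed.of p Measure.count _ F'

/-- `Φ₃ : F^p(G, C_0(G, A), lt ⊗ α) → F^p(G, C_0(G, A), lt ⊗ id)` is the continuous homomorphism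
given by `Φ₃(F)(s, t) = α_t⁻¹(F(s, t))` for `F ∈ C_c(G, C_0(G, A))`. -/
structure IsPhi₃ (Φ : Crossed p (Measure.count : Measure G) (ltTensor α) →ₙₐ[ℂ]
    Crossed p (Measure.count : Measure G) (ltTensor (trivialAction G A))) : Prop where
  continuous : Continuous Φ
  formula : ∀ F : C_c(G, C₀(G, A)), ∃ F' : C_c(G, C₀(G, A)),
    (∀ s t, F' s t = α.act t⁻¹ (F s t)) ∧
    Φ (Crossed.of p Measure.count _ F) = Crossed.of p Measure.count _ F'

end Phi

/-! ### `L^p` operator algebras and unique matrix norms -/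

/-- `A` is an `L^p` operator algebra: it has an isometric representation on some `L^p` space. -/
def IsLpOperatorAlgebra (p : ℝ≥0∞) [Fact (1 ≤ p)] (A : Type u) [NormedRing A]
    [NormedAlgebra ℂ A] : Prop :=
  ∃ (X : Type u) (_ : MeasurableSpace X) (ν : Measure X)
    (π : A →ₙₐ[ℂ] (Lp ℂ p ν →L[ℂ] Lp ℂ p ν)), ∀ a, ‖π a‖ = ‖a‖

/-- A matrix of operators on a Banach space `E` acting on the `ℓ^p` direct sum of `n` copies of
`E`. For `E = L^p(X, ν)` this sum is `L^p({1, …, n} × X)`, with counting measure on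
`{1, …, n}`. -/
def matrixOperator (p : ℝ≥0∞) [Fact (1 ≤ p)] {E : Type u} [NormedAddCommGroup E]
    [NormedSpace ℂ E] {n : ℕ} (T : Matrix (Fin n) (Fin n) (E →L[ℂ] E)) :
    PiLp p (fun _ : Fin n => E) →L[ℂ] PiLp p (fun _ : Fin n => E) :=
  ((PiLp.continuousLinearEquiv p ℂ (fun _ : Fin n => E)).symm :
      (Fin n → E) →L[ℂ] PiLp p (fun _ : Fin n => E)) ∘L
    (ContinuousLinearMap.pi fun i => ∑ j, (T i j) ∘L ContinuousLinearMap.proj j) ∘L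
    (PiLp.continuousLinearEquiv p ℂ (fun _ : Fin n => E) :
      PiLp p (fun _ : Fin n => E) →L[ℂ] (Fin n → E))

theorem matrixOperator_apply (p : ℝ≥0∞) [Fact (1 ≤ p)] {E : Type u} [NormedAddCommGroup E]
    [NormedSpace ℂ E] {n : ℕ} (T : Matrix (Fin n) (Fin n) (E →L[ℂ] E))
    (ξ : PiLp p (fun _ : Fin n => E)) (i : Fin n) :
    matrixOperator p T ξ i = ∑ j, T i j (ξ j) := by
  simp [matrixOperator]

/-- `A` has unique `L^p` operator matrix norms: any two isometric representations on separable
`L^p` spaces of `σ`-finite measures induce the same norms on all matrix algebras over `A`. -/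
def HasUniqueLpMatrixNorms (p : ℝ≥0∞) [Fact (1 ≤ p)] (A : Type u) [NormedRing A]
    [NormedAlgebra ℂ A] : Prop :=
  ∀ (X Y : Type u) (_ : MeasurableSpace X) (_ : MeasurableSpace Y) (ν : Measure X)
    (κ : Measure Y) (_ : SigmaFinite ν) (_ : SigmaFinite κ)
    (_ : TopologicalSpace.SeparableSpace (Lp ℂ p ν))
    (_ : TopologicalSpace.SeparableSpace (Lp ℂ p κ))
    (π : A →ₙₐ[ℂ] (Lp ℂ p ν →L[ℂ] Lp ℂ p ν)) (σ : A →ₙₐ[ℂ] (Lp ℂ p κ →L[ℂ] Lp ℂ p κ)),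
    (∀ a, ‖π a‖ = ‖a‖) → (∀ a, ‖σ a‖ = ‖a‖) →
    ∀ (n : ℕ) (a : Matrix (Fin n) (Fin n) A),
      ‖matrixOperator p (a.map π)‖ = ‖matrixOperator p (a.map σ)‖

end LpCrossed

end

open LpCrossed

open scoped TensorProduct

/-!
Each `Φᵢ` intertwines covariant representations: every covariant representation of the target
system yields one of the source system, on the same `L^p` space and with the same integrated
operators on a dense space of functions, so that `Φᵢ` is contractive for the universal norms.
Constructing it means recovering an algebra and a group from their integrated form. The elements
of `F^p(Ĝ, A, β)` are disintegrated by extending its nondegenerate representation to the left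
multipliers given by `A` and `Ĝ`; for `C₀(G, A)` the relevant multipliers are pointwise
multiplication by elements of `A` and by conjugate characters, whose integrated form is
multiplication by a Fourier transform. Uniqueness and equivariance are read off from the formulas
on functions.
-/

noncomputable section

namespace LpCrossed

/-! ### Extending representations to left multipliers -/

section Multiplier

variable {D E F : Type*} [NonUnitalNormedRing D] [NormedSpace ℂ D]
  [NormedAddCommGroup E] [NormedSpace ℂ E] [NormedAddCommGroup F] [NormedSpace ℂ F]

/-- A contractive algebra homomorphism as a continuous linear map. -/
def contractiveClm {R : Type*} [NonUnitalNormedRing R] [NormedSpace ℂ R] (φ : D →ₙₐ[ℂ] R)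
    (hφ : ∀ x, ‖φ x‖ ≤ ‖x‖) : D →L[ℂ] R :=
  (φ : D →ₗ[ℂ] R).mkContinuous 1 fun x => by simpa using hφ x

/-- A Banach algebra has a contractive left approximate unit: a filter concentrated on the closed
unit ball along which `e * x` tends to `x` for every `x`. -/
def HasContractiveLeftApproxUnit (D : Type*) [NonUnitalNormedRing D] : Prop :=
  ∃ l : Filter D, l.NeBot ∧ (∀ᶠ e in l, ‖e‖ ≤ 1) ∧
    ∀ x, Filter.Tendsto (fun e => e * x) l (𝓝 x)

/-- The bounded left multipliers of a Banach algebra: the operators commuting with all right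
multiplications. -/
def leftMultipliers (D : Type*) [NonUnitalNormedRing D] [NormedSpace ℂ D]
    [IsScalarTower ℂ D D] : Subalgebra ℂ (D →L[ℂ] D) where
  carrier := {L | ∀ x y, L (x * y) = L x * y}
  mul_mem' {L M} hL hM x y := by
    rw [mul_apply_eq_comp, mul_apply_eq_comp, hM, hL]
  add_mem' {L M} hL hM x y := by
    rw [_root_.add_apply, _root_.add_apply, hL, hM, add_mul]
  algebraMap_mem' c x y := by
    simp only [ContinuousLinearMap.algebraMap_apply, smul_mul_assoc]

/-- A nondegenerate contractive representation of a Banach algebra on a Banach space. -/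
structure NondegenerateRep (D E : Type*) [NonUnitalNormedRing D] [NormedSpace ℂ D]
    [NormedAddCommGroup E] [NormedSpace ℂ E] where
  hom : D →ₙₐ[ℂ] (E →L[ℂ] E)
  norm_hom_le : ∀ d, ‖hom d‖ ≤ ‖d‖
  nondegenerate : Dense (Submodule.span ℂ {η | ∃ d ξ, η = hom d ξ} : Set E)

namespace NondegenerateRep

variable (π : NondegenerateRep D E)

theorem norm_apply_le (d : D) (ξ : E) : ‖π.hom d ξ‖ ≤ ‖d‖ * ‖ξ‖ :=
  (π.hom d).le_of_opNorm_le (π.norm_hom_le d) ξ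

theorem continuous_hom : Continuous π.hom :=
  (contractiveClm π.hom π.norm_hom_le).continuous

/-- The action of a representation as a linear map `D ⊗ E → E`; nondegeneracy is the density of
its range. -/
def action : D ⊗[ℂ] E →ₗ[ℂ] E :=
  TensorProduct.lift <| LinearMap.mk₂ ℂ (fun d ξ => π.hom d ξ)
    (fun d e ξ => by rw [map_add, _root_.add_apply])
    (fun c d ξ => by rw [map_smul, _root_.smul_apply])
    (fun d ξ η => map_add (π.hom d) ξ η) (fun c d ξ => map_smul (π.hom d) c ξ)

theorem action_tmul (d : D) (ξ : E) : π.action (d ⊗ₜ ξ) = π.hom d ξ :=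
  TensorProduct.lift.tmul d ξ

theorem denseRange_action : DenseRange π.action := by
  have hspan : Submodule.span ℂ {η | ∃ d ξ, η = π.hom d ξ} ≤ LinearMap.range π.action :=
    Submodule.span_le.2 fun η ⟨d, ξ, h⟩ => ⟨d ⊗ₜ ξ, (π.action_tmul d ξ).trans h.symm⟩
  exact π.nondegenerate.mono hspan

theorem clm_ext {S T : E →L[ℂ] F} (h : ∀ d ξ, S (π.hom d ξ) = T (π.hom d ξ)) : S = T := by
  have hcomp : S.toLinearMap ∘ₗ π.action = T.toLinearMap ∘ₗ π.action :=
    TensorProduct.ext' fun d ξ => by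
      simp only [LinearMap.comp_apply, action_tmul]
      exact h d ξ
  exact DFunLike.coe_injective <| π.denseRange_action.equalizer S.continuous T.continuous
    (congrArg DFunLike.coe hcomp)

variable [IsScalarTower ℂ D D]

/-- The map `x ⊗ ξ ↦ π (L x) ξ`, which factors through the action to the extension of `π`
at `L`. -/
def multiplierAction (L : leftMultipliers D) : D ⊗[ℂ] E →ₗ[ℂ] E :=
  π.action ∘ₗ L.1.toLinearMap.rTensor E

theorem multiplierAction_tmul (L : leftMultipliers D) (x : D) (ξ : E) :
    π.multiplierAction L (x ⊗ₜ ξ) = π.hom (L.1 x) ξ :=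
  π.action_tmul _ ξ

theorem tendsto_hom_action (L : leftMultipliers D) {l : Filter D}
    (hl : ∀ x, Filter.Tendsto (fun e => e * x) l (𝓝 x)) (z : D ⊗[ℂ] E) :
    Filter.Tendsto (fun e => π.hom (L.1 e) (π.action z)) l
      (𝓝 (π.multiplierAction L z)) := by
  induction z using TensorProduct.induction_on with
  | zero => simp only [map_zero, tendsto_const_nhds]
  | tmul x ξ =>
    have hcont : Continuous fun y => π.hom (L.1 y) ξ :=
      (π.continuous_hom.comp L.1.continuous).clm_apply continuous_const
    rw [multiplierAction_tmul]
    refine ((hcont.tendsto x).comp (hl x)).congr fun e => ?_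
    rw [Function.comp_apply, L.2 e x, map_mul, action_tmul, mul_apply_eq_comp]
  | add z w hz hw => simpa only [map_add] using hz.add hw

theorem norm_multiplierAction_le (hD : HasContractiveLeftApproxUnit D) (L : leftMultipliers D)
    (z : D ⊗[ℂ] E) : ‖π.multiplierAction L z‖ ≤ ‖L‖ * ‖π.action z‖ := by
  obtain ⟨l, hl, hnorm, hlim⟩ := hD
  refine le_of_tendsto (π.tendsto_hom_action L hlim z).norm (hnorm.mono fun e he => ?_)
  refine (π.norm_apply_le _ _).trans (mul_le_mul_of_nonneg_right ?_ (norm_nonneg _))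
  exact (L.1.le_opNorm e).trans (mul_le_of_le_one_right (norm_nonneg _) he)

variable [CompleteSpace E]

/-- The operator of the extension of `π` to left multipliers, on a single multiplier. -/
def extendClm (L : leftMultipliers D) : E →L[ℂ] E :=
  (π.multiplierAction L).extendOfNorm π.action

theorem extendClm_apply (hD : HasContractiveLeftApproxUnit D) (L : leftMultipliers D) (x : D)
    (ξ : E) : π.extendClm L (π.hom x ξ) = π.hom (L.1 x) ξ := by
  rw [← π.action_tmul, ← π.multiplierAction_tmul]
  exact LinearMap.extendOfNorm_eq π.denseRange_action
    ⟨‖L‖, π.norm_multiplierAction_le hD L⟩ (x ⊗ₜ ξ)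

variable (hD : HasContractiveLeftApproxUnit D)

/-- The extension of a nondegenerate representation to left multipliers. -/
def extend : leftMultipliers D →ₐ[ℂ] (E →L[ℂ] E) :=
  AlgHom.ofLinearMap
    { toFun := π.extendClm
      map_add' := fun L M => π.clm_ext fun x ξ => by
        rw [_root_.add_apply]
        simp only [π.extendClm_apply hD, Subalgebra.coe_add, _root_.add_apply, map_add]
      map_smul' := fun c L => π.clm_ext fun x ξ => by
        rw [_root_.smul_apply]
        simp only [π.extendClm_apply hD, Subalgebra.coe_smul, _root_.smul_apply, map_smul,
          RingHom.id_apply] }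
    (π.clm_ext fun x ξ => π.extendClm_apply hD 1 x ξ)
    (fun L M => π.clm_ext fun x ξ => by
      simp only [LinearMap.coe_mk, AddHom.coe_mk, mul_apply_eq_comp,
        π.extendClm_apply hD, Subalgebra.coe_mul])

theorem extend_apply (L : leftMultipliers D) (x : D) (ξ : E) :
    π.extend hD L (π.hom x ξ) = π.hom (L.1 x) ξ :=
  π.extendClm_apply hD L x ξ

theorem norm_extend_le (L : leftMultipliers D) : ‖π.extend hD L‖ ≤ ‖L‖ :=
  LinearMap.opNorm_extendOfNorm_le π.denseRange_action (norm_nonneg _)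
    (π.norm_multiplierAction_le hD L)

theorem mul_extend {W : E →L[ℂ] E} {θ : D → D} (hW : ∀ x, W * π.hom x = π.hom (θ x) * W)
    {L M : leftMultipliers D} (hLM : ∀ x, θ (L.1 x) = M.1 (θ x)) :
    W * π.extend hD L = π.extend hD M * W := by
  have hW' (x : D) (ξ : E) : W (π.hom x ξ) = π.hom (θ x) (W ξ) := DFunLike.congr_fun (hW x) ξ
  refine π.clm_ext fun x ξ => ?_
  simp only [mul_apply_eq_comp, extend_apply, hW', hLM]

end NondegenerateRep

end Multiplier

section Integrated

variable {H B : Type u} [Group H] [TopologicalSpace H] [IsTopologicalGroup H]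
  [MeasurableSpace H] [BorelSpace H]
  [NonUnitalNormedRing B] [NormedSpace ℂ B] [IsScalarTower ℂ B B] [SMulCommClass ℂ B B]
  [CompleteSpace B]
  {p : ℝ≥0∞} [Fact (1 ≤ p)] {α : IsometricAction H B}

/-- The algebra representation underlying a covariant representation. -/
def CovRep.toNondegenerateRep (ρ : CovRep p α) : NondegenerateRep B ρ.E where
  hom := ρ.π
  norm_hom_le := ρ.norm_π_le
  nondegenerate := ρ.nondegenerate

variable (μ : Measure H) [IsFiniteMeasureOnCompacts μ] [μ.IsMulLeftInvariant]

/-- The integrated form of a covariant representation, extended to `F^p(H, B, α)`. -/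
def CovRep.integratedHom (ρ : CovRep p α) : Crossed p μ α →ₙₐ[ℂ] (ρ.E →L[ℂ] ρ.E) :=
  Crossed.liftHom
    { toFun := ρ.integrated μ
      map_add' := ρ.integrated_add μ
      map_smul' := ρ.integrated_smul μ }
    (ρ.norm_integrated_le_universalNorm μ) (ρ.integrated_convolution μ)

variable {μ}

theorem CovRep.integratedHom_of (ρ : CovRep p α) (f : C_c(H, B)) :
    ρ.integratedHom μ (Crossed.of p μ α f) = ρ.integrated μ f :=
  Crossed.liftHom_of _ _ _ _

theorem CovRep.norm_integratedHom_le (ρ : CovRep p α) (x : Crossed p μ α) :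
    ‖ρ.integratedHom μ x‖ ≤ ‖x‖ :=
  Crossed.norm_liftHom_le _ _ _ x

theorem CovRep.continuous_integratedHom (ρ : CovRep p α) : Continuous (ρ.integratedHom μ) :=
  Crossed.continuous_liftHom _ _ _

theorem Crossed.eq_zero_of_forall_covRep {x : Crossed p μ α}
    (h : ∀ ρ : CovRep p α, ρ.integratedHom μ x = 0) : x = 0 := by
  rw [← norm_le_zero_iff]
  refine le_of_forall_pos_le_add fun ε hε => ?_
  obtain ⟨f, hf⟩ := Crossed.denseRange_of.exists_dist_lt x (half_pos hε)
  rw [dist_eq_norm] at hf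
  have hof : ‖Crossed.of p μ α f‖ ≤ ε / 2 := by
    rw [Crossed.norm_of]
    refine universalNorm_le (half_pos hε).le fun ρ => ?_
    have hρ := (ρ.norm_integratedHom_le (x - Crossed.of p μ α f)).trans hf.le
    rwa [map_sub, h, zero_sub, norm_neg, ρ.integratedHom_of] at hρ
  calc ‖x‖ ≤ ‖x - Crossed.of p μ α f‖ + ‖Crossed.of p μ α f‖ := norm_le_norm_sub_add _ _
    _ ≤ 0 + ε := by linarith

theorem Crossed.ext_covRep {x y : Crossed p μ α}
    (h : ∀ ρ : CovRep p α, ρ.integratedHom μ x = ρ.integratedHom μ y) : x = y :=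
  sub_eq_zero.1 <| Crossed.eq_zero_of_forall_covRep fun ρ => by rw [map_sub, h, sub_self]

theorem Crossed.exists_hom_of_compatible {V D : Type*} [AddCommGroup V] [Module ℂ V]
    [NonUnitalNormedRing D] [NormedSpace ℂ D] {e : V →ₗ[ℂ] D} (he : DenseRange e)
    (f : V →ₗ[ℂ] C_c(H, B)) (φ : ∀ ρ : CovRep p α, D →ₙₐ[ℂ] (ρ.E →L[ℂ] ρ.E))
    (hφ : ∀ ρ x, ‖φ ρ x‖ ≤ ‖x‖) (h : ∀ ρ v, φ ρ (e v) = ρ.integrated μ (f v)) :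
    ∃ Φ : D →ₙₐ[ℂ] Crossed p μ α, Continuous Φ ∧ ∀ v, Φ (e v) = Crossed.of p μ α (f v) := by
  let T : D →L[ℂ] Crossed p μ α := (Crossed.of p μ α ∘ₗ f).extendOfNorm e
  have hbound (v : V) : ‖(Crossed.of p μ α ∘ₗ f) v‖ ≤ 1 * ‖e v‖ := by
    rw [LinearMap.comp_apply, Crossed.norm_of, one_mul]
    exact universalNorm_le (norm_nonneg _) fun ρ => h ρ v ▸ hφ ρ (e v)
  have hT (v : V) : T (e v) = Crossed.of p μ α (f v) :=
    LinearMap.extendOfNorm_eq he ⟨1, hbound⟩ v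
  have hρ (ρ : CovRep p α) (x : D) : ρ.integratedHom μ (T x) = φ ρ x := by
    refine he.induction_on x (isClosed_eq (ρ.continuous_integratedHom.comp T.continuous)
      (contractiveClm (φ ρ) (hφ ρ)).continuous) fun v => ?_
    rw [hT, ρ.integratedHom_of, h]
  have hmul (x y : D) : T (x * y) = T x * T y :=
    Crossed.ext_covRep fun ρ => by simp only [map_mul, hρ]
  exact ⟨{ T.toLinearMap with map_mul' := hmul, map_zero' := map_zero T }, T.continuous, hT⟩

end Integrated

theorem conj_eq_of_mul_eq_mul {H M : Type*} [Group H] [Monoid M] (v : H →* M) {t : H} {x y : M}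
    (h : v t * x = y * v t) : v t * x * v t⁻¹ = y := by
  rw [h, mul_assoc, ← map_mul, mul_inv_cancel, map_one, mul_one]

theorem continuous_apply_of_denseRange {Y V E F : Type*} [TopologicalSpace Y]
    [NormedAddCommGroup E] [NormedSpace ℂ E] [NormedAddCommGroup F] [NormedSpace ℂ F]
    {T : Y → E →L[ℂ] F} {C : ℝ} (hT : ∀ y, ‖T y‖ ≤ C) {e : V → E} (he : DenseRange e)
    (h : ∀ v, Continuous fun y => T y (e v)) (x : E) : Continuous fun y => T y x := by
  refine continuous_of_uniform_approx_of_continuous fun V hV => ?_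
  obtain ⟨ε, hε, hV⟩ := Metric.mem_uniformity_dist.1 hV
  obtain ⟨δ, hδ, hCδ⟩ := exists_pos_mul_lt hε C
  obtain ⟨v, hv⟩ := he.exists_dist_lt x hδ
  refine ⟨_, h v, fun y => hV ?_⟩
  rw [dist_eq_norm, ← map_sub]
  have hC : 0 ≤ C := (norm_nonneg _).trans (hT y)
  calc ‖T y (x - e v)‖ ≤ C * ‖x - e v‖ := (T y).le_of_opNorm_le (hT y) _
    _ ≤ C * δ := by rw [← dist_eq_norm]; gcongr
    _ < ε := hCδ

section MultiplierSystem

variable {H B : Type u} [Group H] [TopologicalSpace H] [NormedRing B] [NormedAlgebra ℂ B]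

/-- A covariant homomorphism of a dynamical system `(H, B, α)` with unital `B` into the contractive
left multipliers of a Banach algebra `D`. -/
structure MultiplierSystem (α : IsometricAction H B) (D : Type*) [NonUnitalNormedRing D]
    [NormedSpace ℂ D] [IsScalarTower ℂ D D] where
  left : B →ₙₐ[ℂ] leftMultipliers D
  left_one : left 1 = 1
  norm_left_le : ∀ b, ‖left b‖ ≤ ‖b‖
  shift : H →* leftMultipliers D
  norm_shift_le : ∀ s, ‖shift s‖ ≤ 1
  continuous_shift : ∀ x, Continuous fun s => (shift s).1 x
  covariant : ∀ s b, shift s * left b = left (α.act s b) * shift s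

namespace MultiplierSystem

variable {α : IsometricAction H B} {D E : Type*} [NonUnitalNormedRing D] [NormedSpace ℂ D]
  [IsScalarTower ℂ D D] [NormedAddCommGroup E] [NormedSpace ℂ E] [CompleteSpace E]
  (M : MultiplierSystem α D)

/-- `M.left` as a continuous linear map into the operators on `D`. -/
def leftL : B →L[ℂ] D →L[ℂ] D :=
  (leftMultipliers D).toSubmodule.subtypeL ∘L contractiveClm M.left M.norm_left_le

theorem continuous_left_shift (f : C_c(H, B)) (x : D) :
    Continuous fun s => (M.left (f s)).1 ((M.shift s).1 x) :=
  (M.leftL.continuous.comp (map_continuous f)).clm_apply (M.continuous_shift x)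

theorem integrable_left_shift [MeasurableSpace H] [BorelSpace H] (μ : Measure H)
    [IsFiniteMeasureOnCompacts μ] (f : C_c(H, B)) (x : D) :
    Integrable (fun s => (M.left (f s)).1 ((M.shift s).1 x)) μ := by
  refine (M.continuous_left_shift f x).integrable_of_hasCompactSupport
    (f.hasCompactSupport.mono fun s hs h0 => hs ?_)
  simp only [h0, map_zero, ZeroMemClass.coe_zero, _root_.zero_apply]

section Rep

variable (hD : HasContractiveLeftApproxUnit D) (π : NondegenerateRep D E)

/-- The representation of the coefficient algebra induced by a representation of `D`. -/
def algRep : B →ₙₐ[ℂ] (E →L[ℂ] E) :=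
  (π.extend hD : leftMultipliers D →ₙₐ[ℂ] (E →L[ℂ] E)).comp M.left

theorem algRep_apply (b : B) (x : D) (ξ : E) :
    M.algRep hD π b (π.hom x ξ) = π.hom ((M.left b).1 x) ξ :=
  π.extend_apply hD _ x ξ

theorem norm_algRep_le (b : B) : ‖M.algRep hD π b‖ ≤ ‖b‖ :=
  (π.norm_extend_le hD _).trans (M.norm_left_le b)

theorem algRep_one : M.algRep hD π 1 = 1 :=
  (congrArg (π.extend hD) M.left_one).trans (map_one _)

/-- The representation of the group induced by a representation of `D`. -/
def groupRep : H →* (E →L[ℂ] E) :=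
  (π.extend hD : leftMultipliers D →* (E →L[ℂ] E)).comp M.shift

theorem groupRep_apply (s : H) (x : D) (ξ : E) :
    M.groupRep hD π s (π.hom x ξ) = π.hom ((M.shift s).1 x) ξ :=
  π.extend_apply hD _ x ξ

theorem norm_groupRep_le (s : H) : ‖M.groupRep hD π s‖ ≤ 1 :=
  (π.norm_extend_le hD _).trans (M.norm_shift_le s)

theorem norm_groupRep_apply (s : H) (ξ : E) : ‖M.groupRep hD π s ξ‖ = ‖ξ‖ := by
  have hle (s : H) (ξ : E) : ‖M.groupRep hD π s ξ‖ ≤ ‖ξ‖ :=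
    ((M.groupRep hD π s).le_of_opNorm_le (M.norm_groupRep_le hD π s) ξ).trans_eq (one_mul _)
  refine le_antisymm (hle s ξ) ?_
  calc ‖ξ‖ = ‖M.groupRep hD π s⁻¹ (M.groupRep hD π s ξ)‖ := by
        rw [← mul_apply_eq_comp, ← map_mul, inv_mul_cancel, map_one, one_apply_eq_self]
    _ ≤ ‖M.groupRep hD π s ξ‖ := hle _ _

theorem continuous_groupRep (ξ : E) : Continuous fun s => M.groupRep hD π s ξ := by
  refine continuous_apply_of_denseRange (M.norm_groupRep_le hD π) π.denseRange_action
    (fun z => ?_) ξ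
  induction z using TensorProduct.induction_on with
  | zero => simp only [map_zero, continuous_const]
  | tmul x η =>
    simp only [π.action_tmul, M.groupRep_apply]
    exact (π.continuous_hom.comp (M.continuous_shift x)).clm_apply continuous_const
  | add z w hz hw =>
    simp only [map_add]
    exact Continuous.add hz hw

theorem groupRep_mul_algRep (s : H) (b : B) :
    M.groupRep hD π s * M.algRep hD π b = M.algRep hD π (α.act s b) * M.groupRep hD π s := by
  have h := congrArg (π.extend hD) (M.covariant s b)
  rwa [map_mul, map_mul] at h

end Rep

variable {p : ℝ≥0∞} [Fact (1 ≤ p)] {X : Type u} [MeasurableSpace X] {ν : Measure X}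
  [SigmaFinite ν] (hD : HasContractiveLeftApproxUnit D) (π : NondegenerateRep D (Lp ℂ p ν))

/-- A nondegenerate representation of `D` on an `L^p` space induces a covariant representation
of any dynamical system acting on `D` by multipliers. -/
def covRep : CovRep p α where
  X := X
  ν := ν
  π := M.algRep hD π
  v := M.groupRep hD π
  norm_π_le := M.norm_algRep_le hD π
  nondegenerate := by
    refine Dense.mono Submodule.subset_span (dense_univ.mono fun ξ _ => ⟨1, ξ, ?_⟩)
    rw [M.algRep_one, one_apply_eq_self]
  norm_v := M.norm_groupRep_apply hD π
  continuous_v := M.continuous_groupRep hD π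
  covariant t b := conj_eq_of_mul_eq_mul (M.groupRep hD π) (M.groupRep_mul_algRep hD π t b)

variable [MeasurableSpace H] [BorelSpace H] {μ : Measure H} [IsFiniteMeasureOnCompacts μ]
  [CompleteSpace D]

theorem integrated_covRep_apply (f : C_c(H, B)) (x : D) (ξ : Lp ℂ p ν) :
    (M.covRep hD π).integrated μ f (π.hom x ξ) =
      π.hom (∫ s, (M.left (f s)).1 ((M.shift s).1 x) ∂μ) ξ := by
  have hcomm := ((contractiveClm π.hom π.norm_hom_le).flip ξ).integral_comp_comm
    (M.integrable_left_shift μ f x)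
  refine Eq.trans ?_ hcomm
  change ∫ s, M.algRep hD π (f s) (M.groupRep hD π s (π.hom x ξ)) ∂μ =
    ∫ s, π.hom ((M.left (f s)).1 ((M.shift s).1 x)) ξ ∂μ
  simp only [groupRep_apply, algRep_apply]

theorem integrated_covRep {f : C_c(H, B)} {y : D}
    (h : ∀ x, ∫ s, (M.left (f s)).1 ((M.shift s).1 x) ∂μ = y * x) :
    (M.covRep hD π).integrated μ f = π.hom y :=
  π.clm_ext fun x ξ => by
    refine (M.integrated_covRep_apply hD π f x ξ).trans ?_
    rw [h, map_mul]
    rfl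

end MultiplierSystem

end MultiplierSystem

/-! ### Approximate units in crossed products -/

section Bump

variable {H : Type u} [Group H] [TopologicalSpace H] [MeasurableSpace H] (μ : Measure H)

/-- The filter of nonnegative functions of integral one with support shrinking to the identity. -/
def bumpFilter : Filter C_c(H, ℝ) :=
  Filter.comap (fun φ : C_c(H, ℝ) => Function.support φ) (𝓝 (1 : H)).smallSets ⊓
    Filter.principal {φ | (∀ s, 0 ≤ φ s) ∧ ∫ s, φ s ∂μ = 1}

theorem eventually_bumpFilter_nonneg : ∀ᶠ φ in bumpFilter μ, ∀ s, 0 ≤ φ s :=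
  Filter.mem_inf_of_right (Filter.mem_principal.2 fun _ h => h.1)

theorem eventually_bumpFilter_integral : ∀ᶠ φ in bumpFilter μ, ∫ s, φ s ∂μ = 1 :=
  Filter.mem_inf_of_right (Filter.mem_principal.2 fun _ h => h.2)

theorem eventually_bumpFilter_support {U : Set H} (hU : U ∈ 𝓝 (1 : H)) :
    ∀ᶠ φ : C_c(H, ℝ) in bumpFilter μ, Function.support φ ⊆ U :=
  Filter.mem_inf_of_left <| Filter.mem_comap.2
    ⟨{V | V ⊆ U}, Filter.eventually_smallSets.2 ⟨U, hU, fun _ => id⟩, fun _ => id⟩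

variable [BorelSpace H] [IsFiniteMeasureOnCompacts μ]

instance bumpFilter_neBot [IsTopologicalGroup H] [LocallyCompactSpace H] [μ.IsOpenPosMeasure] :
    (bumpFilter μ).NeBot := by
  rw [bumpFilter, Filter.inf_principal_neBot_iff]
  intro t ht
  obtain ⟨S, hS, hSt⟩ := Filter.mem_comap.1 ht
  obtain ⟨U, hU, hUS⟩ := Filter.eventually_smallSets.1 hS
  obtain ⟨V, hVU, hV, h1V⟩ := mem_nhds_iff.1 hU
  obtain ⟨f, hf1, hf0, hfc, hf⟩ := exists_continuous_one_zero_of_isCompact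
    (isCompact_singleton (x := (1 : H))) hV.isClosed_compl
    (Set.disjoint_compl_right_iff_subset.2 (Set.singleton_subset_iff.2 h1V))
  have hpos : 0 < ∫ s, f s ∂μ :=
    f.continuous.integral_pos_of_hasCompactSupport_nonneg_nonzero hfc (fun s => (hf s).1)
      (x := 1) (by rw [hf1 rfl]; exact one_ne_zero)
  have hsupp : Function.support (fun s => (∫ s, f s ∂μ)⁻¹ * f s) ⊆ U := by
    refine fun s hs => hVU (by_contra fun h => hs ?_)
    simp only [hf0 h, Pi.zero_apply, mul_zero]
  refine ⟨⟨⟨fun s => (∫ s, f s ∂μ)⁻¹ * f s, by fun_prop⟩, hfc.mul_left⟩, hSt (hUS _ hsupp),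
    fun s => mul_nonneg (inv_nonneg.2 hpos.le) (hf s).1, ?_⟩
  exact (integral_const_mul _ _).trans (inv_mul_cancel₀ hpos.ne')

theorem tendsto_integral_bumpFilter {E : Type*} [NormedAddCommGroup E] [NormedSpace ℝ E]
    [CompleteSpace E] {g : H → E} (hg : Continuous g) :
    Filter.Tendsto (fun φ : C_c(H, ℝ) => ∫ s, φ s • g s ∂μ) (bumpFilter μ) (𝓝 (g 1)) := by
  rw [Metric.tendsto_nhds]
  intro ε hε
  filter_upwards [eventually_bumpFilter_nonneg μ, eventually_bumpFilter_integral μ,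
    eventually_bumpFilter_support μ (Metric.tendsto_nhds.1 (hg.tendsto 1) _ (half_pos hε))]
    with φ hφ0 hφ1 hφs
  have hφ : Integrable (fun s => φ s) μ :=
    (map_continuous φ).integrable_of_hasCompactSupport φ.hasCompactSupport
  have hφg : Integrable (fun s => φ s • g s) μ :=
    ((map_continuous φ).smul hg).integrable_of_hasCompactSupport φ.hasCompactSupport.smul_right
  have hsub : (∫ s, φ s • g s ∂μ) - g 1 = ∫ s, φ s • (g s - g 1) ∂μ := by
    simp only [smul_sub]
    rw [integral_sub hφg (hφ.smul_const _), integral_smul_const, hφ1, one_smul]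
  have hle (s : H) : ‖φ s • (g s - g 1)‖ ≤ φ s * (ε / 2) := by
    rw [norm_smul, Real.norm_of_nonneg (hφ0 s)]
    by_cases hs : φ s = 0
    · simp only [hs, zero_mul, le_refl]
    · exact mul_le_mul_of_nonneg_left (dist_eq_norm (g s) (g 1) ▸ (hφs hs).le) (hφ0 s)
  calc dist (∫ s, φ s • g s ∂μ) (g 1) = ‖∫ s, φ s • (g s - g 1) ∂μ‖ := by rw [dist_eq_norm, hsub]
    _ ≤ ∫ s, φ s * (ε / 2) ∂μ := norm_integral_le_of_norm_le (hφ.mul_const _) (.of_forall hle)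
    _ = ε / 2 := by rw [integral_mul_const, hφ1, one_mul]
    _ < ε := half_lt_self hε

end Bump

section CrossedMultiplier

variable {H B : Type u} [Group H] [TopologicalSpace H] [NonUnitalNormedRing B] [NormedSpace ℂ B]
  {p : ℝ≥0∞} [Fact (1 ≤ p)] {α : IsometricAction H B}

theorem CovRep.norm_v_le (ρ : CovRep p α) (s : H) : ‖ρ.v s‖ ≤ 1 :=
  ContinuousLinearMap.opNorm_le_bound _ zero_le_one fun ξ => by rw [ρ.norm_v, one_mul]

/-- Pointwise left multiplication by `b` on `C_c(H, B)`. -/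
def leftMulCc [SMulCommClass ℂ B B] (b : B) : C_c(H, B) →ₗ[ℂ] C_c(H, B) where
  toFun f := ⟨⟨fun s => b * f s, by fun_prop⟩, f.hasCompactSupport.mul_left⟩
  map_add' f g := by ext s; exact mul_add _ _ _
  map_smul' c f := by ext s; exact mul_smul_comm c b (f s)

variable [MeasurableSpace H] [BorelSpace H] {μ : Measure H} [IsFiniteMeasureOnCompacts μ]

theorem CovRep.integrated_leftMulCc [SMulCommClass ℂ B B] (ρ : CovRep p α) (b : B)
    (f : C_c(H, B)) :
    ρ.integrated μ (leftMulCc b f) = ρ.π b * ρ.integrated μ f := by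
  ext1 ξ
  change ∫ s, ρ.π (b * f s) (ρ.v s ξ) ∂μ = ρ.π b (∫ s, ρ.π (f s) (ρ.v s ξ) ∂μ)
  rw [← (ρ.π b).integral_comp_comm (ρ.integrable_integrand μ f ξ)]
  simp only [map_mul, mul_apply_eq_comp]

variable [IsTopologicalGroup H]

/-- The left translation `f ↦ (t ↦ α_s(f(s⁻¹ t)))` of `C_c(H, B)`. -/
def translateCc (α : IsometricAction H B) (s : H) : C_c(H, B) →ₗ[ℂ] C_c(H, B) where
  toFun f :=
    { toFun := fun t => α.act s (f (s⁻¹ * t))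
      continuous_toFun := (α.clm s).continuous.comp
        ((map_continuous f).comp (continuous_const.mul continuous_id))
      hasCompactSupport' := (f.hasCompactSupport.comp_homeomorph (Homeomorph.mulLeft s⁻¹)).comp_left
        (g := α.act s) (map_zero _) }
  map_add' f g := by ext t; exact map_add (α.act s) _ _
  map_smul' c f := by ext t; exact map_smul (α.act s) c _

theorem CovRep.integrated_translateCc [μ.IsMulLeftInvariant] (ρ : CovRep p α) (s : H)
    (f : C_c(H, B)) :
    ρ.integrated μ (translateCc α s f) = ρ.v s * ρ.integrated μ f := by
  ext1 ξ
  change ∫ t, ρ.π (α.act s (f (s⁻¹ * t))) (ρ.v t ξ) ∂μ = ρ.v s (∫ t, ρ.π (f t) (ρ.v t ξ) ∂μ)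
  rw [← (ρ.v s).integral_comp_comm (ρ.integrable_integrand μ f ξ),
    ← integral_mul_left_eq_self _ s]
  simp only [inv_mul_cancel_left, ρ.v_π, map_mul, mul_apply_eq_comp]

variable [IsScalarTower ℂ B B] [SMulCommClass ℂ B B] [CompleteSpace B] [μ.IsMulLeftInvariant]

theorem CovRep.integratedHom_clm (ρ : CovRep p α) {L : Crossed p μ α →L[ℂ] Crossed p μ α}
    {T : ρ.E →L[ℂ] ρ.E}
    (h : ∀ f, ρ.integratedHom μ (L (Crossed.of p μ α f)) = T * ρ.integrated μ f)
    (x : Crossed p μ α) : ρ.integratedHom μ (L x) = T * ρ.integratedHom μ x := by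
  induction x using Crossed.induction_on with
  | hc =>
    exact isClosed_eq (ρ.continuous_integratedHom.comp L.continuous)
      (continuous_const.mul ρ.continuous_integratedHom)
  | h f => rw [h, ρ.integratedHom_of]

section OfOperators

variable {L : C_c(H, B) →ₗ[ℂ] C_c(H, B)} {T : ∀ ρ : CovRep p α, ρ.E →L[ℂ] ρ.E} {C : ℝ}

theorem norm_of_comp_le (hC : 0 ≤ C) (hT : ∀ ρ, ‖T ρ‖ ≤ C)
    (h : ∀ ρ f, ρ.integrated μ (L f) = T ρ * ρ.integrated μ f) (f : C_c(H, B)) :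
    ‖Crossed.of p μ α (L f)‖ ≤ C * universalNorm p μ α f := by
  rw [Crossed.norm_of]
  refine universalNorm_le (mul_nonneg hC (universalNorm_nonneg p μ α f)) fun ρ => ?_
  rw [h]
  exact (norm_mul_le _ _).trans (mul_le_mul (hT ρ)
    (ρ.norm_integrated_le_universalNorm μ f) (norm_nonneg _) hC)

variable (L T C) in
/-- The left multiplier of `F^p(H, B, α)` extending an operator `L` on `C_c(H, B)` which every
covariant representation `ρ` turns into left multiplication by an operator `T ρ`. -/
def Crossed.multiplier (hC : 0 ≤ C) (hT : ∀ ρ, ‖T ρ‖ ≤ C)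
    (h : ∀ ρ f, ρ.integrated μ (L f) = T ρ * ρ.integrated μ f) :
    leftMultipliers (Crossed p μ α) :=
  have hρ (ρ : CovRep p α) := ρ.integratedHom_clm (T := T ρ)
    (L := Crossed.lift (Crossed.of p μ α ∘ₗ L) C (norm_of_comp_le hC hT h)) fun f => by
      rw [Crossed.lift_of, LinearMap.comp_apply, ρ.integratedHom_of, h]
  ⟨Crossed.lift (Crossed.of p μ α ∘ₗ L) C (norm_of_comp_le hC hT h), fun x y =>
    Crossed.ext_covRep fun ρ => by
      rw [hρ, map_mul (ρ.integratedHom μ), map_mul (ρ.integratedHom μ), hρ, mul_assoc]⟩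

variable (hC : 0 ≤ C) (hT : ∀ ρ, ‖T ρ‖ ≤ C)
  (h : ∀ ρ f, ρ.integrated μ (L f) = T ρ * ρ.integrated μ f)

theorem Crossed.multiplier_of (f : C_c(H, B)) :
    (Crossed.multiplier L T C hC hT h).1 (Crossed.of p μ α f) = Crossed.of p μ α (L f) :=
  Crossed.lift_of _ _ _ f

theorem Crossed.norm_multiplier_le : ‖Crossed.multiplier L T C hC hT h‖ ≤ C :=
  ContinuousLinearMap.opNorm_le_bound _ hC (Crossed.norm_lift_le _ _ _)

theorem CovRep.integratedHom_multiplier (ρ : CovRep p α) (x : Crossed p μ α) :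
    ρ.integratedHom μ ((Crossed.multiplier L T C hC hT h).1 x) = T ρ * ρ.integratedHom μ x :=
  ρ.integratedHom_clm (fun f => by rw [Crossed.multiplier_of, ρ.integratedHom_of, h]) x

end OfOperators

theorem Crossed.leftMultipliers_ext {L M : leftMultipliers (Crossed p μ α)}
    (h : ∀ (ρ : CovRep p α) x, ρ.integratedHom μ (L.1 x) = ρ.integratedHom μ (M.1 x)) : L = M :=
  Subtype.ext <| ContinuousLinearMap.ext fun x => Crossed.ext_covRep fun ρ => h ρ x

/-- Left multiplication by an element of `B`, as a left multiplier of `F^p(H, B, α)`. -/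
def Crossed.leftMulAux (p : ℝ≥0∞) [Fact (1 ≤ p)] (μ : Measure H) [IsFiniteMeasureOnCompacts μ]
    [μ.IsMulLeftInvariant] (α : IsometricAction H B) (b : B) : leftMultipliers (Crossed p μ α) :=
  Crossed.multiplier (leftMulCc b) (fun ρ => ρ.π b) ‖b‖ (norm_nonneg b)
    (fun ρ => ρ.norm_π_le b)
    (fun ρ => ρ.integrated_leftMulCc b)

theorem CovRep.integratedHom_leftMulAux (ρ : CovRep p α) (b : B) (x : Crossed p μ α) :
    ρ.integratedHom μ ((Crossed.leftMulAux p μ α b).1 x) = ρ.π b * ρ.integratedHom μ x :=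
  ρ.integratedHom_multiplier _ _ _ x

/-- Left multiplication by elements of `B`, as left multipliers of `F^p(H, B, α)`. -/
def Crossed.leftMul (p : ℝ≥0∞) [Fact (1 ≤ p)] (μ : Measure H)
    [IsFiniteMeasureOnCompacts μ] [μ.IsMulLeftInvariant] (α : IsometricAction H B) :
    B →ₙₐ[ℂ] leftMultipliers (Crossed p μ α) where
  toFun := Crossed.leftMulAux p μ α
  map_zero' := Crossed.leftMultipliers_ext fun ρ x => by
    rw [ρ.integratedHom_leftMulAux, map_zero, zero_mul]
    exact (map_zero (ρ.integratedHom μ)).symm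
  map_add' a b := Crossed.leftMultipliers_ext fun ρ x => by
    simp only [Subalgebra.coe_add, _root_.add_apply, map_add, ρ.integratedHom_leftMulAux, add_mul]
  map_smul' c b := Crossed.leftMultipliers_ext fun ρ x => by
    simp only [MonoidHom.id_apply, Subalgebra.coe_smul, _root_.smul_apply, map_smul,
      ρ.integratedHom_leftMulAux, smul_mul_assoc]
  map_mul' a b := Crossed.leftMultipliers_ext fun ρ x => by
    simp only [Subalgebra.coe_mul, mul_apply_eq_comp, ρ.integratedHom_leftMulAux, map_mul,
      mul_assoc]

theorem Crossed.leftMul_of (b : B) (f : C_c(H, B)) :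
    (Crossed.leftMul p μ α b).1 (Crossed.of p μ α f) = Crossed.of p μ α (leftMulCc b f) :=
  Crossed.multiplier_of (norm_nonneg b) (fun ρ => ρ.norm_π_le b)
    (fun ρ => ρ.integrated_leftMulCc b) f

theorem Crossed.norm_leftMul_le (b : B) : ‖Crossed.leftMul p μ α b‖ ≤ ‖b‖ :=
  Crossed.norm_multiplier_le (norm_nonneg b) (fun ρ => ρ.norm_π_le b)
    (fun ρ => ρ.integrated_leftMulCc b)

theorem CovRep.integratedHom_leftMul (ρ : CovRep p α) (b : B) (x : Crossed p μ α) :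
    ρ.integratedHom μ ((Crossed.leftMul p μ α b).1 x) = ρ.π b * ρ.integratedHom μ x :=
  ρ.integratedHom_leftMulAux b x

/-- Left translation by an element of `H`, as a left multiplier of `F^p(H, B, α)`. -/
def Crossed.translateAux (p : ℝ≥0∞) [Fact (1 ≤ p)] (μ : Measure H)
    [IsFiniteMeasureOnCompacts μ] [μ.IsMulLeftInvariant] (α : IsometricAction H B) (s : H) :
    leftMultipliers (Crossed p μ α) :=
  Crossed.multiplier (translateCc α s) (fun ρ => ρ.v s) 1 zero_le_one
    (fun ρ => ρ.norm_v_le s)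
    (fun ρ => ρ.integrated_translateCc s)

theorem CovRep.integratedHom_translateAux (ρ : CovRep p α) (s : H) (x : Crossed p μ α) :
    ρ.integratedHom μ ((Crossed.translateAux p μ α s).1 x) = ρ.v s * ρ.integratedHom μ x :=
  ρ.integratedHom_multiplier _ _ _ x

/-- Left translation by elements of `H`, as left multipliers of `F^p(H, B, α)`. -/
def Crossed.translate (p : ℝ≥0∞) [Fact (1 ≤ p)] (μ : Measure H)
    [IsFiniteMeasureOnCompacts μ] [μ.IsMulLeftInvariant] (α : IsometricAction H B) :
    H →* leftMultipliers (Crossed p μ α) where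
  toFun := Crossed.translateAux p μ α
  map_one' := Crossed.leftMultipliers_ext fun ρ x => by
    rw [ρ.integratedHom_translateAux, map_one, one_mul, Subalgebra.coe_one, one_apply_eq_self]
  map_mul' s t := Crossed.leftMultipliers_ext fun ρ x => by
    simp only [Subalgebra.coe_mul, mul_apply_eq_comp, ρ.integratedHom_translateAux, map_mul,
      mul_assoc]

theorem Crossed.translate_of (s : H) (f : C_c(H, B)) :
    (Crossed.translate p μ α s).1 (Crossed.of p μ α f) = Crossed.of p μ α (translateCc α s f) :=
  Crossed.multiplier_of zero_le_one (fun ρ => ρ.norm_v_le s)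
    (fun ρ => ρ.integrated_translateCc s) f

theorem Crossed.norm_translate_le (s : H) : ‖Crossed.translate p μ α s‖ ≤ 1 :=
  Crossed.norm_multiplier_le zero_le_one (fun ρ => ρ.norm_v_le s)
    (fun ρ => ρ.integrated_translateCc s)

theorem CovRep.integratedHom_translate (ρ : CovRep p α) (s : H) (x : Crossed p μ α) :
    ρ.integratedHom μ ((Crossed.translate p μ α s).1 x) = ρ.v s * ρ.integratedHom μ x :=
  ρ.integratedHom_translateAux s x

theorem Crossed.translate_mul_leftMul (s : H) (b : B) :
    Crossed.translate p μ α s * Crossed.leftMul p μ α b =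
      Crossed.leftMul p μ α (α.act s b) * Crossed.translate p μ α s :=
  Crossed.leftMultipliers_ext fun ρ x => by
    have hρ : ρ.v s * ρ.π b = ρ.π (α.act s b) * ρ.v s :=
      ContinuousLinearMap.ext fun ξ => ρ.v_π s b ξ
    simp only [Subalgebra.coe_mul, mul_apply_eq_comp, ρ.integratedHom_leftMul,
      ρ.integratedHom_translate, ← mul_assoc, hρ]

variable [LocallyCompactSpace H]

open scoped Pointwise in
theorem Crossed.continuous_translate_of (f : C_c(H, B)) :
    Continuous fun s => (Crossed.translate p μ α s).1 (Crossed.of p μ α f) := by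
  rw [continuous_iff_continuousAt]
  intro s₀
  obtain ⟨K, hK, hKs⟩ := exists_compact_mem_nhds s₀
  rw [ContinuousAt, tendsto_iff_norm_sub_tendsto_zero]
  have hle (s : H) : ‖(Crossed.translate p μ α s).1 (Crossed.of p μ α f) -
      (Crossed.translate p μ α s₀).1 (Crossed.of p μ α f)‖ ≤
      ∫ t, ‖α.act s (f (s⁻¹ * t)) - α.act s₀ (f (s₀⁻¹ * t))‖ ∂μ := by
    rw [Crossed.translate_of, Crossed.translate_of, ← map_sub]
    exact Crossed.norm_of_le _
  have hf := map_continuous f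
  have hsupp (s t : H) (hs : s ∈ K) (ht : t ∉ K * tsupport f) : f (s⁻¹ * t) = 0 :=
    image_eq_zero_of_notMem_tsupport fun h => ht ⟨s, hs, _, h, mul_inv_cancel_left s t⟩
  have hcont : ContinuousOn
      (fun s => ∫ t, ‖α.act s (f (s⁻¹ * t)) - α.act s₀ (f (s₀⁻¹ * t))‖ ∂μ) K := by
    refine continuousOn_integral_of_compact_support
      (hK.mul f.hasCompactSupport.isCompact) (Continuous.continuousOn ?_) fun s t hs ht => ?_
    · exact ((α.continuous_uncurry.comp (continuous_fst.prodMk (hf.comp (by fun_prop)))).sub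
        ((α.clm s₀).continuous.comp (hf.comp (by fun_prop)))).norm
    · simp only [hsupp s t hs ht, hsupp s₀ t (mem_of_mem_nhds hKs) ht, map_zero, sub_self,
        norm_zero]
  have hlim := (hcont.continuousAt hKs).tendsto
  simp only [sub_self, norm_zero, integral_zero] at hlim
  exact squeeze_zero (fun _ => norm_nonneg _) hle hlim

theorem Crossed.continuous_translate (x : Crossed p μ α) :
    Continuous fun s => (Crossed.translate p μ α s).1 x :=
  continuous_apply_of_denseRange Crossed.norm_translate_le Crossed.denseRange_of
    Crossed.continuous_translate_of x

end CrossedMultiplier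

section Unital

variable {H B : Type u} [TopologicalSpace H] [NormedRing B] [NormedAlgebra ℂ B]

/-- A scalar function of compact support as a function with values in a unital algebra. -/
def scalarCc (φ : C_c(H, ℝ)) : C_c(H, B) where
  toFun s := (φ s : ℂ) • (1 : B)
  continuous_toFun := by fun_prop
  hasCompactSupport' := φ.hasCompactSupport.comp_left (g := fun c : ℝ => (c : ℂ) • (1 : B))
    (by simp only [Complex.ofReal_zero, zero_smul])

theorem scalarCc_apply (φ : C_c(H, ℝ)) (s : H) :
    (scalarCc φ : C_c(H, B)) s = (φ s : ℂ) • (1 : B) := rfl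

variable [Group H] {p : ℝ≥0∞} [Fact (1 ≤ p)] {α : IsometricAction H B}

theorem NondegenerateRep.map_one {E : Type*} [NormedAddCommGroup E] [NormedSpace ℂ E]
    (π : NondegenerateRep B E) : π.hom 1 = 1 :=
  π.clm_ext fun d ξ => by
    rw [← mul_apply_eq_comp, ← map_mul, one_mul, one_apply_eq_self]

theorem CovRep.map_one (ρ : CovRep p α) : ρ.π 1 = 1 := ρ.toNondegenerateRep.map_one

variable [MeasurableSpace H] [BorelSpace H] {μ : Measure H} [IsFiniteMeasureOnCompacts μ]

theorem CovRep.integrated_scalarCc (ρ : CovRep p α) (φ : C_c(H, ℝ)) (ξ : ρ.E) :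
    ρ.integrated μ (scalarCc φ) ξ = ∫ s, φ s • ρ.v s ξ ∂μ := by
  refine integral_congr_ae (.of_forall fun s => ?_)
  change ρ.π ((φ s : ℂ) • 1) (ρ.v s ξ) = (φ s : ℂ) • ρ.v s ξ
  rw [map_smul, ρ.map_one, _root_.smul_apply, one_apply_eq_self]

variable [IsTopologicalGroup H] [CompleteSpace B]

theorem Crossed.leftMul_one [μ.IsMulLeftInvariant] : Crossed.leftMul p μ α (1 : B) = 1 :=
  Crossed.leftMultipliers_ext fun ρ x => by
    rw [ρ.integratedHom_leftMul, ρ.map_one, one_mul, Subalgebra.coe_one, one_apply_eq_self]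

variable [LocallyCompactSpace H] [μ.IsMulLeftInvariant]

/-- The action of a dynamical system on its crossed product by left multiplications and left
translations. -/
def Crossed.multiplierSystem (p : ℝ≥0∞) [Fact (1 ≤ p)] (μ : Measure H)
    [IsFiniteMeasureOnCompacts μ] [μ.IsMulLeftInvariant] (α : IsometricAction H B) :
    MultiplierSystem α (Crossed p μ α) where
  left := Crossed.leftMul p μ α
  left_one := Crossed.leftMul_one
  norm_left_le := Crossed.norm_leftMul_le
  shift := Crossed.translate p μ α
  norm_shift_le := Crossed.norm_translate_le
  continuous_shift := Crossed.continuous_translate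
  covariant := Crossed.translate_mul_leftMul

theorem Crossed.of_mul_eq_integral (f : C_c(H, B)) (x : Crossed p μ α) :
    Crossed.of p μ α f * x =
      ∫ s, (Crossed.leftMul p μ α (f s)).1 ((Crossed.translate p μ α s).1 x) ∂μ := by
  refine Crossed.ext_covRep fun ρ => ContinuousLinearMap.ext fun ξ => ?_
  have hcomm := ((contractiveClm (ρ.integratedHom μ) ρ.norm_integratedHom_le).flip
    ξ).integral_comp_comm ((Crossed.multiplierSystem p μ α).integrable_left_shift μ f x)
  refine Eq.trans ?_ hcomm
  rw [map_mul, ρ.integratedHom_of]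
  change ∫ s, ρ.π (f s) (ρ.v s (ρ.integratedHom μ x ξ)) ∂μ =
    ∫ s, ρ.integratedHom μ ((Crossed.leftMul p μ α (f s)).1 ((Crossed.translate p μ α s).1 x)) ξ ∂μ
  simp only [ρ.integratedHom_leftMul, ρ.integratedHom_translate, mul_apply_eq_comp]

theorem Crossed.of_scalarCc_mul (φ : C_c(H, ℝ)) (x : Crossed p μ α) :
    Crossed.of p μ α (scalarCc φ) * x = ∫ s, φ s • (Crossed.translate p μ α s).1 x ∂μ := by
  rw [Crossed.of_mul_eq_integral]
  refine integral_congr_ae (.of_forall fun s => ?_)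
  change (Crossed.leftMul p μ α ((φ s : ℂ) • 1)).1 _ = (φ s : ℂ) • (Crossed.translate p μ α s).1 x
  rw [map_smul, Crossed.leftMul_one, Subalgebra.coe_smul, Subalgebra.coe_one, _root_.smul_apply,
    one_apply_eq_self]

variable [μ.IsOpenPosMeasure]

theorem Crossed.hasContractiveLeftApproxUnit [NormOneClass B] (p : ℝ≥0∞) [Fact (1 ≤ p)]
    (α : IsometricAction H B) (μ : Measure H) [IsFiniteMeasureOnCompacts μ]
    [μ.IsMulLeftInvariant] [μ.IsOpenPosMeasure] :
    HasContractiveLeftApproxUnit (Crossed p μ α) := by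
  refine ⟨(bumpFilter μ).map fun φ => Crossed.of p μ α (scalarCc φ), inferInstance, ?_,
    fun x => Filter.tendsto_map'_iff.2 ?_⟩
  · rw [Filter.eventually_map]
    filter_upwards [eventually_bumpFilter_nonneg μ, eventually_bumpFilter_integral μ]
      with φ hφ0 hφ1
    calc ‖Crossed.of p μ α (scalarCc φ)‖ ≤ ∫ s, ‖(scalarCc φ : C_c(H, B)) s‖ ∂μ :=
          Crossed.norm_of_le _
      _ = ∫ s, φ s ∂μ := by
          simp only [scalarCc_apply, norm_smul, norm_one, mul_one, Complex.norm_real,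
            Real.norm_of_nonneg (hφ0 _)]
      _ ≤ 1 := hφ1.le
  · have hlim := tendsto_integral_bumpFilter μ (Crossed.continuous_translate (p := p) (α := α) x)
    rw [map_one, Subalgebra.coe_one, one_apply_eq_self] at hlim
    exact hlim.congr fun φ => (Crossed.of_scalarCc_mul φ x).symm

variable (μ) in
/-- The integrated form as a nondegenerate representation of the crossed product. -/
def CovRep.integratedRep (ρ : CovRep p α) : NondegenerateRep (Crossed p μ α) ρ.E where
  hom := ρ.integratedHom μ
  norm_hom_le := ρ.norm_integratedHom_le
  nondegenerate ξ := by
    have hlim := tendsto_integral_bumpFilter μ (ρ.continuous_v ξ)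
    rw [_root_.map_one, one_apply_eq_self] at hlim
    refine mem_closure_of_tendsto hlim (.of_forall fun φ => Submodule.subset_span ?_)
    exact ⟨Crossed.of p μ α (scalarCc φ), ξ, by rw [ρ.integratedHom_of, ρ.integrated_scalarCc]⟩

end Unital

/-! ### Density of functions of two variables -/

section Approximation

variable {K E : Type*} [TopologicalSpace K] [T2Space K] [LocallyCompactSpace K]
  [NormedAddCommGroup E] [NormedSpace ℝ E] {S : Set E}

theorem exists_norm_sub_sum_smul_le_indicator (hS : Dense S) (f : C_c(K, E)) {V : Set K}
    (hV : IsOpen V) (hfV : tsupport f ⊆ V) {ε : ℝ} (hε : 0 < ε) :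
    ∃ (t : Finset K) (φ : t → C_c(K, ℝ)) (x : t → E), (∀ i, x i ∈ S) ∧
      ∀ k, ‖f k - ∑ i, φ i k • x i‖ ≤ V.indicator (fun _ => ε) k := by
  choose x hxS hx using fun k => hS.exists_dist_lt (f k) hε
  let U (i : K) : Set K := V ∩ {k | dist (f k) (x i) < ε}
  have hU (i : K) : IsOpen (U i) :=
    hV.inter (isOpen_lt ((map_continuous f).dist continuous_const) continuous_const)
  have hf : IsCompact (tsupport f) := f.hasCompactSupport
  obtain ⟨t, ht⟩ := hf.elim_finite_subcover U hU fun k hk => Set.mem_iUnion.2 ⟨k, hfV hk, hx k⟩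
  obtain ⟨ψ, hψ, hψc⟩ := PartitionOfUnity.exists_isSubordinate_of_locallyFinite_t2space hf
    (fun i : t => U i) (fun i => hU i) (locallyFinite_of_finite _)
    (ht.trans_eq (Set.iUnion_subtype (· ∈ t) fun i => U i).symm)
  have hψ0 {i : t} {k : K} (hk : k ∉ U i) : ψ i k = 0 :=
    image_eq_zero_of_notMem_tsupport fun h => hk (hψ i h)
  refine ⟨t, fun i => ⟨ψ i, hψc i⟩, fun i => x i, fun i => hxS i, fun k => ?_⟩
  have hfψ : f k = ∑ i, ψ i k • f k := by
    rw [← Finset.sum_smul, ← finsum_eq_sum_of_fintype]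
    by_cases hk : k ∈ tsupport f
    · rw [ψ.sum_eq_one hk, one_smul]
    · rw [image_eq_zero_of_notMem_tsupport hk, smul_zero]
  have hle (i : t) : ‖ψ i k • (f k - x i)‖ ≤ ψ i k * V.indicator (fun _ => ε) k := by
    rw [norm_smul, Real.norm_of_nonneg (ψ.nonneg i k)]
    by_cases hk : k ∈ U i
    · rw [Set.indicator_of_mem hk.1, ← dist_eq_norm]
      exact mul_le_mul_of_nonneg_left hk.2.le (ψ.nonneg i k)
    · rw [hψ0 hk, zero_mul, zero_mul]
  calc ‖f k - ∑ i, ψ i k • x i‖ = ‖∑ i, ψ i k • (f k - x i)‖ := by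
        conv_lhs => rw [hfψ]
        simp only [smul_sub, Finset.sum_sub_distrib]
    _ ≤ ∑ i, ψ i k * V.indicator (fun _ => ε) k := norm_sum_le_of_le _ fun i _ => hle i
    _ ≤ V.indicator (fun _ => ε) k := by
        rw [← Finset.sum_mul, ← finsum_eq_sum_of_fintype]
        exact mul_le_of_le_one_left (Set.indicator_nonneg (fun _ _ => hε.le) k) (ψ.sum_le_one k)

theorem exists_integral_norm_sub_sum_smul_lt [MeasurableSpace K] [BorelSpace K] (ν : Measure K)
    [IsFiniteMeasureOnCompacts ν] (hS : Dense S) (f : C_c(K, E)) {ε : ℝ} (hε : 0 < ε) :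
    ∃ (t : Finset K) (φ : t → C_c(K, ℝ)) (x : t → E), (∀ i, x i ∈ S) ∧
      ∫ k, ‖f k - ∑ i, φ i k • x i‖ ∂ν < ε := by
  obtain ⟨Q, hQ, hfQ⟩ := exists_compact_superset f.hasCompactSupport.isCompact
  obtain ⟨δ, hδ, hδε⟩ := exists_pos_mul_lt hε (ν.real (interior Q))
  have hfin : ν (interior Q) ≠ ⊤ := ((measure_mono interior_subset).trans_lt hQ.measure_lt_top).ne
  obtain ⟨t, φ, x, hx, hle⟩ :=
    exists_norm_sub_sum_smul_le_indicator hS f isOpen_interior hfQ hδ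
  refine ⟨t, φ, x, hx, ?_⟩
  calc ∫ k, ‖f k - ∑ i, φ i k • x i‖ ∂ν ≤ ∫ k, (interior Q).indicator (fun _ => δ) k ∂ν :=
        integral_mono_of_nonneg (.of_forall fun k => norm_nonneg _)
          ((integrableOn_const hfin).integrable_indicator isOpen_interior.measurableSet)
          (.of_forall hle)
    _ = ν.real (interior Q) * δ := by
        rw [integral_indicator_const _ isOpen_interior.measurableSet, smul_eq_mul]
    _ < ε := hδε

end Approximation

section IteratedCrossedProduct

/-- The elementary tensor `(k, s) ↦ φ(k) g(s)`. -/
def tensorCc {K H B : Type u} [TopologicalSpace K] [T2Space K] [TopologicalSpace H] [R1Space H]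
    [NormedAddCommGroup B] [NormedSpace ℝ B] (φ : C_c(K, ℝ)) (g : C_c(H, B)) :
    C_c(K × H, B) where
  toFun q := φ q.1 • g q.2
  continuous_toFun := ((map_continuous φ).comp continuous_fst).smul
    ((map_continuous g).comp continuous_snd)
  hasCompactSupport' := HasCompactSupport.intro
    (φ.hasCompactSupport.isCompact.prod g.hasCompactSupport.isCompact) fun q hq => by
      by_cases h : q.1 ∈ tsupport φ
      · rw [image_eq_zero_of_notMem_tsupport (f := g) fun h' => hq ⟨h, h'⟩, smul_zero]
      · rw [image_eq_zero_of_notMem_tsupport h, zero_smul]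

variable {K H B : Type u} [Group K] [TopologicalSpace K] [IsTopologicalGroup K] [T2Space K]
  [Group H] [TopologicalSpace H] [IsTopologicalGroup H] [MeasurableSpace H] [BorelSpace H]
  [NonUnitalNormedRing B] [NormedSpace ℂ B] [IsScalarTower ℂ B B] [SMulCommClass ℂ B B]
  [CompleteSpace B] {p : ℝ≥0∞} [Fact (1 ≤ p)] {α : IsometricAction H B}
  {μ : Measure H} [IsFiniteMeasureOnCompacts μ] [μ.IsMulLeftInvariant]

theorem curryCc_sum_tensorCc {ι : Type*} [Fintype ι] (φ : ι → C_c(K, ℝ)) (g : ι → C_c(H, B))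
    (k : K) :
    curryCc p μ α (∑ i, tensorCc (φ i) (g i)) k = ∑ i, φ i k • Crossed.of p μ α (g i) := by
  have hslice : slice (∑ i, tensorCc (φ i) (g i)) k = ∑ i, (φ i k : ℂ) • g i := by
    ext s
    rw [slice_apply, CompactlySupportedContinuousMap.sum_apply,
      CompactlySupportedContinuousMap.sum_apply]
    rfl
  rw [curryCc_apply, hslice, map_sum]
  exact Finset.sum_congr rfl fun i _ => map_smul _ _ _

variable [LocallyCompactSpace K] [MeasurableSpace K] [BorelSpace K]

theorem Crossed.denseRange_of_curryCc (ν : Measure K) [IsFiniteMeasureOnCompacts ν]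
    (θ : IsometricAction K (Crossed p μ α)) :
    DenseRange fun F : C_c(K × H, B) => Crossed.of p ν θ (curryCc p μ α F) := by
  refine fun y => Crossed.induction_on (P := fun y => y ∈ closure _) y isClosed_closure
    fun f => Metric.mem_closure_iff.2 fun ε hε => ?_
  obtain ⟨t, φ, x, hx, hlt⟩ :=
    exists_integral_norm_sub_sum_smul_lt ν (Crossed.denseRange_of (p := p) (μ := μ) (α := α)) f hε
  choose g hg using hx
  refine ⟨_, ⟨∑ i, tensorCc (φ i) (g i), rfl⟩, ?_⟩
  rw [dist_eq_norm, ← map_sub]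
  refine (Crossed.norm_of_le _).trans_lt (lt_of_eq_of_lt ?_ hlt)
  refine integral_congr_ae (.of_forall fun k => congrArg norm ?_)
  rw [CompactlySupportedContinuousMap.sub_apply, curryCc_sum_tensorCc]
  simp only [hg]

end IteratedCrossedProduct

section ZeroAtInfty

variable {X E F : Type*} [TopologicalSpace X] [NormedAddCommGroup E]
  [NormedAddCommGroup F]

theorem norm_c0_apply_le (f : C₀(X, E)) (t : X) : ‖f t‖ ≤ ‖f‖ :=
  f.toBCF.norm_coe_le_norm t

theorem norm_c0_le {f : C₀(X, E)} {C : ℝ} (hC : 0 ≤ C) (h : ∀ t, ‖f t‖ ≤ C) : ‖f‖ ≤ C :=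
  (BoundedContinuousFunction.norm_le (f := f.toBCF) hC).2 h

theorem finite_le_norm_c0 [DiscreteTopology X] (f : C₀(X, E)) {ε : ℝ} (hε : 0 < ε) :
    {t | ε ≤ ‖f t‖}.Finite := by
  have hf := (zero_at_infty f).norm.eventually_lt_const (norm_zero.trans_lt hε)
  rw [Filter.cocompact_eq_cofinite, Filter.eventually_cofinite] at hf
  simpa only [not_lt] using hf

variable [NormedSpace ℂ E] [NormedSpace ℂ F]

/-- Evaluation at a point. -/
def c0Eval (t : X) : C₀(X, E) →L[ℂ] E :=
  LinearMap.mkContinuous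
    { toFun := fun f => f t
      map_add' := fun _ _ => rfl
      map_smul' := fun _ _ => rfl } 1 fun f => (norm_c0_apply_le f t).trans_eq (one_mul _).symm

variable [DiscreteTopology X]

/-- The operator from `C₀(X, E)` to `C₀(X, F)` acting on the fibres by a bounded family of
operators. -/
def c0Fiberwise (T : X → E →L[ℂ] F) {C : ℝ} (hC : 0 ≤ C) (hT : ∀ t, ‖T t‖ ≤ C) :
    C₀(X, E) →L[ℂ] C₀(X, F) :=
  LinearMap.mkContinuous
    { toFun := fun f =>
        { toFun := fun t => T t (f t)
          continuous_toFun := continuous_of_discreteTopology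
          zero_at_infty' := squeeze_zero_norm (fun t => (T t).le_of_opNorm_le (hT t) (f t)) (by
            simpa only [norm_zero, mul_zero] using (zero_at_infty f).norm.const_mul C) }
      map_add' := fun f g => by ext t; exact map_add (T t) _ _
      map_smul' := fun c f => by ext t; exact map_smul (T t) c _ } C fun f =>
    norm_c0_le (mul_nonneg hC (norm_nonneg f)) fun t =>
      ((T t).le_of_opNorm_le (hT t) (f t)).trans
        (mul_le_mul_of_nonneg_left (norm_c0_apply_le f t) hC)

theorem c0Fiberwise_apply (T : X → E →L[ℂ] F) {C : ℝ} (hC : 0 ≤ C) (hT : ∀ t, ‖T t‖ ≤ C)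
    (f : C₀(X, E)) (t : X) : c0Fiberwise T hC hT f t = T t (f t) := rfl

theorem norm_c0Fiberwise_le (T : X → E →L[ℂ] F) {C : ℝ} (hC : 0 ≤ C) (hT : ∀ t, ‖T t‖ ≤ C) :
    ‖c0Fiberwise T hC hT‖ ≤ C :=
  LinearMap.mkContinuous_norm_le _ hC _

theorem continuous_c0Fiberwise {Y : Type*} [TopologicalSpace Y] {T : Y → X → E →L[ℂ] F} {C : ℝ}
    (hC : 0 ≤ C) (hT : ∀ y t, ‖T y t‖ ≤ C) (f : C₀(X, E))
    (h : ∀ t, Continuous fun y => T y t (f t)) :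
    Continuous fun y => c0Fiberwise (T y) hC (hT y) f := by
  refine continuous_iff_continuousAt.2 fun y₀ => ?_
  rw [ContinuousAt, ZeroAtInftyContinuousMap.tendsto_iff_tendstoUniformly,
    Metric.tendstoUniformly_iff]
  intro ε hε
  obtain ⟨δ, hδ, hCδ⟩ := exists_pos_mul_lt hε (C + C)
  have hnear : ∀ᶠ y in 𝓝 y₀, ∀ t ∈ (finite_le_norm_c0 f hδ).toFinset,
      dist (T y₀ t (f t)) (T y t (f t)) < ε :=
    (Filter.eventually_all_finset _).2 fun t _ => by
      simpa only [dist_comm] using Metric.tendsto_nhds.1 ((h t).tendsto y₀) ε hε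
  filter_upwards [hnear] with y hy t
  simp only [c0Fiberwise_apply]
  by_cases ht : δ ≤ ‖f t‖
  · exact hy t ((Set.Finite.mem_toFinset _).2 ht)
  · have hle (z : Y) : ‖T z t (f t)‖ ≤ C * δ := ((T z t).le_of_opNorm_le (hT z t) _).trans
      (mul_le_mul_of_nonneg_left (not_le.1 ht).le hC)
    calc dist (T y₀ t (f t)) (T y t (f t)) ≤ ‖T y₀ t (f t)‖ + ‖T y t (f t)‖ :=
          dist_le_norm_add_norm _ _
      _ ≤ C * δ + C * δ := add_le_add (hle y₀) (hle y)
      _ < ε := by rwa [← add_mul]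

end ZeroAtInfty

section ApproxUnit

variable {X A : Type*} [TopologicalSpace X] [DiscreteTopology X] [NormedRing A]

/-- The indicator function of a finite set, as a function vanishing at infinity. -/
def c0Indicator (s : Finset X) : C₀(X, A) where
  toFun := (s : Set X).indicator 1
  continuous_toFun := continuous_of_discreteTopology
  zero_at_infty' := by
    rw [Filter.cocompact_eq_cofinite]
    refine tendsto_const_nhds.congr' (Filter.eventually_cofinite.2 ?_)
    exact s.finite_toSet.subset fun t ht => by_contra fun h => ht (Set.indicator_of_notMem h _).symm

theorem tendsto_c0Indicator_mul (f : C₀(X, A)) :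
    Filter.Tendsto (fun s : Finset X => c0Indicator s * f) Filter.atTop (𝓝 f) := by
  rw [ZeroAtInftyContinuousMap.tendsto_iff_tendstoUniformly, Metric.tendstoUniformly_iff]
  intro ε hε
  filter_upwards [Filter.eventually_ge_atTop (finite_le_norm_c0 f hε).toFinset] with s hs t
  change dist (f t) ((s : Set X).indicator 1 t * f t) < ε
  by_cases ht : t ∈ (s : Set X)
  · rwa [Set.indicator_of_mem ht, Pi.one_apply, one_mul, dist_self]
  · rw [Set.indicator_of_notMem ht, zero_mul, dist_zero_right, ← not_le]
    exact fun hle => ht (hs ((Set.Finite.mem_toFinset _).2 hle))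

variable (X A) in
theorem c0_hasContractiveLeftApproxUnit [NormOneClass A] :
    HasContractiveLeftApproxUnit C₀(X, A) := by
  refine ⟨Filter.atTop.map c0Indicator, inferInstance, Filter.eventually_map.2 <| .of_forall
    fun s => norm_c0_le zero_le_one fun t => ?_, fun f => Filter.tendsto_map'_iff.2 <|
      tendsto_c0Indicator_mul f⟩
  exact (norm_indicator_le_norm_self _ _).trans_eq norm_one

end ApproxUnit

/-! ### The Fourier transform into `C₀(G, A)` -/

section Fourier

variable {G A : Type u} [TopologicalSpace G] [NormedRing A] [NormedAlgebra ℂ A]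

variable (G) in
/-- Left multiplication by constants, as left multipliers of `C₀(G, A)`. -/
def c0LeftMul [DiscreteTopology G] : A →ₙₐ[ℂ] leftMultipliers C₀(G, A) where
  toFun a := ⟨c0Fiberwise (fun _ => ContinuousLinearMap.mul ℂ A a) (norm_nonneg a)
    fun _ => ContinuousLinearMap.opNorm_mul_apply_le ℂ A a,
    fun f g => by ext t; exact (mul_assoc a (f t) (g t)).symm⟩
  map_zero' := by ext f t; exact zero_mul _
  map_add' a b := by ext f t; exact add_mul a b _
  map_smul' c a := by ext f t; exact smul_mul_assoc c a _
  map_mul' a b := by ext f t; exact mul_assoc a b _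

theorem norm_c0LeftMul_le [DiscreteTopology G] (a : A) : ‖c0LeftMul G a‖ ≤ ‖a‖ :=
  norm_c0Fiberwise_le _ (norm_nonneg a) fun _ => ContinuousLinearMap.opNorm_mul_apply_le ℂ A a

variable [CommGroup G]

theorem norm_conj_dual_smul_id_le (γ : PontryaginDual G) (t : G) :
    ‖starRingEnd ℂ (γ t : ℂ) • ContinuousLinearMap.id ℂ A‖ ≤ 1 := by
  rw [norm_smul, RCLike.norm_conj, Circle.norm_coe, one_mul]
  exact ContinuousLinearMap.norm_id_le

theorem conj_dual_mul_apply (γ δ : PontryaginDual G) (t : G) :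
    starRingEnd ℂ ((γ * δ) t : ℂ) = starRingEnd ℂ (γ t : ℂ) * starRingEnd ℂ (δ t : ℂ) :=
  (congr_arg _ (Circle.coe_mul _ _)).trans (map_mul _ _ _)

theorem continuous_dual_apply [LocallyCompactSpace G] (t : G) :
    Continuous fun γ : PontryaginDual G => (γ t : ℂ) :=
  have hcoe : Continuous ((↑) : Circle → ℂ) := by fun_prop
  hcoe.comp (continuous_dual_eval.comp (continuous_id.prodMk continuous_const))

variable [DiscreteTopology G]

/-- Multiplication by the conjugate of a character on `C₀(G, A)`. -/
def c0CharClm (γ : PontryaginDual G) : C₀(G, A) →L[ℂ] C₀(G, A) :=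
  c0Fiberwise (fun t : G => starRingEnd ℂ (γ t : ℂ) • ContinuousLinearMap.id ℂ A) zero_le_one
    (norm_conj_dual_smul_id_le γ)

theorem c0CharClm_apply (γ : PontryaginDual G) (f : C₀(G, A)) (t : G) :
    c0CharClm γ f t = starRingEnd ℂ (γ t : ℂ) • f t := rfl

theorem c0CharClm_one : c0CharClm (1 : PontryaginDual G) = (1 : C₀(G, A) →L[ℂ] C₀(G, A)) := by
  ext f t
  rw [c0CharClm_apply]
  change starRingEnd ℂ ((1 : Circle) : ℂ) • f t = f t
  rw [Circle.coe_one, map_one, one_smul]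

theorem c0CharClm_mul (γ δ : PontryaginDual G) :
    c0CharClm (γ * δ) = (c0CharClm γ * c0CharClm δ : C₀(G, A) →L[ℂ] C₀(G, A)) := by
  ext f t
  rw [mul_apply_eq_comp, c0CharClm_apply, c0CharClm_apply, c0CharClm_apply,
    conj_dual_mul_apply, mul_smul]

theorem norm_c0CharClm_le (γ : PontryaginDual G) :
    ‖(c0CharClm γ : C₀(G, A) →L[ℂ] C₀(G, A))‖ ≤ 1 :=
  norm_c0Fiberwise_le (fun t : G => starRingEnd ℂ (γ t : ℂ) • ContinuousLinearMap.id ℂ A)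
    zero_le_one (norm_conj_dual_smul_id_le γ)

theorem continuous_c0CharClm [IsTopologicalGroup G] (f : C₀(G, A)) :
    Continuous fun γ : PontryaginDual G => c0CharClm γ f :=
  continuous_c0Fiberwise
    (T := fun (γ : PontryaginDual G) (t : G) =>
      starRingEnd ℂ (γ t : ℂ) • ContinuousLinearMap.id ℂ A)
    zero_le_one norm_conj_dual_smul_id_le f fun t =>
      (Complex.continuous_conj.comp (continuous_dual_apply t)).smul continuous_const

variable (G A) in
/-- Multiplication by conjugates of characters, as left multipliers of `C₀(G, A)`. -/
def c0Char : PontryaginDual G →* leftMultipliers C₀(G, A) where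
  toFun γ := ⟨c0CharClm γ, fun f g => by
    ext t
    exact (smul_mul_assoc (starRingEnd ℂ (γ t : ℂ)) (f t) (g t)).symm⟩
  map_one' := Subtype.ext c0CharClm_one
  map_mul' γ δ := Subtype.ext (c0CharClm_mul γ δ)

variable [IsTopologicalGroup G]

variable (G A) in
/-- The multipliers of `C₀(G, A)` given by constants and characters. -/
def c0MultiplierSystem : MultiplierSystem (trivialAction (PontryaginDual G) A) C₀(G, A) where
  left := c0LeftMul G
  left_one := by ext f t; exact one_mul (f t)
  norm_left_le := norm_c0LeftMul_le
  shift := c0Char G A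
  norm_shift_le := norm_c0CharClm_le
  continuous_shift := continuous_c0CharClm
  covariant γ a := by
    ext f t
    exact (mul_smul_comm (starRingEnd ℂ (γ t : ℂ)) a (f t)).symm

end Fourier

section Orthogonality

/-- The inclusion of `ℚ / ℤ` into `ℝ / ℤ`. -/
def addCircleRatToReal : AddCircle (1 : ℚ) →+ AddCircle (1 : ℝ) :=
  QuotientAddGroup.map _ _ (Rat.castHom ℝ).toAddMonoidHom <|
    AddSubgroup.zmultiples_le.2 ⟨1, by simp⟩

theorem injective_addCircleRatToReal : Function.Injective addCircleRatToReal := by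
  refine (injective_iff_map_eq_zero _).2 fun x => QuotientAddGroup.induction_on x fun q hq => ?_
  have hq' : ((q : ℝ) : AddCircle (1 : ℝ)) = 0 := hq
  obtain ⟨n, hn⟩ := (AddCircle.coe_eq_zero_iff (1 : ℝ)).1 hq'
  refine (AddCircle.coe_eq_zero_iff (1 : ℚ)).2 ⟨n, ?_⟩
  simp only [zsmul_eq_mul, mul_one] at hn ⊢
  exact_mod_cast hn

variable {G : Type u} [CommGroup G] [TopologicalSpace G] [DiscreteTopology G]

theorem exists_dual_apply_ne_one {t : G} (ht : t ≠ 1) : ∃ γ : PontryaginDual G, γ t ≠ 1 := by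
  obtain ⟨χ, hχ⟩ := CharacterModule.exists_character_apply_ne_zero_of_ne_zero
    (A := Additive G) (a := Additive.ofMul t) ht
  let γ : G →ₜ* Circle :=
    { toFun := fun g => AddCircle.toCircle (addCircleRatToReal (χ (Additive.ofMul g)))
      map_one' := by rw [ofMul_one, map_zero, map_zero, AddCircle.toCircle_zero]
      map_mul' := fun g h => by rw [ofMul_mul, map_add, map_add, AddCircle.toCircle_add]
      continuous_toFun := continuous_of_discreteTopology }
  refine ⟨γ, fun h => hχ (injective_addCircleRatToReal ?_)⟩
  rw [map_zero]
  exact AddCircle.injective_toCircle one_ne_zero (h.trans AddCircle.toCircle_zero.symm)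

variable [MeasurableSpace (PontryaginDual G)] [BorelSpace (PontryaginDual G)]
  (μ : Measure (PontryaginDual G)) [μ.IsMulLeftInvariant]

theorem integral_dual_apply_eq_zero {t : G} (ht : t ≠ 1) :
    ∫ γ : PontryaginDual G, (γ t : ℂ) ∂μ = 0 := by
  obtain ⟨γ₀, hγ₀⟩ := exists_dual_apply_ne_one ht
  have hinv : (γ₀ t : ℂ) * ∫ γ : PontryaginDual G, (γ t : ℂ) ∂μ =
      ∫ γ : PontryaginDual G, (γ t : ℂ) ∂μ := by
    rw [← integral_const_mul]
    exact integral_mul_left_eq_self (fun γ : PontryaginDual G => (γ t : ℂ)) γ₀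
  by_contra h
  exact hγ₀ (Circle.ext ((mul_eq_right₀ h).1 hinv))

/-- The character of `Ĝ` defined by an element of `G`, as a continuous function. -/
def dualEvalMap [IsTopologicalGroup G] (t : G) : C(PontryaginDual G, ℂ) :=
  ⟨fun γ => γ t, continuous_dual_apply t⟩

variable [IsTopologicalGroup G] [IsProbabilityMeasure μ]

theorem orthonormal_dualEvalMap :
    Orthonormal ℂ fun t : G => ContinuousMap.toLp 2 μ ℂ (dualEvalMap t) := by
  classical
  rw [orthonormal_iff_ite]
  intro s t
  have h (γ : PontryaginDual G) : dualEvalMap t γ * starRingEnd ℂ (dualEvalMap s γ) =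
      (γ (s⁻¹ * t) : ℂ) := by
    change (γ t : ℂ) * starRingEnd ℂ (γ s : ℂ) = _
    rw [map_mul, map_inv, Circle.coe_mul, Circle.coe_inv_eq_conj, mul_comm]
  simp only [ContinuousMap.inner_toLp, h]
  split_ifs with hst
  · simp [hst]
  · exact integral_dual_apply_eq_zero μ fun h => hst (inv_mul_eq_one.1 h)

theorem tendsto_coeff_scalar (φ : C(PontryaginDual G, ℂ)) :
    Filter.Tendsto (fun t : G => ∫ γ : PontryaginDual G, starRingEnd ℂ (γ t : ℂ) * φ γ ∂μ)
      Filter.cofinite (𝓝 0) := by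
  have hbessel := ((orthonormal_dualEvalMap (G := G) μ).inner_products_summable
    (ContinuousMap.toLp 2 μ ℂ φ)).tendsto_cofinite_zero.sqrt
  rw [Real.sqrt_zero] at hbessel
  refine tendsto_zero_iff_norm_tendsto_zero.2 (hbessel.congr fun t => ?_)
  rw [Real.sqrt_sq (norm_nonneg _), ContinuousMap.inner_toLp]
  simp only [mul_comm, dualEvalMap, ContinuousMap.coe_mk]

end Orthogonality

section RiemannLebesgue

variable {G : Type u} [CommGroup G] [TopologicalSpace G] [DiscreteTopology G]
  [MeasurableSpace (PontryaginDual G)] [BorelSpace (PontryaginDual G)]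
  (μ : Measure (PontryaginDual G)) {E : Type*} [NormedAddCommGroup E] [NormedSpace ℂ E]

theorem integrable_coeff [IsFiniteMeasure μ] {f : PontryaginDual G → E} (hf : Continuous f)
    (t : G) : Integrable (fun γ : PontryaginDual G => starRingEnd ℂ (γ t : ℂ) • f γ) μ :=
  ((Complex.continuous_conj.comp
    (continuous_dual_apply t)).smul hf).integrable_of_hasCompactSupport (.of_compactSpace _)

variable [IsTopologicalGroup G] [IsProbabilityMeasure μ] [μ.IsMulLeftInvariant] [CompleteSpace E]

theorem tendsto_coeff_smul (φ : C_c(PontryaginDual G, ℝ)) (x : E) :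
    Filter.Tendsto (fun t : G => ∫ γ : PontryaginDual G, starRingEnd ℂ (γ t : ℂ) • φ γ • x ∂μ)
      Filter.cofinite (𝓝 0) := by
  let ψ : C(PontryaginDual G, ℂ) :=
    ⟨fun γ => (φ γ : ℂ), Complex.continuous_ofReal.comp (map_continuous φ)⟩
  have h := (tendsto_coeff_scalar μ ψ).smul_const x
  rw [zero_smul] at h
  refine h.congr fun t => ?_
  rw [← integral_smul_const]
  exact integral_congr_ae (.of_forall fun γ => mul_smul _ (φ γ : ℂ) x)

theorem tendsto_coeff (f : C_c(PontryaginDual G, E)) :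
    Filter.Tendsto (fun t : G => ∫ γ : PontryaginDual G, starRingEnd ℂ (γ t : ℂ) • f γ ∂μ)
      Filter.cofinite (𝓝 0) := by
  refine Metric.tendsto_nhds.2 fun ε hε => ?_
  obtain ⟨s, φ, x, -, hφ⟩ := exists_integral_norm_sub_sum_smul_lt μ dense_univ f (half_pos hε)
  have hlim := tendsto_finsetSum Finset.univ fun i _ => tendsto_coeff_smul μ (φ i) (x i)
  rw [Finset.sum_const_zero] at hlim
  filter_upwards [Metric.tendsto_nhds.1 hlim (ε / 2) (half_pos hε)] with t ht
  have hint (i : s) := integrable_coeff (f := fun γ => φ i γ • x i) μ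
    ((map_continuous (φ i)).smul continuous_const) t
  rw [dist_zero_right] at ht ⊢
  calc ‖∫ γ : PontryaginDual G, starRingEnd ℂ (γ t : ℂ) • f γ ∂μ‖
      = ‖∫ γ : PontryaginDual G, starRingEnd ℂ (γ t : ℂ) • (f γ - ∑ i, φ i γ • x i) ∂μ +
          ∑ i, ∫ γ : PontryaginDual G, starRingEnd ℂ (γ t : ℂ) • φ i γ • x i ∂μ‖ := by
        rw [← integral_finsetSum _ fun i _ => hint i, ← integral_add]
        · simp only [smul_sub, Finset.smul_sum, sub_add_cancel]
        · exact integrable_coeff μ ((map_continuous f).sub <| continuous_finsetSum _ fun i _ =>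
            (map_continuous (φ i)).smul continuous_const) t
        · exact integrable_finsetSum _ fun i _ => hint i
    _ ≤ ∫ γ : PontryaginDual G, ‖f γ - ∑ i, φ i γ • x i‖ ∂μ + ε / 2 := by
        refine (norm_add_le _ _).trans (add_le_add ?_ ht.le)
        refine (norm_integral_le_integral_norm _).trans_eq ?_
        simp only [norm_smul, RCLike.norm_conj, Circle.norm_coe, one_mul]
    _ < ε := by linarith

/-- The Fourier transform of a continuous function on `Ĝ`. -/
def fourierC0 : C_c(PontryaginDual G, E) →ₗ[ℂ] C₀(G, E) where
  toFun f :=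
    { toFun := fun t => ∫ γ : PontryaginDual G, starRingEnd ℂ (γ t : ℂ) • f γ ∂μ
      continuous_toFun := continuous_of_discreteTopology
      zero_at_infty' := by
        rw [Filter.cocompact_eq_cofinite]
        exact tendsto_coeff μ f }
  map_add' f g := by
    ext t
    refine Eq.trans ?_ (integral_add (integrable_coeff μ (map_continuous f) t)
      (integrable_coeff μ (map_continuous g) t))
    exact integral_congr_ae (.of_forall fun γ => smul_add _ (f γ) (g γ))
  map_smul' c f := by
    ext t
    refine Eq.trans ?_ (integral_smul c _)
    exact integral_congr_ae (.of_forall fun γ => smul_comm _ c (f γ))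

theorem fourierC0_apply (f : C_c(PontryaginDual G, E)) (t : G) :
    fourierC0 μ f t = ∫ γ : PontryaginDual G, starRingEnd ℂ (γ t : ℂ) • f γ ∂μ := rfl

theorem integral_c0MultiplierSystem {A : Type u} [NormedRing A] [NormedAlgebra ℂ A]
    [CompleteSpace A] (f : C_c(PontryaginDual G, A)) (g : C₀(G, A)) :
    ∫ γ, ((c0MultiplierSystem G A).left (f γ)).1 (((c0MultiplierSystem G A).shift γ).1 g) ∂μ =
      fourierC0 μ f * g := by
  ext t
  change c0Eval t _ = fourierC0 μ f t * g t
  rw [← ContinuousLinearMap.integral_comp_comm _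
    ((c0MultiplierSystem G A).integrable_left_shift μ f g), fourierC0_apply,
    ← integral_mul_const_of_integrable (integrable_coeff μ (map_continuous f) t)]
  refine integral_congr_ae (.of_forall fun γ => ?_)
  exact (mul_smul_comm _ (f γ) (g t)).trans (smul_mul_assoc _ (f γ) (g t)).symm

end RiemannLebesgue

instance isOpenPosMeasure_count {G : Type*} [TopologicalSpace G] [MeasurableSpace G] :
    (Measure.count : Measure G).IsOpenPosMeasure where
  open_pos U _ hne := by
    rw [Measure.count_ne_zero_iff]
    exact hne

section Intertwining

variable {H B : Type u} [Group H] [TopologicalSpace H] [NonUnitalNormedRing B] [NormedSpace ℂ B]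
  {p : ℝ≥0∞} [Fact (1 ≤ p)] {α : IsometricAction H B} (ρ : CovRep p α)

theorem CovRep.v_mul_π (t : H) (b : B) : ρ.v t * ρ.π b = ρ.π (α.act t b) * ρ.v t :=
  ContinuousLinearMap.ext fun ξ => ρ.v_π t b ξ

variable [IsTopologicalGroup H] [MeasurableSpace H] [BorelSpace H] [IsScalarTower ℂ B B]
  [SMulCommClass ℂ B B] [CompleteSpace B]
  {μ : Measure H} [IsFiniteMeasureOnCompacts μ] [μ.IsMulLeftInvariant]

theorem CovRep.mul_integratedHom {W : ρ.E →L[ℂ] ρ.E} {θ : Crossed p μ α → Crossed p μ α}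
    (hθ : Continuous θ)
    (h : ∀ f, W * ρ.integrated μ f = ρ.integratedHom μ (θ (Crossed.of p μ α f)) * W)
    (x : Crossed p μ α) : W * ρ.integratedHom μ x = ρ.integratedHom μ (θ x) * W := by
  induction x using Crossed.induction_on with
  | hc =>
    exact isClosed_eq (continuous_const.mul ρ.continuous_integratedHom)
      ((ρ.continuous_integratedHom.comp hθ).mul continuous_const)
  | h f => rw [ρ.integratedHom_of, h]

theorem CovRep.mul_integratedHom_twist {χ : PontryaginDual H} {W : ρ.E →L[ℂ] ρ.E}
    (hπ : ∀ b, W * ρ.π b = ρ.π b * W)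
    (hv : ∀ s, W * ρ.v s = starRingEnd ℂ (χ s : ℂ) • (ρ.v s * W)) (x : Crossed p μ α) :
    W * ρ.integratedHom μ x = ρ.integratedHom μ (Crossed.twist p μ α χ x) * W := by
  refine ρ.mul_integratedHom (Crossed.continuous_twist χ) (fun f => ?_) x
  rw [Crossed.twist_of, ρ.integratedHom_of]
  ext1 ξ
  rw [mul_apply_eq_comp, mul_apply_eq_comp, ρ.integrated_apply, ρ.integrated_apply,
    ← W.integral_comp_comm (ρ.integrable_integrand μ f ξ)]
  refine integral_congr_ae (.of_forall fun s => ?_)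
  calc W (ρ.π (f s) (ρ.v s ξ)) = ρ.π (f s) ((W * ρ.v s) ξ) := DFunLike.congr_fun (hπ (f s)) _
    _ = starRingEnd ℂ (χ s : ℂ) • ρ.π (f s) (ρ.v s (W ξ)) := by
      rw [hv]
      exact map_smul (ρ.π (f s)) _ _
    _ = ρ.π (twistCc χ f s) (ρ.v s (W ξ)) := by
      rw [twistCc_apply, map_smul]
      rfl

end Intertwining

section Currying

variable {K H B : Type u} [TopologicalSpace K] [R1Space K] [Group H] [TopologicalSpace H]
  [IsTopologicalGroup H] [MeasurableSpace H] [BorelSpace H]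
  [NonUnitalNormedRing B] [NormedSpace ℂ B] [IsScalarTower ℂ B B] [SMulCommClass ℂ B B]
  [CompleteSpace B]

/-- `curryCc` as a linear map. -/
def curryCcLinear (p : ℝ≥0∞) [Fact (1 ≤ p)] (μ : Measure H) [IsFiniteMeasureOnCompacts μ]
    [μ.IsMulLeftInvariant] (α : IsometricAction H B) :
    C_c(K × H, B) →ₗ[ℂ] C_c(K, Crossed p μ α) where
  toFun := curryCc p μ α
  map_add' F F' := by
    ext k
    exact map_add (Crossed.of p μ α) (slice F k) (slice F' k)
  map_smul' c F := by
    ext k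
    exact map_smul (Crossed.of p μ α) c (slice F k)

end Currying

/-! ### The homomorphism `Φ₁` -/

section Swap

variable {G A : Type u} [CommGroup G] [TopologicalSpace G] [IsTopologicalGroup G]
  [DiscreteTopology G] [NormedRing A] [NormedAlgebra ℂ A]

/-- The map `F ↦ ((s, γ) ↦ γ(s) F(γ, s))` implementing `Φ₁` on functions. -/
def swapTwistCc : C_c(PontryaginDual G × G, A) →ₗ[ℂ] C_c(G × PontryaginDual G, A) where
  toFun F :=
    { toFun := fun q => (q.2 q.1 : ℂ) • F (q.2, q.1)
      continuous_toFun :=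
        (continuous_subtype_val.comp (continuous_dual_eval.comp continuous_swap)).smul
          ((map_continuous F).comp continuous_swap)
      hasCompactSupport' := by
        refine (F.hasCompactSupport.comp_homeomorph
          (Homeomorph.prodComm G (PontryaginDual G))).mono fun q hq h0 => hq ?_
        exact (congrArg ((q.2 q.1 : ℂ) • ·) h0).trans (smul_zero _) }
  map_add' F F' := by
    ext q
    exact smul_add _ _ _
  map_smul' c F := by
    ext q
    exact smul_comm _ _ _

variable [CompleteSpace A] [MeasurableSpace G] [BorelSpace G]
  [MeasurableSpace (PontryaginDual G)] [BorelSpace (PontryaginDual G)]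
  {p : ℝ≥0∞} [Fact (1 ≤ p)] {μ : Measure (PontryaginDual G)} [IsProbabilityMeasure μ]
  [μ.IsMulLeftInvariant] {α : IsometricAction G A}

theorem dualTensorMap_leftMul (s : G) (a : A)
    (x : Crossed p μ (trivialAction (PontryaginDual G) A)) :
    dualTensorMap μ α p s ((Crossed.leftMul p μ _ a).1 x) =
      (Crossed.leftMul p μ _ (α.act s a)).1 (dualTensorMap μ α p s x) := by
  induction x using Crossed.induction_on with
  | hc =>
    exact isClosed_eq ((continuous_dualTensorMap μ α s).comp (ContinuousLinearMap.continuous _))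
      ((ContinuousLinearMap.continuous _).comp (continuous_dualTensorMap μ α s))
  | h f =>
    rw [Crossed.leftMul_of, dualTensorMap_of, dualTensorMap_of, Crossed.leftMul_of]
    refine congrArg (Crossed.of p μ _) (CompactlySupportedContinuousMap.ext fun γ => ?_)
    rw [dualTensor_formula]
    change (γ s : ℂ) • α.act s (a * f γ) = α.act s a * (actEquivariant α s).compCc _ γ
    rw [dualTensor_formula, map_mul, mul_smul_comm]

theorem dualTensorMap_translate (s : G) (γ : PontryaginDual G)
    (x : Crossed p μ (trivialAction (PontryaginDual G) A)) :
    dualTensorMap μ α p s ((Crossed.translate p μ _ γ).1 x) =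
      (γ s : ℂ) • (Crossed.translate p μ _ γ).1 (dualTensorMap μ α p s x) := by
  induction x using Crossed.induction_on with
  | hc =>
    exact isClosed_eq ((continuous_dualTensorMap μ α s).comp (ContinuousLinearMap.continuous _))
      (((ContinuousLinearMap.continuous _).comp (continuous_dualTensorMap μ α s)).const_smul
        (γ s : ℂ))
  | h f =>
    rw [Crossed.translate_of, dualTensorMap_of, dualTensorMap_of, Crossed.translate_of,
      ← map_smul]
    refine congrArg (Crossed.of p μ _) (CompactlySupportedContinuousMap.ext fun χ => ?_)
    rw [dualTensor_formula]
    change (χ s : ℂ) • α.act s (f (γ⁻¹ * χ)) =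
      (γ s : ℂ) • (actEquivariant α s).compCc (twistCc (evalChar s⁻¹) f) (γ⁻¹ * χ)
    have hχ : γ s * (γ⁻¹ * χ) s = χ s := mul_inv_cancel_left (γ s) (χ s)
    rw [dualTensor_formula, smul_smul, ← Circle.coe_mul, hχ]

variable [NormOneClass A] [μ.IsOpenPosMeasure] (ρ : CovRep p (dualTensor μ α p))

/-- The representation of `A` obtained by disintegrating a representation of `F^p(Ĝ, A, β)`. -/
def CovRep.dualAlg : A →ₙₐ[ℂ] (ρ.E →L[ℂ] ρ.E) :=
  (Crossed.multiplierSystem p μ (trivialAction (PontryaginDual G) A)).algRep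
    (Crossed.hasContractiveLeftApproxUnit p _ μ) ρ.toNondegenerateRep

/-- The representation of `Ĝ` obtained by disintegrating a representation of `F^p(Ĝ, A, β)`. -/
def CovRep.dualGroup : PontryaginDual G →* (ρ.E →L[ℂ] ρ.E) :=
  (Crossed.multiplierSystem p μ (trivialAction (PontryaginDual G) A)).groupRep
    (Crossed.hasContractiveLeftApproxUnit p _ μ) ρ.toNondegenerateRep

/-- The covariant representation of `(Ĝ, A, β)` formed by `dualAlg` and `dualGroup`. -/
def CovRep.dualRep : CovRep p (trivialAction (PontryaginDual G) A) :=
  (Crossed.multiplierSystem p μ (trivialAction (PontryaginDual G) A)).covRep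
    (Crossed.hasContractiveLeftApproxUnit p _ μ) ρ.toNondegenerateRep

theorem CovRep.integrated_dualRep (f : C_c(PontryaginDual G, A)) :
    ρ.dualRep.integrated μ f = ρ.π (Crossed.of p μ _ f) :=
  MultiplierSystem.integrated_covRep _ _ _ fun x => (Crossed.of_mul_eq_integral f x).symm

theorem CovRep.dualGroup_mul_dualAlg (γ : PontryaginDual G) (a : A) :
    ρ.dualGroup γ * ρ.dualAlg a = ρ.dualAlg a * ρ.dualGroup γ :=
  ρ.dualRep.v_mul_π γ a

theorem CovRep.v_mul_dualAlg (s : G) (a : A) :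
    ρ.v s * ρ.dualAlg a = ρ.dualAlg (α.act s a) * ρ.v s :=
  ρ.toNondegenerateRep.mul_extend (Crossed.hasContractiveLeftApproxUnit p _ μ) (ρ.v_mul_π s)
    (dualTensorMap_leftMul s a)

theorem CovRep.v_mul_dualGroup (s : G) (γ : PontryaginDual G) :
    ρ.v s * ρ.dualGroup γ = (γ s : ℂ) • (ρ.dualGroup γ * ρ.v s) := by
  refine (ρ.toNondegenerateRep.mul_extend
    (Crossed.hasContractiveLeftApproxUnit p _ μ) (ρ.v_mul_π s)
    (M := (γ s : ℂ) • Crossed.translate p μ _ γ) (dualTensorMap_translate s γ)).trans ?_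
  rw [map_smul, smul_mul_assoc]
  rfl

/-- The covariant representation of `(G, A, α)` contained in one of
`(G, F^p(Ĝ, A, β), β̂ ⊗ α)`. -/
def CovRep.innerRep : CovRep p α where
  X := ρ.X
  ν := ρ.ν
  π := ρ.dualAlg
  v := ρ.v
  norm_π_le := ρ.dualRep.norm_π_le
  nondegenerate := ρ.dualRep.nondegenerate
  norm_v := ρ.norm_v
  continuous_v := ρ.continuous_v
  covariant t a := conj_eq_of_mul_eq_mul ρ.v (ρ.v_mul_dualAlg t a)

theorem CovRep.dualGroup_mul_v (γ : PontryaginDual G) (s : G) :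
    ρ.dualGroup γ * ρ.v s = starRingEnd ℂ (γ s : ℂ) • (ρ.v s * ρ.dualGroup γ) := by
  have hγ : starRingEnd ℂ (γ s : ℂ) * (γ s : ℂ) = 1 := by
    rw [← Circle.coe_inv_eq_conj, ← Circle.coe_mul, inv_mul_cancel, Circle.coe_one]
  rw [ρ.v_mul_dualGroup, smul_smul, hγ, one_smul]

/-- The covariant representation of `(Ĝ, F^p(G, A, α), α̂)` obtained from one of
`(G, F^p(Ĝ, A, β), β̂ ⊗ α)` by exchanging the roles of `G` and `Ĝ`. -/
def CovRep.swapRep : CovRep p (dualAction p (Measure.count : Measure G) α) where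
  X := ρ.X
  ν := ρ.ν
  π := ρ.innerRep.integratedHom Measure.count
  v := ρ.dualGroup
  norm_π_le := ρ.innerRep.norm_integratedHom_le
  nondegenerate := (ρ.innerRep.integratedRep Measure.count).nondegenerate
  norm_v := ρ.dualRep.norm_v
  continuous_v := ρ.dualRep.continuous_v
  covariant γ x := conj_eq_of_mul_eq_mul ρ.dualGroup
    (ρ.innerRep.mul_integratedHom_twist (ρ.dualGroup_mul_dualAlg γ) (ρ.dualGroup_mul_v γ) x)

theorem CovRep.swapRep_integrated_eq (F : C_c(PontryaginDual G × G, A)) (ξ : ρ.E) :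
    ρ.swapRep.integrated μ (curryCc p Measure.count α F) ξ =
      ∫ γ, ∫ s, ρ.dualAlg (F (γ, s)) (ρ.v s (ρ.dualGroup γ ξ))
        ∂(Measure.count : Measure G) ∂μ :=
  integral_congr_ae (.of_forall fun γ =>
    DFunLike.congr_fun (ρ.innerRep.integratedHom_of (μ := Measure.count) (slice F γ))
      (ρ.dualGroup γ ξ))

theorem CovRep.integrated_swapTwistCc (F : C_c(PontryaginDual G × G, A)) (ξ : ρ.E) :
    ρ.integrated Measure.count
        (curryCc p μ (trivialAction (PontryaginDual G) A) (swapTwistCc F)) ξ =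
      ∫ s, ∫ γ, ρ.dualAlg (F (γ, s)) (ρ.v s (ρ.dualGroup γ ξ))
        ∂μ ∂(Measure.count : Measure G) := by
  refine integral_congr_ae (.of_forall fun s => ?_)
  refine (DFunLike.congr_fun (ρ.integrated_dualRep _) (ρ.v s ξ)).symm.trans ?_
  refine integral_congr_ae (.of_forall fun γ => ?_)
  have hv : ρ.v s (ρ.dualGroup γ ξ) = (γ s : ℂ) • ρ.dualGroup γ (ρ.v s ξ) :=
    DFunLike.congr_fun (ρ.v_mul_dualGroup s γ) ξ
  change ρ.dualAlg ((γ s : ℂ) • F (γ, s)) (ρ.dualGroup γ (ρ.v s ξ)) =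
    ρ.dualAlg (F (γ, s)) (ρ.v s (ρ.dualGroup γ ξ))
  rw [hv, map_smul, map_smul]
  rfl

theorem CovRep.swapRep_integrated (F : C_c(PontryaginDual G × G, A)) :
    ρ.swapRep.integrated μ (curryCc p Measure.count α F) =
      ρ.integrated Measure.count
        (curryCc p μ (trivialAction (PontryaginDual G) A) (swapTwistCc F)) := by
  refine ContinuousLinearMap.ext fun ξ => (ρ.swapRep_integrated_eq F ξ).trans
    (Eq.trans ?_ (ρ.integrated_swapTwistCc F ξ).symm)
  have hw : Continuous fun q : PontryaginDual G × G => ρ.dualGroup q.1 ξ :=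
    (ρ.dualRep.continuous_v ξ).comp continuous_fst
  refine integral_integral_swap_of_hasCompactSupport
    (f := fun γ s => ρ.dualAlg (F (γ, s)) (ρ.v s (ρ.dualGroup γ ξ)))
    ((ρ.dualRep.continuous_π.comp (map_continuous F)).clm_apply
      (ρ.continuous_v_uncurry.comp (continuous_snd.prodMk hw)))
    (F.hasCompactSupport.mono fun q hq h0 => hq ?_)
  exact DFunLike.congr_fun ((congrArg ρ.dualAlg h0).trans (map_zero ρ.dualAlg)) _

variable (p μ α) in
theorem exists_isPhi₁ : ∃ Φ : Crossed p μ (dualAction p (Measure.count : Measure G) α) →ₙₐ[ℂ]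
    Crossed p (Measure.count : Measure G) (dualTensor μ α p), IsPhi₁ Φ := by
  obtain ⟨Φ, hΦ, hof⟩ := Crossed.exists_hom_of_compatible
    (e := Crossed.of p μ (dualAction p (Measure.count : Measure G) α) ∘ₗ
      curryCcLinear p Measure.count α)
    (Crossed.denseRange_of_curryCc μ _)
    (curryCcLinear p μ (trivialAction (PontryaginDual G) A) ∘ₗ swapTwistCc)
    (fun ρ : CovRep p (dualTensor μ α p) => ρ.swapRep.integratedHom μ)
    (fun ρ => ρ.swapRep.norm_integratedHom_le)
    (fun ρ F => (ρ.swapRep.integratedHom_of _).trans (ρ.swapRep_integrated F))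
  exact ⟨Φ, hΦ, fun F => ⟨swapTwistCc F, fun s γ => rfl, hof F⟩⟩

end Swap

/-! ### The homomorphism `Φ₂` -/

section Fourier

variable {G A : Type u} [CommGroup G] [TopologicalSpace G] [IsTopologicalGroup G]
  [DiscreteTopology G] [NormedRing A] [NormedAlgebra ℂ A] [CompleteSpace A]
  [MeasurableSpace (PontryaginDual G)] [BorelSpace (PontryaginDual G)]
  {p : ℝ≥0∞} [Fact (1 ≤ p)] {μ : Measure (PontryaginDual G)} [IsProbabilityMeasure μ]
  [μ.IsMulLeftInvariant] {α : IsometricAction G A}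

variable (μ) in
/-- The partial Fourier transform implementing `Φ₂` on functions. -/
def partialFourier : C_c(G × PontryaginDual G, A) →ₗ[ℂ] C_c(G, C₀(G, A)) where
  toFun F :=
    { toFun := fun s => fourierC0 μ (slice F s)
      continuous_toFun := continuous_of_discreteTopology
      hasCompactSupport' := by
        refine HasCompactSupport.intro (F.hasCompactSupport.isCompact.image continuous_fst)
          fun s hs => ?_
        have hslice : slice F s = 0 := CompactlySupportedContinuousMap.ext fun γ =>
          image_eq_zero_of_notMem_tsupport (x := (s, γ)) fun h => hs ⟨(s, γ), h, rfl⟩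
        rw [hslice, map_zero] }
  map_add' F F' := by
    ext1 s
    exact map_add (fourierC0 μ) (slice F s) (slice F' s)
  map_smul' c F := by
    ext1 s
    exact map_smul (fourierC0 μ) c (slice F s)

section CharRep

variable [NormOneClass A] (ρ : CovRep p (ltTensor α))

/-- The covariant representation of `(Ĝ, A, β)` obtained by letting `A` act on `C₀(G, A)` by
multiplication and `γ ∈ Ĝ` by multiplication with the conjugate character. -/
def CovRep.charRep : CovRep p (trivialAction (PontryaginDual G) A) :=
  (c0MultiplierSystem G A).covRep (c0_hasContractiveLeftApproxUnit G A) ρ.toNondegenerateRep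

theorem CovRep.integrated_charRep (f : C_c(PontryaginDual G, A)) :
    ρ.charRep.integrated μ f = ρ.π (fourierC0 μ f) :=
  MultiplierSystem.integrated_covRep _ _ _ fun g => integral_c0MultiplierSystem μ f g

variable (μ) in
/-- The integrated form of `ρ.charRep`, as operators on the space of `ρ`. -/
def CovRep.charHom :
    Crossed p μ (trivialAction (PontryaginDual G) A) →ₙₐ[ℂ] (ρ.E →L[ℂ] ρ.E) :=
  ρ.charRep.integratedHom μ

theorem CovRep.charHom_of (f : C_c(PontryaginDual G, A)) :
    ρ.charHom μ (Crossed.of p μ _ f) = ρ.π (fourierC0 μ f) :=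
  (ρ.charRep.integratedHom_of f).trans (ρ.integrated_charRep f)

end CharRep

variable [MeasurableSpace G] [BorelSpace G]

theorem fourierC0_dualTensor (s : G) (f : C_c(PontryaginDual G, A)) :
    fourierC0 μ ((actEquivariant α s).compCc (twistCc (evalChar s⁻¹) f)) =
      (ltTensor α).act s (fourierC0 μ f) := by
  ext t
  rw [ltTensor_apply, fourierC0_apply, fourierC0_apply]
  refine Eq.trans (integral_congr_ae (.of_forall fun γ => ?_))
    ((α.clm s).integral_comp_comm (integrable_coeff μ (map_continuous f) (s⁻¹ * t)))
  have hγ : starRingEnd ℂ (γ t : ℂ) * (γ s : ℂ) = starRingEnd ℂ (γ (s⁻¹ * t) : ℂ) := by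
    rw [map_mul, map_inv, Circle.coe_mul, Circle.coe_inv_eq_conj, map_mul, Complex.conj_conj,
      mul_comm]
  change starRingEnd ℂ (γ t : ℂ) • (actEquivariant α s).compCc _ γ =
    α.act s (starRingEnd ℂ (γ (s⁻¹ * t) : ℂ) • f γ)
  rw [dualTensor_formula, map_smul, smul_smul, hγ]

variable [NormOneClass A] (ρ : CovRep p (ltTensor α))

theorem CovRep.v_mul_charHom (s : G)
    (x : Crossed p μ (trivialAction (PontryaginDual G) A)) :
    ρ.v s * ρ.charHom μ x = ρ.charHom μ (dualTensorMap μ α p s x) * ρ.v s := by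
  refine CovRep.mul_integratedHom ρ.charRep (W := ρ.v s) (continuous_dualTensorMap μ α s)
    (fun f => ?_) x
  rw [ρ.integrated_charRep, dualTensorMap_of]
  refine (ρ.v_mul_π s _).trans (congrArg (fun T : ρ.E →L[ℂ] ρ.E => T * ρ.v s) ?_)
  exact ((ρ.charHom_of _).trans (congrArg ρ.π (fourierC0_dualTensor s f))).symm

variable [μ.IsOpenPosMeasure]

variable (μ) in
/-- The covariant representation of `(G, F^p(Ĝ, A, β), β̂ ⊗ α)` induced by one of
`(G, C₀(G, A), lt ⊗ α)`. -/
def CovRep.fourierRep : CovRep p (dualTensor μ α p) where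
  X := ρ.X
  ν := ρ.ν
  π := ρ.charHom μ
  v := ρ.v
  norm_π_le := ρ.charRep.norm_integratedHom_le
  nondegenerate := (ρ.charRep.integratedRep μ).nondegenerate
  norm_v := ρ.norm_v
  continuous_v := ρ.continuous_v
  covariant s x := conj_eq_of_mul_eq_mul ρ.v (ρ.v_mul_charHom s x)

theorem CovRep.integrated_fourierRep (F : C_c(G × PontryaginDual G, A)) :
    (ρ.fourierRep μ).integrated Measure.count
        (curryCc p μ (trivialAction (PontryaginDual G) A) F) =
      ρ.integrated Measure.count (partialFourier μ F) :=
  ContinuousLinearMap.ext fun ξ => integral_congr_ae (.of_forall fun s =>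
    DFunLike.congr_fun (ρ.charHom_of (slice F s)) (ρ.v s ξ))

variable (p μ α) in
theorem exists_isPhi₂ : ∃ Φ : Crossed p (Measure.count : Measure G) (dualTensor μ α p) →ₙₐ[ℂ]
    Crossed p (Measure.count : Measure G) (ltTensor α), IsPhi₂ Φ := by
  obtain ⟨Φ, hΦ, hof⟩ := Crossed.exists_hom_of_compatible
    (e := Crossed.of p (Measure.count : Measure G) (dualTensor μ α p) ∘ₗ
      curryCcLinear p μ (trivialAction (PontryaginDual G) A))
    (Crossed.denseRange_of_curryCc Measure.count _) (partialFourier μ)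
    (fun ρ : CovRep p (ltTensor α) => (ρ.fourierRep μ).integratedHom Measure.count)
    (fun ρ => (ρ.fourierRep μ).norm_integratedHom_le)
    (fun ρ F => ((ρ.fourierRep μ).integratedHom_of _).trans (ρ.integrated_fourierRep F))
  exact ⟨Φ, hΦ, fun F => ⟨partialFourier μ F, fun s t => rfl, hof F⟩⟩

end Fourier

/-! ### The homomorphism `Φ₃` -/

section Untwist

variable {G A : Type u} [CommGroup G] [TopologicalSpace G] [IsTopologicalGroup G]
  [DiscreteTopology G] [NormedRing A] [NormedAlgebra ℂ A]

/-- The endomorphism `f ↦ (t ↦ α_{σ(t)}(f t))` of `C₀(G, A)`. -/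
def c0Twist (α : IsometricAction G A) (σ : G → G) : C₀(G, A) →ₙₐ[ℂ] C₀(G, A) :=
  { c0Fiberwise (fun t => α.clm (σ t)) zero_le_one (fun t =>
      ContinuousLinearMap.opNorm_le_bound _ zero_le_one fun a =>
        (α.norm_act (σ t) a).le.trans_eq (one_mul _).symm) with
    map_zero' := map_zero (c0Fiberwise (fun t => α.clm (σ t)) _ _)
    map_mul' := fun f g => by
      ext t
      exact map_mul (α.act (σ t)) (f t) (g t) }

variable [CompleteSpace A]

/-- The equivariant isomorphism `f ↦ (t ↦ α_t⁻¹(f t))` from `lt ⊗ α` to `lt ⊗ id`. -/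
def untwistEquivariant (α : IsometricAction G A) :
    EquivariantHom (ltTensor α) (ltTensor (trivialAction G A)) where
  hom := c0Twist α fun t => t⁻¹
  norm_hom_le f := norm_c0_le (norm_nonneg _) fun t =>
    (α.norm_act _ _).trans_le (norm_c0_apply_le f t)
  denseRange_hom := Function.Surjective.denseRange fun f =>
    ⟨c0Twist α id f, ZeroAtInftyContinuousMap.ext fun t => α.act_inv_act t (f t)⟩
  equivariant s f := by
    ext t
    change α.act t⁻¹ (α.act s (f (s⁻¹ * t))) = α.act (s⁻¹ * t)⁻¹ (f (s⁻¹ * t))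
    rw [← α.act_mul, mul_inv_rev, inv_inv]

variable [MeasurableSpace G] [BorelSpace G] (p : ℝ≥0∞) [Fact (1 ≤ p)]

theorem isPhi₃_map (α : IsometricAction G A) :
    IsPhi₃ (Crossed.map p (Measure.count : Measure G) (untwistEquivariant α)) where
  continuous := Crossed.continuous_map _
  formula F := ⟨(untwistEquivariant α).compCc F, fun _ _ => rfl, Crossed.map_of _ F⟩

end Untwist

/-! ### Uniqueness and equivariance -/

section Equivariance

variable {G A : Type u} [CommGroup G] [TopologicalSpace G] [IsTopologicalGroup G]
  [DiscreteTopology G] [NormedRing A] [NormedAlgebra ℂ A] [CompleteSpace A]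
  [MeasurableSpace G] [BorelSpace G]
  {p : ℝ≥0∞} [Fact (1 ≤ p)] {α : IsometricAction G A}

theorem IsPhi₃.eq {Φ Φ' : Crossed p (Measure.count : Measure G) (ltTensor α) →ₙₐ[ℂ]
      Crossed p (Measure.count : Measure G) (ltTensor (trivialAction G A))}
    (h : IsPhi₃ Φ) (h' : IsPhi₃ Φ') : Φ = Φ' := by
  refine DFunLike.coe_injective (Crossed.denseRange_of.equalizer
    h.continuous h'.continuous (funext fun F => ?_))
  obtain ⟨F₁, hF₁, h₁⟩ := h.formula F
  obtain ⟨F₂, hF₂, h₂⟩ := h'.formula F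
  have hF : F₁ = F₂ := by
    ext s t
    rw [hF₁, hF₂]
  exact h₁.trans (hF ▸ h₂.symm)

variable [MeasurableSpace (PontryaginDual G)] [BorelSpace (PontryaginDual G)]
  {μ : Measure (PontryaginDual G)} [IsProbabilityMeasure μ] [μ.IsMulLeftInvariant]

theorem IsPhi₁.eq {Φ Φ' : Crossed p μ (dualAction p (Measure.count : Measure G) α) →ₙₐ[ℂ]
      Crossed p (Measure.count : Measure G) (dualTensor μ α p)}
    (h : IsPhi₁ Φ) (h' : IsPhi₁ Φ') : Φ = Φ' := by
  refine DFunLike.coe_injective ((Crossed.denseRange_of_curryCc μ _).equalizer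
    h.continuous h'.continuous (funext fun F => ?_))
  obtain ⟨F₁, hF₁, h₁⟩ := h.formula F
  obtain ⟨F₂, hF₂, h₂⟩ := h'.formula F
  have hF : F₁ = F₂ := by
    ext ⟨s, γ⟩
    rw [hF₁, hF₂]
  exact h₁.trans (hF ▸ h₂.symm)

theorem IsPhi₂.eq {Φ Φ' : Crossed p (Measure.count : Measure G) (dualTensor μ α p) →ₙₐ[ℂ]
      Crossed p (Measure.count : Measure G) (ltTensor α)}
    (h : IsPhi₂ Φ) (h' : IsPhi₂ Φ') : Φ = Φ' := by
  refine DFunLike.coe_injective ((Crossed.denseRange_of_curryCc Measure.count _).equalizer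
    h.continuous h'.continuous (funext fun F => ?_))
  obtain ⟨F₁, hF₁, h₁⟩ := h.formula F
  obtain ⟨F₂, hF₂, h₂⟩ := h'.formula F
  have hF : F₁ = F₂ := by
    ext s t
    rw [hF₁, hF₂]
  exact h₁.trans (hF ▸ h₂.symm)

/-- The function `(γ, s) ↦ conj (γ(r)) F(γ, s)`, on which `α̂̂_r F` is modelled. -/
def twistFstCc (r : G) (F : C_c(PontryaginDual G × G, A)) : C_c(PontryaginDual G × G, A) where
  toFun q := starRingEnd ℂ (q.1 r : ℂ) • F q
  continuous_toFun :=
    (Complex.continuous_conj.comp ((continuous_dual_apply r).comp continuous_fst)).smul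
      (map_continuous F)
  hasCompactSupport' := F.hasCompactSupport.mono fun q hq h0 => hq (by simp only [h0, smul_zero])

theorem doubleDualAction_of_curryCc (r : G) (F : C_c(PontryaginDual G × G, A)) :
    (doubleDualAction μ α p).act r (Crossed.of p μ _ (curryCc p Measure.count α F)) =
      Crossed.of p μ _ (curryCc p Measure.count α (twistFstCc r F)) := by
  rw [doubleDualAction_of]
  congr 1
  ext γ
  rw [twistCc_apply, curryCc_apply, curryCc_apply, ← map_smul]
  rfl

variable {Φ₁ : Crossed p μ (dualAction p (Measure.count : Measure G) α) →ₙₐ[ℂ]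
    Crossed p (Measure.count : Measure G) (dualTensor μ α p)}
  {Φ₂ : Crossed p (Measure.count : Measure G) (dualTensor μ α p) →ₙₐ[ℂ]
    Crossed p (Measure.count : Measure G) (ltTensor α)}
  {Φ₃ : Crossed p (Measure.count : Measure G) (ltTensor α) →ₙₐ[ℂ]
    Crossed p (Measure.count : Measure G) (ltTensor (trivialAction G A))}

theorem IsPhi₁.comp_formula (h₁ : IsPhi₁ Φ₁) (h₂ : IsPhi₂ Φ₂) (h₃ : IsPhi₃ Φ₃)
    (F : C_c(PontryaginDual G × G, A)) : ∃ F' : C_c(G, C₀(G, A)),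
      (∀ s t, F' s t = α.act t⁻¹
        (∫ γ, starRingEnd ℂ (γ t : ℂ) • (γ s : ℂ) • F (γ, s) ∂μ)) ∧
      Φ₃ (Φ₂ (Φ₁ (Crossed.of p μ _ (curryCc p Measure.count α F)))) =
        Crossed.of p Measure.count _ F' := by
  obtain ⟨F₁, hF₁, e₁⟩ := h₁.formula F
  obtain ⟨F₂, hF₂, e₂⟩ := h₂.formula F₁
  obtain ⟨F₃, hF₃, e₃⟩ := h₃.formula F₂
  refine ⟨F₃, fun s t => ?_, by rw [e₁, e₂, e₃]⟩
  rw [hF₃, hF₂]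
  simp only [hF₁]

theorem IsPhi₁.comp_equivariant (h₁ : IsPhi₁ Φ₁) (h₂ : IsPhi₂ Φ₂) (h₃ : IsPhi₃ Φ₃) (r : G)
    (x : Crossed p μ (dualAction p (Measure.count : Measure G) α)) :
    (Φ₃.comp (Φ₂.comp Φ₁)) ((doubleDualAction μ α p).act r x) =
      (rtTensorId α p).act r ((Φ₃.comp (Φ₂.comp Φ₁)) x) := by
  have hcont : Continuous (Φ₃.comp (Φ₂.comp Φ₁)) :=
    h₃.continuous.comp (h₂.continuous.comp h₁.continuous)
  refine (Crossed.denseRange_of_curryCc μ _).induction_on x (isClosed_eq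
    (hcont.comp (Crossed.continuous_twist _)) ((Crossed.continuous_map _).comp hcont)) fun F => ?_
  obtain ⟨F', hF', e⟩ := h₁.comp_formula h₂ h₃ F
  obtain ⟨F'', hF'', e'⟩ := h₁.comp_formula h₂ h₃ (twistFstCc r F)
  have hrt : F'' = (rtEquivariant α r).compCc F' := by
    ext s t
    rw [hF'', rtTensorId_formula, hF', ← α.act_mul, mul_inv_rev, mul_inv_cancel_left]
    congr 2
    ext1 γ
    change starRingEnd ℂ (γ t : ℂ) • (γ s : ℂ) • starRingEnd ℂ (γ r : ℂ) • F (γ, s) = _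
    rw [map_mul, Circle.coe_mul, map_mul, smul_smul, smul_smul, smul_smul]
    congr 1
    ring
  calc Φ₃ (Φ₂ (Φ₁ ((doubleDualAction μ α p).act r _)))
      = Crossed.of p Measure.count _ F'' := by rw [doubleDualAction_of_curryCc, e']
    _ = (rtTensorId α p).act r (Crossed.of p Measure.count _ F') := by
        rw [hrt]
        exact (Crossed.map_of (rtEquivariant α r) F').symm
    _ = (rtTensorId α p).act r (Φ₃ (Φ₂ (Φ₁ _))) := by rw [e]

end Equivariance

end LpCrossed

end

theorem lemma3p8_general {G A : Type u} [CommGroup G] [TopologicalSpace G] [IsTopologicalGroup G]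
    [DiscreteTopology G] [MeasurableSpace G] [BorelSpace G]
    [MeasurableSpace (PontryaginDual G)] [BorelSpace (PontryaginDual G)]
    (μ : Measure (PontryaginDual G)) [μ.IsHaarMeasure] [IsProbabilityMeasure μ]
    [NormedRing A] [NormOneClass A] [NormedAlgebra ℂ A] [CompleteSpace A]
    (p : ℝ≥0∞) [Fact (1 ≤ p)]
    (α : IsometricAction G A) :
    (∃! Φ₁ : Crossed p μ (dualAction p (Measure.count : Measure G) α) →ₙₐ[ℂ]
        Crossed p (Measure.count : Measure G) (dualTensor μ α p),
      IsPhi₁ Φ₁) ∧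
    (∃! Φ₂ : Crossed p (Measure.count : Measure G) (dualTensor μ α p) →ₙₐ[ℂ]
        Crossed p (Measure.count : Measure G) (ltTensor α),
      IsPhi₂ Φ₂) ∧
    (∃! Φ₃ : Crossed p (Measure.count : Measure G) (ltTensor α) →ₙₐ[ℂ]
        Crossed p (Measure.count : Measure G)
          (ltTensor (trivialAction G A)),
      IsPhi₃ Φ₃) ∧
    ∀ (Φ₁ : Crossed p μ (dualAction p (Measure.count : Measure G) α) →ₙₐ[ℂ]
        Crossed p (Measure.count : Measure G) (dualTensor μ α p))
      (Φ₂ : Crossed p (Measure.count : Measure G) (dualTensor μ α p) →ₙₐ[ℂ]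
        Crossed p (Measure.count : Measure G) (ltTensor α))
      (Φ₃ : Crossed p (Measure.count : Measure G) (ltTensor α) →ₙₐ[ℂ]
        Crossed p (Measure.count : Measure G)
          (ltTensor (trivialAction G A))),
      IsPhi₁ Φ₁ → IsPhi₂ Φ₂ → IsPhi₃ Φ₃ →
      ∀ (r : G) (x : Crossed p μ
          (dualAction p (Measure.count : Measure G) α)),
        (Φ₃.comp (Φ₂.comp Φ₁)) ((doubleDualAction μ α p).act r x) =
          (rtTensorId α p).act r ((Φ₃.comp (Φ₂.comp Φ₁)) x) := by
  obtain ⟨Φ₁, h₁⟩ := exists_isPhi₁ p μ α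
  obtain ⟨Φ₂, h₂⟩ := exists_isPhi₂ p μ α
  exact ⟨⟨Φ₁, h₁, fun _ h => h.eq h₁⟩, ⟨Φ₂, h₂, fun _ h => h.eq h₂⟩,
    ⟨_, isPhi₃_map p α, fun _ h => h.eq (isPhi₃_map p α)⟩,
    fun _ _ _ k₁ k₂ k₃ r x => k₁.comp_equivariant k₂ k₃ r x⟩

theorem lemma3p8 {G A : Type u} [CommGroup G] [TopologicalSpace G] [IsTopologicalGroup G]
    [DiscreteTopology G] [Countable G] [MeasurableSpace G] [BorelSpace G]
    [MeasurableSpace (PontryaginDual G)] [BorelSpace (PontryaginDual G)]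
    (μ : Measure (PontryaginDual G)) [μ.IsHaarMeasure] [IsProbabilityMeasure μ]
    [NormedRing A] [NormOneClass A] [NormedAlgebra ℂ A] [CompleteSpace A]
    [TopologicalSpace.SeparableSpace A]
    (p : ℝ≥0∞) [Fact (1 ≤ p)] (hp : p ≠ ∞)
    (hA : IsLpOperatorAlgebra p A) (hU : HasUniqueLpMatrixNorms p A)
    (α : IsometricAction G A) :
    (∃! Φ₁ : Crossed p μ (dualAction p (Measure.count : Measure G) α) →ₙₐ[ℂ]
        Crossed p (Measure.count : Measure G) (dualTensor μ α p),
      IsPhi₁ Φ₁) ∧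
    (∃! Φ₂ : Crossed p (Measure.count : Measure G) (dualTensor μ α p) →ₙₐ[ℂ]
        Crossed p (Measure.count : Measure G) (ltTensor α),
      IsPhi₂ Φ₂) ∧
    (∃! Φ₃ : Crossed p (Measure.count : Measure G) (ltTensor α) →ₙₐ[ℂ]
        Crossed p (Measure.count : Measure G)
          (ltTensor (trivialAction G A)),
      IsPhi₃ Φ₃) ∧
    ∀ (Φ₁ : Crossed p μ (dualAction p (Measure.count : Measure G) α) →ₙₐ[ℂ]
        Crossed p (Measure.count : Measure G) (dualTensor μ α p))
      (Φ₂ : Crossed p (Measure.count : Measure G) (dualTensor μ α p) →ₙₐ[ℂ]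
        Crossed p (Measure.count : Measure G) (ltTensor α))
      (Φ₃ : Crossed p (Measure.count : Measure G) (ltTensor α) →ₙₐ[ℂ]
        Crossed p (Measure.count : Measure G)
          (ltTensor (trivialAction G A))),
      IsPhi₁ Φ₁ → IsPhi₂ Φ₂ → IsPhi₃ Φ₃ →
      ∀ (r : G) (x : Crossed p μ
          (dualAction p (Measure.count : Measure G) α)),
        (Φ₃.comp (Φ₂.comp Φ₁)) ((doubleDualAction μ α p).act r x) =
          (rtTensorId α p).act r ((Φ₃.comp (Φ₂.comp Φ₁)) x) :=
  lemma3p8_general μ p α
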